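/- Let $\mathfrak X$ be a complex Banach space. For a strongly continuous semigroup $\{U(t)\}_{t\ge 0}$ the generator $A$ is defined with the sign convention $U(t)=e^{-tA}$, i.e. $Ax=\lim_{t\to+0}(x-U(t)x)/t$ on the set $\mathrm{dom}(A)$ of all $x$ for which the limit exists; $A^*$ denotes the adjoint in the dual space $\mathfrak X^*$. Let $0<\theta\le\pi/2$ and let $A$ be the generator of a holomorphic contraction semigroup of semi-angle $\theta$, that is, $\{e^{-tA}\}_{t\ge0}$ is a strongly continuous semigroup of contractions and is the restriction to the half-line of a bounded holomorphic semigroup $\{e^{-zA}\}$ on the sector $S_\theta=\{z\ne0:\ |\arg z|<\theta\}$ (bounded on each $S_{\theta-\epsilon}$, $0<\epsilon<\theta$, analytic and multiplicative on $S_\theta$, strongly convergent to the identity as $z\to0$ in each $S_{\theta-\epsilon}$). Let $B$ be the generator of a strongly continuous contraction semigroup $\{e^{-tB}\}_{t\ge0}$. Let $\alpha\in[0,1)$ and let $A^\alpha$ be the fractional power of $A$ ($A^0=\mathbb 1$; for $0<\alpha<1$, the closure of the operator $x\mapsto\Gamma(-\alpha)^{-1}\int_0^\infty\lambda^{-\alpha-1}(e^{-\lambda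 A}-\mathbb 1)x\,d\lambda$, $x\in\mathrm{dom}(A)$). Suppose that $$\mathrm{dom}((A^\alpha)^*)\subseteq\mathrm{dom}(B^*),\qquad \mathrm{dom}(A)\subseteq\mathrm{dom}(B),$$ and, if $\mathfrak X$ is not reflexive, that in addition $\mathrm{dom}(A^*)\subseteq\mathrm{dom}(B^*)$. Then there is a strongly continuous contraction semigroup, denoted $\{e^{-t(A+B)}\}_{t\ge0}$, whose generator $H$ extends the algebraic sum $A+B$ (with domain $\mathrm{dom}(A)$) and satisfies $H^*=A^*+B^*$ (with domain $\mathrm{dom}(A^*)$); if the algebraic sum $A+B$ on $\mathrm{dom}(A)$ is itself the generator of a strongly continuous semigroup, then that semigroup is $\{e^{-t(A+B)}\}_{t\ge0}$. Moreover there are constants $M_3,M_4,\tilde M_4,\eta>0$ such that for all $t\ge0$ and all integers $n>2$ $$\left\|\left(e^{-tA/n}e^{-tB/n}\right)^n-e^{-t(A+B)}\right\|\le e^{\eta t}\,(M_3+M_4\,t^{1-\alpha})\,\frac{\ln n}{n^{1-\alpha}}\qquad\text{if }\alpha>0,$$ $$\left\|\left(e^{-tA/n}e^{-tB/n}\right)^n-e^{-t(A+B)}\right\|\le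 e^{\eta t}\,(M_3+\tilde M_4\,t)\,\frac{2(\ln n)^2}{n}\qquad\text{if }\alpha=0.$$ -/

import Mathlib

open Filter Topology MeasureTheory Set
open scoped NNReal

noncomputable section

namespace TrotterProduct

variable {X : Type*} [NormedAddCommGroup X] [NormedSpace ℂ X]

/-! ### Strongly continuous semigroups and their generators -/

/-- `T` is a one-parameter strongly continuous semigroup of bounded linear operators. -/
structure IsC0Semigroup (T : ℝ≥0 → X →L[ℂ] X) : Prop where
  map_zero : T 0 = 1
  map_add : ∀ s t : ℝ≥0, T (s + t) = T s * T t
  tendsto_zero : ∀ x : X, Tendsto (fun t : ℝ≥0 => T t x) (𝓝[>] 0) (𝓝 x)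

/-- A strongly continuous semigroup of contractions. -/
structure IsContractionSemigroup (T : ℝ≥0 → X →L[ℂ] X) : Prop extends IsC0Semigroup T where
  norm_le_one : ∀ t : ℝ≥0, ‖T t‖ ≤ 1

/-- The graph of the generator: pairs `(x, y)` with `y = lim_{t → 0+} (x - T(t) x) / t`. -/
def generatorGraph (T : ℝ≥0 → X →L[ℂ] X) : Submodule ℂ (X × X) where
  carrier := {p | Tendsto (fun t : ℝ≥0 => (((t : ℝ) : ℂ)⁻¹) • (p.1 - T t p.1)) (𝓝[>] 0) (𝓝 p.2)}
  add_mem' := by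
    intro p q hp hq
    refine (hp.add hq).congr fun t => ?_
    simp only [Prod.fst_add, _root_.map_add, ← smul_add]
    congr 1
    abel
  zero_mem' := by simp
  smul_mem' := by
    intro c p hp
    refine (hp.const_smul c).congr fun t => ?_
    simp only [Prod.smul_fst, map_smul, ← smul_sub]
    rw [smul_comm]

/-- The generator `A` of the semigroup `T`, with the sign convention `T(t) = exp(-tA)`. -/
def generator (T : ℝ≥0 → X →L[ℂ] X) : X →ₗ.[ℂ] X := (generatorGraph T).toLinearPMap

theorem mem_graph_generator (T : ℝ≥0 → X →L[ℂ] X) (x y : X) :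
    (x, y) ∈ (generator T).graph ↔
      Tendsto (fun t : ℝ≥0 => (((t : ℝ) : ℂ)⁻¹) • (x - T t x)) (𝓝[>] 0) (𝓝 y) := by
  unfold generator
  rw [Submodule.toLinearPMap_graph_eq]
  · rfl
  · rintro ⟨a, b⟩ h (rfl : a = 0)
    have h' : Tendsto (fun t : ℝ≥0 => (((t : ℝ) : ℂ)⁻¹) • ((0 : X) - T t 0)) (𝓝[>] 0) (𝓝 b) := h
    simp only [_root_.map_zero, sub_zero, smul_zero] at h'
    exact tendsto_nhds_unique h' tendsto_const_nhds

/-! ### Holomorphic contraction semigroups -/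

/-- The open sector of semi-angle `θ` around the positive half-line. -/
def sector (θ : ℝ) : Set ℂ := {z | z ≠ 0 ∧ |z.arg| < θ}

/-- `W` is a bounded holomorphic semigroup of semi-angle `θ`. -/
structure IsBoundedHolomorphicSemigroup (θ : ℝ) (W : ℂ → X →L[ℂ] X) : Prop where
  bounded : ∀ ε : ℝ, 0 < ε → ε < θ → ∃ M : ℝ, ∀ z ∈ sector (θ - ε), ‖W z‖ ≤ M
  mul : ∀ z ∈ sector θ, ∀ w ∈ sector θ, W z * W w = W (z + w)
  analytic : AnalyticOnNhd ℂ W (sector θ)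
  tendsto_zero : ∀ ε : ℝ, 0 < ε → ε < θ → ∀ x : X,
    Tendsto (fun z => W z x) (𝓝[sector (θ - ε)] 0) (𝓝 x)

/-- `T` is a holomorphic contraction semigroup of semi-angle `θ`: a strongly continuous
contraction semigroup on the half-line which is the restriction of a bounded holomorphic semigroup
of semi-angle `θ`. -/
structure IsHolomorphicContractionSemigroup (θ : ℝ) (T : ℝ≥0 → X →L[ℂ] X) : Prop
    extends IsContractionSemigroup T where
  exists_extension : ∃ W : ℂ → X →L[ℂ] X, IsBoundedHolomorphicSemigroup θ W ∧
    ∀ t : ℝ≥0, 0 < t → W ((t : ℝ) : ℂ) = T t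

/-! ### Adjoints in the dual space, reflexivity -/

/-- The graph of the Banach space adjoint: pairs `(φ, ψ)` of bounded functionals such that
`φ (T x) = ψ x` for all `x ∈ dom T`. -/
def dualAdjointGraph (T : X →ₗ.[ℂ] X) : Submodule ℂ (StrongDual ℂ X × StrongDual ℂ X) where
  carrier := {p | ∀ x : T.domain, p.1 (T x) = p.2 x}
  add_mem' := by
    intro p q hp hq x
    simp [hp x, hq x]
  zero_mem' := by simp
  smul_mem' := by
    intro c p hp x
    simp [hp x]

/-- The adjoint `T*` (in the dual space) of a densely defined operator `T`. -/
def dualAdjoint (T : X →ₗ.[ℂ] X) : StrongDual ℂ X →ₗ.[ℂ] StrongDual ℂ X :=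
  (dualAdjointGraph T).toLinearPMap

theorem mem_dualAdjoint_domain (T : X →ₗ.[ℂ] X) (φ : StrongDual ℂ X) :
    φ ∈ (dualAdjoint T).domain ↔ ∃ ψ : StrongDual ℂ X, ∀ x : T.domain, φ (T x) = ψ x := by
  simp [dualAdjoint, Submodule.toLinearPMap_domain, dualAdjointGraph]

theorem mem_graph_dualAdjoint (T : X →ₗ.[ℂ] X) (hT : Dense (T.domain : Set X))
    (φ ψ : StrongDual ℂ X) :
    (φ, ψ) ∈ (dualAdjoint T).graph ↔ ∀ x : T.domain, φ (T x) = ψ x := by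
  unfold dualAdjoint
  rw [Submodule.toLinearPMap_graph_eq]
  · rfl
  · rintro ⟨a, b⟩ h (rfl : a = 0)
    refine DFunLike.coe_injective (Continuous.ext_on hT b.continuous continuous_const ?_)
    intro x hx
    exact ((h ⟨x, hx⟩).symm.trans rfl)

/-- A normed space is reflexive if the canonical embedding in its bidual is onto. -/
def IsReflexiveSpace (X : Type*) [NormedAddCommGroup X] [NormedSpace ℂ X] : Prop :=
  Function.Surjective (NormedSpace.inclusionInDoubleDual ℂ X)

/-! ### Fractional powers of generators -/

/-- The integrand `λ ^ (-α-1) (T(λ) x - x)`. -/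
def fracIntegrand (T : ℝ≥0 → X →L[ℂ] X) (α : ℝ) (x : X) (l : ℝ) : X :=
  ((l ^ (-α - 1) : ℝ) : ℂ) • (T l.toNNReal x - x)

/-- The operator `x ↦ Γ(-α)⁻¹ ∫₀^∞ λ ^ (-α-1) (T(λ) x - x) dλ` on the domain of the generator of
`T`. The integrability requirement in the domain, which makes linearity immediate, is automatic for
contraction semigroups and `0 < α < 1`, see `fracPowerOnGenerator_domain`. -/
def fracPowerOnGenerator (T : ℝ≥0 → X →L[ℂ] X) (α : ℝ) : X →ₗ.[ℂ] X where
  domain :=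
    { carrier := {x | x ∈ (generator T).domain ∧ IntegrableOn (fracIntegrand T α x) (Ioi 0)}
      add_mem' := by
        rintro x y ⟨hx, hx'⟩ ⟨hy, hy'⟩
        refine ⟨Submodule.add_mem _ hx hy, (hx'.add hy').congr (ae_of_all _ fun l => ?_)⟩
        simp only [Pi.add_apply, fracIntegrand, _root_.map_add, ← smul_add]
        congr 1
        abel
      zero_mem' := by
        refine ⟨Submodule.zero_mem _, ?_⟩
        have : fracIntegrand T α (0 : X) = fun _ => 0 := by ext l; simp [fracIntegrand]
        rw [this]
        exact integrableOn_zero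
      smul_mem' := by
        rintro c x ⟨hx, hx'⟩
        refine ⟨Submodule.smul_mem _ c hx, (hx'.smul c).congr (ae_of_all _ fun l => ?_)⟩
        simp only [Pi.smul_apply, fracIntegrand, map_smul, ← smul_sub]
        rw [smul_comm] }
  toFun :=
    { toFun := fun x =>
        (((Real.Gamma (-α))⁻¹ : ℝ) : ℂ) • ∫ l in Ioi (0 : ℝ), fracIntegrand T α (x : X) l
      map_add' := by
        rintro ⟨x, hx, hx'⟩ ⟨y, hy, hy'⟩
        rw [← smul_add, ← integral_add hx' hy']
        congr 1
        refine integral_congr_ae (ae_of_all _ fun l => ?_)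
        simp only [fracIntegrand, Submodule.coe_add, _root_.map_add, ← smul_add]
        congr 1
        abel
      map_smul' := by
        rintro c ⟨x, hx, hx'⟩
        rw [RingHom.id_apply, smul_comm c, ← integral_smul c (fracIntegrand T α x)]
        congr 1
        refine integral_congr_ae (ae_of_all _ fun l => ?_)
        simp only [fracIntegrand, Submodule.coe_smul, map_smul, ← smul_sub]
        rw [smul_comm] }

/-- The fractional power `A ^ α`, `0 ≤ α < 1`, of the generator `A` of the bounded semigroup `T`:
the identity for `α = 0`; for `0 < α < 1` the closure of the operator given by the integral formula
on `dom A` (`dom A` is a core of `A ^ α`). -/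
def fracPower (T : ℝ≥0 → X →L[ℂ] X) (α : ℝ) : X →ₗ.[ℂ] X :=
  if α = 0 then (LinearMap.id : X →ₗ[ℂ] X).toPMap ⊤ else (fracPowerOnGenerator T α).closure

theorem IsContractionSemigroup.continuous {T : ℝ≥0 → X →L[ℂ] X} (hT : IsContractionSemigroup T)
    (x : X) : Continuous fun t => T t x := by
  have key : ∀ s d : ℝ≥0, ‖T (s + d) x - T s x‖ ≤ ‖T d x - x‖ := by
    intro s d
    have h : T (s + d) x - T s x = T s (T d x - x) := by
      rw [hT.map_add, map_sub]; rfl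
    rw [h]
    exact ((T s).le_of_opNorm_le (hT.norm_le_one s) _).trans (one_mul _).le
  have h0 : Tendsto (fun t : ℝ≥0 => ‖T t x - x‖) (𝓝 0) (𝓝 0) := by
    have h1 : ContinuousWithinAt (fun t : ℝ≥0 => ‖T t x - x‖) (Ioi 0) 0 := by
      have := ((hT.tendsto_zero x).sub_const x).norm
      simpa [ContinuousWithinAt, hT.map_zero] using this
    have h2 := continuousWithinAt_insert_self.mpr h1
    have h3 : insert (0 : ℝ≥0) (Ioi 0) = univ := by
      ext t
      simp
    rw [h3, continuousWithinAt_univ] at h2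
    simpa [ContinuousAt, hT.map_zero] using h2
  rw [continuous_iff_continuousAt]
  intro s
  rw [ContinuousAt, tendsto_iff_norm_sub_tendsto_zero]
  have hd : Tendsto (fun t : ℝ≥0 => (t - s) + (s - t)) (𝓝 s) (𝓝 0) := by
    have hc : Continuous fun t : ℝ≥0 => (t - s) + (s - t) := by fun_prop
    simpa using hc.tendsto s
  refine squeeze_zero (fun _ => norm_nonneg _) (fun t => ?_) (h0.comp hd)
  rcases le_total s t with h | h
  · have := key s (t - s)
    rw [add_tsub_cancel_of_le h] at this
    simpa [tsub_eq_zero_of_le h] using this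
  · have := key t (s - t)
    rw [add_tsub_cancel_of_le h, norm_sub_rev] at this
    simpa [tsub_eq_zero_of_le h] using this

theorem fracPowerOnGenerator_domain {T : ℝ≥0 → X →L[ℂ] X} (hT : IsContractionSemigroup T)
    {α : ℝ} (h0 : 0 < α) (h1 : α < 1) :
    (fracPowerOnGenerator T α).domain = (generator T).domain := by
  refine le_antisymm (fun x hx => hx.1) fun x hx => ⟨hx, ?_⟩
  have hx2 := (mem_graph_generator T x (generator T ⟨x, hx⟩)).1
    ((generator T).mem_graph ⟨x, hx⟩)
  have hb := hx2.norm.eventually_le_const (lt_add_one ‖generator T ⟨x, hx⟩‖)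
  set C := ‖generator T ⟨x, hx⟩‖ + 1 with hC
  obtain ⟨δ, hδ, hδb⟩ := (mem_nhdsGT_iff_exists_Ioc_subset).1 hb
  have hδ' : (0 : ℝ) < δ := by exact_mod_cast hδ
  have hmeas : ∀ s : Set ℝ, MeasurableSet s → s ⊆ Ioi 0 →
      AEStronglyMeasurable (fracIntegrand T α x) (volume.restrict s) := by
    intro s hs hs0
    refine ContinuousOn.aestronglyMeasurable (fun l hl => ?_) hs
    have hl0 : (0 : ℝ) < l := hs0 hl
    refine ContinuousAt.continuousWithinAt ?_
    refine ContinuousAt.smul ?_ ?_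
    · exact Complex.continuous_ofReal.continuousAt.comp
        (Real.continuousAt_rpow_const _ _ (Or.inl hl0.ne'))
    · exact (((hT.continuous x).comp continuous_real_toNNReal).sub continuous_const).continuousAt
  have hnorm : ∀ l : ℝ, 0 < l →
      ‖fracIntegrand T α x l‖ = l ^ (-α - 1) * ‖T l.toNNReal x - x‖ := by
    intro l hl
    rw [fracIntegrand, norm_smul, Complex.norm_real, Real.norm_of_nonneg (Real.rpow_nonneg hl.le _)]
  rw [← Ioc_union_Ioi_eq_Ioi hδ'.le]
  refine IntegrableOn.union ?_ ?_
  · have hi : IntegrableOn (fun l : ℝ => C * l ^ (-α)) (Ioc 0 (δ : ℝ)) := by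
      have := intervalIntegral.intervalIntegrable_rpow' (a := 0) (b := (δ : ℝ)) (r := -α)
        (by linarith)
      exact ((intervalIntegrable_iff_integrableOn_Ioc_of_le hδ'.le).1 this).const_mul C
    refine Integrable.mono' hi (hmeas _ measurableSet_Ioc fun l hl => hl.1) ?_
    refine (ae_restrict_iff' measurableSet_Ioc).2 (ae_of_all _ fun l hl => ?_)
    have hl0 : 0 < l := hl.1
    have hmem : l.toNNReal ∈ Ioc (0 : ℝ≥0) δ :=
      ⟨Real.toNNReal_pos.2 hl0, Real.toNNReal_le_iff_le_coe.2 hl.2⟩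
    have hle : ‖(((l.toNNReal : ℝ) : ℂ)⁻¹) • (x - T l.toNNReal x)‖ ≤ C := hδb hmem
    rw [norm_smul, norm_inv, Complex.norm_real, Real.coe_toNNReal l hl0.le,
      Real.norm_of_nonneg hl0.le, inv_mul_le_iff₀ hl0, norm_sub_rev] at hle
    rw [hnorm l hl0]
    calc l ^ (-α - 1) * ‖T l.toNNReal x - x‖ ≤ l ^ (-α - 1) * (l * C) := by gcongr
      _ = C * l ^ (-α) := by
        rw [Real.rpow_sub_one hl0.ne']
        field_simp
  · have hi : IntegrableOn (fun l : ℝ => l ^ (-α - 1) * (2 * ‖x‖)) (Ioi (δ : ℝ)) :=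
      (integrableOn_Ioi_rpow_of_lt (by linarith) hδ').mul_const _
    refine Integrable.mono' hi (hmeas _ measurableSet_Ioi fun l hl => hδ'.trans hl) ?_
    refine (ae_restrict_iff' measurableSet_Ioi).2 (ae_of_all _ fun l hl => ?_)
    have hl0 : 0 < l := hδ'.trans hl
    rw [hnorm l hl0]
    gcongr
    have h2 := (T l.toNNReal).le_of_opNorm_le (hT.norm_le_one _) x
    have h3 := norm_sub_le (T l.toNNReal x) x
    linarith

end TrotterProduct

end

noncomputable section

namespace TrotterProduct

variable {X : Type*} [NormedAddCommGroup X] [NormedSpace ℂ X]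

/-! Notation: R = (A+m)⁻¹, V(τ) = e^{-τ(A+m)}, W(τ) = e^{-τ(H+m)}, D(τ) = (A+m)V(τ), F = V(τ)S(τ).

Construction of H. By the closed graph theorem, the inclusion of the adjoint domains bounds B* by
the graph norm of (A^α)*. Holomorphy makes T(s)A^α of order s^{-α}, so by duality ‖T(s)Bx‖ ≤
K(1+s^{-α})‖x‖ (`exists_smoothing`). Since α < 1 the singularity is integrable, and a Laplace
transform extends RB to a bounded operator G with ‖G‖ ≤ 1/2 for large m. The relation R(H+m) = 1+G
defines H; its resolvent is (1+G)⁻¹R, it is accretive, and Hille–Yosida applies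
(`exists_isPerturbation`). The same relation gives H* = A*+B*.

Error estimate. One step S(τ)V(τ) - W(τ) is not small in norm, but R times it is O(τ), and R times
it times R is O(τ²). In the telescoping sum (`norm_pow_sub_le`) the left R is paid for by D(τ), as
F^j V = F^j D R, and the right R by the smoothing of W^k. The norms of F^j D obey a discrete
Volterra inequality with kernel s^{-α} (`norm_pow_mul_smooth_le`, `discrete_volterra`), giving order
1/((j+1)τ). The powers W^k inherit the smoothing of V^k by Duhamel's formula
(`norm_mul_pow_sum_le`), at the price of ℓ, a bound for ∑ (i+1)^{-1-α}. The convolution of the two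
decays is of order (log n) ℓ / n^{1-α} (`sum_convolution_le`). For α > 0 the series converges and ℓ
is a constant; for α = 0 it is a second logarithm. -/

theorem tendsto_nnreal_iff {E : Type*} {f : ℝ≥0 → E} {l : Filter E} :
    Tendsto f (𝓝[>] 0) l ↔ Tendsto (fun t : ℝ => f t.toNNReal) (𝓝[>] 0) l := by
  constructor
  · intro h
    refine h.comp (tendsto_nhdsWithin_iff.2 ⟨?_, ?_⟩)
    · have : Tendsto Real.toNNReal (𝓝 0) (𝓝 0) := by
        simpa using continuous_real_toNNReal.tendsto 0
      exact this.mono_left nhdsWithin_le_nhds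
    · filter_upwards [self_mem_nhdsWithin] with t ht
      exact Real.toNNReal_pos.2 ht
  · intro h
    have h2 : Tendsto (fun t : ℝ≥0 => (t : ℝ)) (𝓝[>] 0) (𝓝[>] 0) := by
      refine tendsto_nhdsWithin_iff.2 ⟨?_, ?_⟩
      · have : Tendsto (fun t : ℝ≥0 => (t : ℝ)) (𝓝 0) (𝓝 0) := by
          simpa using NNReal.continuous_coe.tendsto 0
        exact this.mono_left nhdsWithin_le_nhds
      · filter_upwards [self_mem_nhdsWithin] with t ht
        exact NNReal.coe_pos.2 ht
    refine (h.comp h2).congr fun t => ?_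
    simp

/-! ### Generators as graphs, and derivatives of orbits -/

theorem mem_generatorGraph_iff {V : ℝ≥0 → X →L[ℂ] X} {x y : X} :
    (x, y) ∈ generatorGraph V ↔
      Tendsto (fun h : ℝ => h⁻¹ • (x - V h.toNNReal x)) (𝓝[>] 0) (𝓝 y) := by
  change Tendsto (fun t : ℝ≥0 => (((t : ℝ) : ℂ)⁻¹) • (x - V t x)) (𝓝[>] 0) (𝓝 y) ↔ _
  rw [tendsto_nnreal_iff]
  refine tendsto_congr' ?_
  filter_upwards [self_mem_nhdsWithin] with t ht
  rw [Real.coe_toNNReal t (le_of_lt ht), ← Complex.ofReal_inv, Complex.coe_smul]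

theorem mem_generator_domain {V : ℝ≥0 → X →L[ℂ] X} {x : X} :
    x ∈ (generator V).domain ↔ ∃ y, (x, y) ∈ generatorGraph V := by
  simp [generator, Submodule.toLinearPMap_domain]

theorem generator_graph (V : ℝ≥0 → X →L[ℂ] X) : (generator V).graph = generatorGraph V := by
  ext ⟨x, y⟩
  exact mem_graph_generator V x y

theorem generator_mem (V : ℝ≥0 → X →L[ℂ] X) (x : (generator V).domain) :
    ((x : X), generator V x) ∈ generatorGraph V := by
  rw [← generator_graph]
  exact (generator V).mem_graph x

theorem generator_apply_eq {V : ℝ≥0 → X →L[ℂ] X} {x : (generator V).domain} {y : X}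
    (h : ((x : X), y) ∈ generatorGraph V) : generator V x = y :=
  tendsto_nhds_unique (mem_generatorGraph_iff.1 (generator_mem V x)) (mem_generatorGraph_iff.1 h)

theorem generatorGraph_unique {V : ℝ≥0 → X →L[ℂ] X} {x y y' : X}
    (h : (x, y) ∈ generatorGraph V) (h' : (x, y') ∈ generatorGraph V) : y = y' :=
  tendsto_nhds_unique (mem_generatorGraph_iff.1 h) (mem_generatorGraph_iff.1 h')

namespace IsC0Semigroup

variable {V : ℝ≥0 → X →L[ℂ] X} (hV : IsC0Semigroup V)
include hV

theorem add_apply (s t : ℝ≥0) (x : X) : V (s + t) x = V s (V t x) := by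
  rw [hV.map_add]; rfl

theorem apply_comm (s t : ℝ≥0) (x : X) : V s (V t x) = V t (V s x) := by
  rw [← hV.add_apply, add_comm, hV.add_apply]

theorem pow_eq (t : ℝ≥0) (n : ℕ) : V t ^ n = V (n * t) := by
  induction n with
  | zero => simp [hV.map_zero]
  | succ n ih =>
    rw [pow_succ, ih, ← hV.map_add]
    congr 1
    push_cast
    ring

theorem generatorGraph_map {x y : X} (h : (x, y) ∈ generatorGraph V) (t : ℝ≥0) :
    (V t x, V t y) ∈ generatorGraph V := by
  rw [mem_generatorGraph_iff] at h ⊢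
  refine (((V t).continuous.tendsto y).comp h).congr fun r => ?_
  simp only [Function.comp_apply]
  rw [(V t).map_smul_of_tower, map_sub, hV.apply_comm]

/-- The forward difference quotient at t is V(t) applied to the one at 0. A right derivative is all
that the mean value inequalities used below require. -/
theorem hasDerivWithinAt {x y : X} (h : (x, y) ∈ generatorGraph V) {t : ℝ} (ht : 0 ≤ t) :
    HasDerivWithinAt (fun r : ℝ => V r.toNNReal x) (-V t.toNNReal y) (Ici t) t := by
  rw [hasDerivWithinAt_iff_tendsto_slope, Ici_sdiff_left]
  have h1 : Tendsto (fun r : ℝ => r - t) (𝓝[>] t) (𝓝[>] 0) := by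
    refine tendsto_nhdsWithin_iff.2 ⟨?_, ?_⟩
    · have : Tendsto (fun r : ℝ => r - t) (𝓝 t) (𝓝 (t - t)) := (continuous_sub_right t).tendsto t
      rw [sub_self] at this
      exact this.mono_left nhdsWithin_le_nhds
    · filter_upwards [self_mem_nhdsWithin] with r hr
      exact sub_pos.2 (mem_Ioi.1 hr)
  have h2 := ((V t.toNNReal).continuous.tendsto y).comp ((mem_generatorGraph_iff.1 h).comp h1)
  refine h2.neg.congr' ?_
  filter_upwards [self_mem_nhdsWithin] with r hr
  have hr' : t < r := hr
  have : r.toNNReal = t.toNNReal + (r - t).toNNReal := by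
    rw [← Real.toNNReal_add ht (sub_pos.2 hr').le]; congr 1; ring
  simp only [Function.comp_apply]
  rw [slope_def_module, this, hV.add_apply, (V _).map_smul_of_tower, map_sub, ← smul_neg, neg_sub]

end IsC0Semigroup

/-! ### Contraction semigroups: accretivity, closed generator, product rule -/

namespace IsContractionSemigroup

variable {V : ℝ≥0 → X →L[ℂ] X} (hV : IsContractionSemigroup V)
include hV

theorem norm_apply_le (t : ℝ≥0) (x : X) : ‖V t x‖ ≤ ‖x‖ := by
  simpa using (V t).le_of_opNorm_le (hV.norm_le_one t) x

theorem continuous_real (x : X) : Continuous fun t : ℝ => V t.toNNReal x :=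
  (hV.continuous x).comp continuous_real_toNNReal

/-- Joint strong continuity. -/
theorem tendsto_apply {ι : Type*} {l : Filter ι} {s : ι → ℝ≥0} {s₀ : ℝ≥0} {z : ι → X} {z₀ : X}
    (hs : Tendsto s l (𝓝 s₀)) (hz : Tendsto z l (𝓝 z₀)) :
    Tendsto (fun i => V (s i) (z i)) l (𝓝 (V s₀ z₀)) := by
  have h1 : Tendsto (fun i => V (s i) z₀) l (𝓝 (V s₀ z₀)) :=
    ((hV.continuous z₀).tendsto s₀).comp hs
  have h2 : Tendsto (fun i => V (s i) (z i - z₀)) l (𝓝 0) := by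
    refine squeeze_zero_norm (fun i => hV.norm_apply_le _ _) ?_
    simpa using (hz.sub_const z₀).norm
  simpa using h2.add h1

/-- Mean value inequality for r ↦ Z V(r) x. The operator Z is there so that a smoothing factor can
stand before the unbounded quantity V(r) y. -/
theorem norm_map_sub_le {Y : Type*} [NormedAddCommGroup Y] [NormedSpace ℂ Y] (Z : X →L[ℂ] Y)
    {x y : X} (h : (x, y) ∈ generatorGraph V) {c : ℝ} {t : ℝ≥0}
    (hc : ∀ r ≤ t, ‖Z (V r y)‖ ≤ c) : ‖Z (V t x - x)‖ ≤ c * t := by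
  have := norm_image_sub_le_of_norm_deriv_right_le_segment (a := 0) (b := (t : ℝ)) (C := c)
    (f := fun r : ℝ => Z (V r.toNNReal x)) (f' := fun r => Z (-V r.toNNReal y))
    (Z.continuous.comp (hV.continuous_real x)).continuousOn
    (fun r hr => (Z.restrictScalars ℝ).hasFDerivAt.comp_hasDerivWithinAt r
      (hV.toIsC0Semigroup.hasDerivWithinAt h hr.1))
    (fun r hr => by
      rw [map_neg, norm_neg]
      exact hc _ (by rw [← NNReal.coe_le_coe, Real.coe_toNNReal _ hr.1]; exact hr.2.le))
    t ⟨t.2, le_rfl⟩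
  simpa [hV.map_zero] using this

/-- Norm-tangent functionals are nonnegative on the increments `x - V t x`. -/
theorem re_sub_nonneg {φ : StrongDual ℂ X} (hφ : ‖φ‖ ≤ 1) {x : X} (hx : φ x = ‖x‖) (t : ℝ≥0) :
    0 ≤ (φ (x - V t x)).re := by
  rw [map_sub, hx, Complex.sub_re, Complex.ofReal_re, sub_nonneg]
  calc (φ (V t x)).re ≤ ‖φ (V t x)‖ := Complex.re_le_norm _
    _ ≤ 1 * ‖V t x‖ := φ.le_of_opNorm_le hφ _
    _ ≤ ‖x‖ := by rw [one_mul]; exact hV.norm_apply_le t x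

theorem re_generator_nonneg {φ : StrongDual ℂ X} (hφ : ‖φ‖ ≤ 1) {x y : X} (hx : φ x = ‖x‖)
    (h : (x, y) ∈ generatorGraph V) : 0 ≤ (φ y).re := by
  have h1 := (Complex.continuous_re.tendsto _).comp
    ((φ.continuous.tendsto y).comp (mem_generatorGraph_iff.1 h))
  refine ge_of_tendsto h1 ?_
  filter_upwards [self_mem_nhdsWithin] with t ht
  simp only [Function.comp_apply]
  rw [φ.map_smul_of_tower, Complex.smul_re]
  exact mul_nonneg (inv_nonneg.2 (le_of_lt ht)) (hV.re_sub_nonneg hφ hx _)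

theorem accretive {x y : X} (h : (x, y) ∈ generatorGraph V) (m : ℝ) :
    m * ‖x‖ ≤ ‖y + (m : ℂ) • x‖ := by
  obtain ⟨φ, hφ, hx⟩ := exists_dual_vector'' ℂ x
  have h1 := hV.re_generator_nonneg hφ hx h
  have h2 : (φ (y + (m : ℂ) • x)).re = (φ y).re + m * ‖x‖ := by
    rw [map_add, map_smul, hx]; simp
  have h3 : (φ (y + (m : ℂ) • x)).re ≤ 1 * ‖y + (m : ℂ) • x‖ :=
    (Complex.re_le_norm _).trans (φ.le_of_opNorm_le hφ _)
  linarith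

/-- The mean value inequality bounds V(t)x - x + ty along the approximating pairs by t times ‖p.2 -
y‖ plus the oscillation of V(r)y for r ≤ t. In the limit only the oscillation remains. No integral
is used, so completeness is not needed. -/
theorem isClosed_generatorGraph : IsClosed (generatorGraph V : Set (X × X)) := by
  rw [← isSeqClosed_iff_isClosed]
  rintro p ⟨x, y⟩ hp hlim
  have hx : Tendsto (fun n => (p n).1) atTop (𝓝 x) := (continuous_fst.tendsto _).comp hlim
  have hy : Tendsto (fun n => (p n).2) atTop (𝓝 y) := (continuous_snd.tendsto _).comp hlim
  have key : ∀ (t : ℝ≥0) (c : ℝ), (∀ r ≤ t, ‖V r y - y‖ ≤ c) →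
      ‖V t x - x + (t : ℝ) • y‖ ≤ c * t := by
    intro t c hc
    have hb : ∀ n, ‖V t (p n).1 - (p n).1 + (t : ℝ) • y‖ ≤ (‖(p n).2 - y‖ + c) * t := by
      intro n
      have := norm_image_sub_le_of_norm_deriv_right_le_segment (a := 0) (b := (t : ℝ))
        (C := ‖(p n).2 - y‖ + c)
        (f := fun r : ℝ => V r.toNNReal (p n).1 + r • y)
        (f' := fun r => -V r.toNNReal (p n).2 + (1 : ℝ) • y)
        ((hV.continuous_real _).add (by fun_prop)).continuousOn
        (fun r hr => (hV.toIsC0Semigroup.hasDerivWithinAt (hp n) hr.1).add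
          ((hasDerivAt_id r).smul_const y).hasDerivWithinAt)
        (fun r hr => by
          have h1 : -V r.toNNReal (p n).2 + (1 : ℝ) • y =
            -(V r.toNNReal ((p n).2 - y) + (V r.toNNReal y - y)) := by
              rw [map_sub, one_smul]; abel
          rw [h1, norm_neg]
          refine (norm_add_le _ _).trans (add_le_add (hV.norm_apply_le _ _) (hc _ ?_))
          rw [← NNReal.coe_le_coe, Real.coe_toNNReal _ hr.1]; exact hr.2.le)
        t ⟨t.2, le_rfl⟩
      simpa [hV.map_zero, add_sub_right_comm] using this
    refine le_of_tendsto_of_tendsto' (b := atTop) ?_ ?_ hb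
    · exact ((((V t).continuous.tendsto x).comp hx).sub hx).add_const _ |>.norm
    · have : Tendsto (fun n => ‖(p n).2 - y‖) atTop (𝓝 0) := by simpa using (hy.sub_const y).norm
      simpa using (this.add_const c).mul_const (t : ℝ)
  change (x, y) ∈ generatorGraph V
  rw [mem_generatorGraph_iff, Metric.tendsto_nhdsWithin_nhds]
  intro ε hε
  have hc := (hV.continuous y).tendsto 0
  rw [hV.map_zero, Metric.tendsto_nhds_nhds] at hc
  obtain ⟨δ, hδ, hd⟩ := hc (ε / 2) (half_pos hε)
  refine ⟨δ, hδ, fun {h} hh hhd => ?_⟩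
  have hh0 : 0 < h := hh
  rw [Real.dist_eq, sub_zero, abs_of_pos hh0] at hhd
  have hk := key h.toNNReal (ε / 2) (fun r hr => by
    have := @hd r (by
      rw [NNReal.dist_eq, NNReal.coe_zero, sub_zero, abs_of_nonneg r.coe_nonneg]
      refine lt_of_le_of_lt ?_ hhd
      rw [← Real.coe_toNNReal h hh0.le]; exact_mod_cast hr)
    rw [dist_eq_norm] at this
    exact this.le)
  rw [Real.coe_toNNReal _ hh0.le] at hk
  rw [dist_eq_norm]
  have h2 : h⁻¹ • (x - V h.toNNReal x) - y = -(h⁻¹ • (V h.toNNReal x - x + h • y)) := by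
    rw [smul_add, smul_smul, inv_mul_cancel₀ hh0.ne', one_smul, smul_sub, smul_sub]; abel
  rw [h2, norm_neg, norm_smul, norm_inv, Real.norm_of_nonneg hh0.le, inv_mul_lt_iff₀ hh0]
  nlinarith

/-- Right derivative of `r ↦ V (t - r) (Z (V₂ r x))`. -/
theorem hasDerivWithinAt_sub {V₂ : ℝ≥0 → X →L[ℂ] X} (hV₂ : IsC0Semigroup V₂) (Z : X →L[ℂ] X)
    {x y w : X} (h₂ : (x, y) ∈ generatorGraph V₂) {t r : ℝ} (hr : 0 ≤ r) (hrt : r < t)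
    (h : (Z (V₂ r.toNNReal x), w) ∈ generatorGraph V) :
    HasDerivWithinAt (fun r : ℝ => V (t - r).toNNReal (Z (V₂ r.toNNReal x)))
      (V (t - r).toNNReal (w - Z (V₂ r.toNNReal y))) (Ici r) r := by
  have hd := (Z.restrictScalars ℝ).hasFDerivAt.comp_hasDerivWithinAt r (hV₂.hasDerivWithinAt h₂ hr)
  rw [hasDerivWithinAt_iff_tendsto_slope, Ici_sdiff_left] at hd ⊢
  have h1 : Tendsto (fun q : ℝ => q - r) (𝓝[>] r) (𝓝[>] 0) := by
    refine tendsto_nhdsWithin_iff.2 ⟨?_, ?_⟩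
    · have : Tendsto (fun q : ℝ => q - r) (𝓝 r) (𝓝 (r - r)) := (continuous_sub_right r).tendsto r
      rw [sub_self] at this
      exact this.mono_left nhdsWithin_le_nhds
    · filter_upwards [self_mem_nhdsWithin] with r hr
      exact sub_pos.2 (mem_Ioi.1 hr)
  have hw := (mem_generatorGraph_iff.1 h).comp h1
  have hs : Tendsto (fun q : ℝ => (t - q).toNNReal) (𝓝[>] r) (𝓝 (t - r).toNNReal) :=
    ((continuous_real_toNNReal.comp (continuous_sub_left t)).tendsto r).mono_left nhdsWithin_le_nhds
  have key := hV.tendsto_apply hs (hw.add hd)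
  have e : w + (Z.restrictScalars ℝ) (-V₂ r.toNNReal y) = w - Z (V₂ r.toNNReal y) := by
    simp [sub_eq_add_neg]
  rw [e] at key
  refine key.congr' ?_
  have hlt : ∀ᶠ q in 𝓝[>] r, q < t :=
    (eventually_lt_nhds hrt).filter_mono nhdsWithin_le_nhds
  filter_upwards [self_mem_nhdsWithin, hlt] with q hq hqt
  have hq' : r < q := hq
  -- Splitting V(t-r) = V(t-q) V(q-r) pulls V(t-q) out of the increment and leaves the sum of two
  -- difference quotients; joint strong continuity then gives the limit.
  have e1 : (t - r).toNNReal = (t - q).toNNReal + (q - r).toNNReal := by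
    rw [← Real.toNNReal_add (sub_pos.2 hqt).le (sub_pos.2 hq').le]; congr 1; ring
  rw [slope_def_module, slope_def_module, e1, hV.add_apply]
  simp only [Function.comp_apply, ContinuousLinearMap.coe_restrictScalars']
  rw [← smul_add, (V _).map_smul_of_tower]
  congr 1
  simp only [_root_.map_add, map_sub]
  abel

end IsContractionSemigroup

/-! ### Rescaling, orbit integrals and the resolvent -/

/-- The rescaled semigroup `exp (-m t) V(t)`. -/
def shift (m : ℝ) (V : ℝ≥0 → X →L[ℂ] X) (t : ℝ≥0) : X →L[ℂ] X :=
  ((Real.exp (-(m * t)) : ℝ) : ℂ) • V t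

theorem shift_apply (m : ℝ) (V : ℝ≥0 → X →L[ℂ] X) (t : ℝ≥0) (x : X) :
    shift m V t x = Real.exp (-(m * t)) • V t x := by
  simp only [shift, _root_.smul_apply, Complex.coe_smul]

theorem norm_shift (m : ℝ) (V : ℝ≥0 → X →L[ℂ] X) (t : ℝ≥0) :
    ‖shift m V t‖ = Real.exp (-(m * t)) * ‖V t‖ := by
  rw [shift, norm_smul, Complex.norm_real, Real.norm_of_nonneg (Real.exp_nonneg _)]

theorem shift_neg_shift (m : ℝ) (V : ℝ≥0 → X →L[ℂ] X) : shift (-m) (shift m V) = V := by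
  funext t
  ext x
  rw [shift_apply, shift_apply, smul_smul, ← Real.exp_add]
  simp

theorem mem_generatorGraph_shift_of_mem {m : ℝ} {V : ℝ≥0 → X →L[ℂ] X} {x y : X}
    (h : (x, y) ∈ generatorGraph V) : (x, y + (m : ℂ) • x) ∈ generatorGraph (shift m V) := by
  rw [mem_generatorGraph_iff] at h ⊢
  have hd : HasDerivAt (fun h : ℝ => -Real.exp (-(m * h))) m 0 := by
    have := (((hasDerivAt_id (0 : ℝ)).const_mul m).neg.exp).neg
    exact this.congr_deriv (by simp)
  have h1 : Tendsto (fun h : ℝ => h⁻¹ • (1 - Real.exp (-(m * h)))) (𝓝[>] 0) (𝓝 m) := by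
    have := hd.tendsto_slope_zero_right
    simpa [sub_eq_add_neg, add_comm] using this
  have h2 : Tendsto (fun h : ℝ => Real.exp (-(m * h))) (𝓝[>] 0) (𝓝 1) := by
    have : Continuous fun h : ℝ => Real.exp (-(m * h)) := by fun_prop
    simpa using (this.tendsto 0).mono_left nhdsWithin_le_nhds
  have h3 := (h2.smul h).add (h1.smul_const x)
  rw [one_smul, ← Complex.coe_smul m x] at h3
  refine h3.congr' ?_
  filter_upwards [self_mem_nhdsWithin] with t ht
  rw [shift_apply, Real.coe_toNNReal t (le_of_lt ht), smul_comm, smul_eq_mul, mul_smul, ← smul_add]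
  congr 1
  rw [smul_sub, sub_smul, one_smul]
  abel

theorem mem_generatorGraph_shift {m : ℝ} {V : ℝ≥0 → X →L[ℂ] X} {x y : X} :
    (x, y) ∈ generatorGraph (shift m V) ↔ (x, y - (m : ℂ) • x) ∈ generatorGraph V := by
  constructor
  · intro h
    have := mem_generatorGraph_shift_of_mem (m := -m) h
    rw [shift_neg_shift] at this
    simpa [sub_eq_add_neg] using this
  · intro h
    simpa using mem_generatorGraph_shift_of_mem (m := m) h

theorem tendsto_average [CompleteSpace X] {f : ℝ → X} (hf : Continuous f) :
    Tendsto (fun h : ℝ => h⁻¹ • ∫ s in (0 : ℝ)..h, f s) (𝓝[>] 0) (𝓝 (f 0)) := by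
  have := (intervalIntegral.integral_hasDerivAt_right (hf.intervalIntegrable 0 0)
    hf.aestronglyMeasurable.stronglyMeasurableAtFilter hf.continuousAt).tendsto_slope_zero_right
  simpa using this

namespace IsContractionSemigroup

variable {V : ℝ≥0 → X →L[ℂ] X} (hV : IsContractionSemigroup V)
include hV

theorem shift {m : ℝ} (hm : 0 ≤ m) : IsContractionSemigroup (shift m V) where
  map_zero := by
    ext x
    simp [shift_apply, hV.map_zero]
  map_add s t := by
    ext x
    rw [mul_apply_eq_comp, shift_apply, shift_apply, shift_apply, hV.add_apply,
      (V s).map_smul_of_tower, smul_smul, ← Real.exp_add]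
    congr 2
    push_cast
    ring
  tendsto_zero x := by
    have h2 : Tendsto (fun t : ℝ≥0 => Real.exp (-(m * t))) (𝓝[>] 0) (𝓝 1) := by
      have : Continuous fun h : ℝ≥0 => Real.exp (-(m * h)) := by fun_prop
      simpa using (this.tendsto 0).mono_left nhdsWithin_le_nhds
    have := h2.smul (hV.tendsto_zero x)
    rw [one_smul] at this
    exact this.congr fun t => (shift_apply m V t x).symm
  norm_le_one t := by
    rw [norm_shift]
    refine mul_le_one₀ ?_ (norm_nonneg _) (hV.norm_le_one t)
    rw [Real.exp_le_one_iff]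
    have : 0 ≤ m * t := by positivity
    linarith

variable [CompleteSpace X]

theorem map_integral (x : X) {a c t : ℝ} (ha : 0 ≤ a) (hc : 0 ≤ c) (ht : 0 ≤ t) :
    V c.toNNReal (∫ s in a..(a + t), V s.toNNReal x) =
      ∫ s in (a + c)..(a + t + c), V s.toNNReal x := by
  rw [← intervalIntegral.integral_comp_add_right (fun s => V s.toNNReal x) c]
  rw [← ContinuousLinearMap.intervalIntegral_comp_comm _
    ((hV.continuous_real x).intervalIntegrable _ _)]
  refine intervalIntegral.integral_congr fun s hs => ?_
  rw [uIcc_of_le (by linarith)] at hs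
  have hs0 : 0 ≤ s := ha.trans hs.1
  change V c.toNNReal (V s.toNNReal x) = V (s + c).toNNReal x
  rw [Real.toNNReal_add hs0 hc, add_comm, hV.add_apply]

/-- V(r) translates the window [0,t] to [r,r+t]; after cancelling the overlap, the quotient is the
average over [0,r] of V(s)x - V(t+s)x. -/
theorem integral_mem_generatorGraph (x : X) {t : ℝ} (ht : 0 ≤ t) :
    (∫ s in (0 : ℝ)..t, V s.toNNReal x, x - V t.toNNReal x) ∈ generatorGraph V := by
  have hc := hV.continuous_real x
  rw [mem_generatorGraph_iff]
  have hc2 : Continuous fun s : ℝ => V (t + s).toNNReal x := hc.comp (continuous_const.add continuous_id)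
  have h := tendsto_average (f := fun s => V s.toNNReal x - V (t + s).toNNReal x) (hc.sub hc2)
  simp only [Real.toNNReal_zero, hV.map_zero, one_apply_eq_self, add_zero] at h
  refine h.congr' ?_
  filter_upwards [self_mem_nhdsWithin] with r hr
  have hr0 : 0 ≤ r := le_of_lt hr
  congr 1
  have e := hV.map_integral x le_rfl hr0 ht
  rw [zero_add, zero_add] at e
  have e1 : ∫ s in (0 : ℝ)..r, V (t + s).toNNReal x = ∫ s in t..(t + r), V s.toNNReal x := by
    rw [intervalIntegral.integral_comp_add_left (fun s => V s.toNNReal x) t, add_zero]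
  rw [e, intervalIntegral.integral_sub (hc.intervalIntegrable _ _) (hc2.intervalIntegrable _ _), e1,
    sub_eq_sub_iff_add_eq_add,
    intervalIntegral.integral_add_adjacent_intervals (hc.intervalIntegrable _ _)
      (hc.intervalIntegrable _ _),
    intervalIntegral.integral_add_adjacent_intervals (hc.intervalIntegrable _ _)
      (hc.intervalIntegrable _ _)]

theorem dense_generator_domain : Dense ((generator V).domain : Set X) := by
  intro x
  have h := tendsto_average (hV.continuous_real x)
  simp only [Real.toNNReal_zero, hV.map_zero, one_apply_eq_self] at h
  refine mem_closure_of_tendsto h ?_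
  filter_upwards [self_mem_nhdsWithin] with r hr
  refine Submodule.smul_of_tower_mem _ _ ?_
  exact mem_generator_domain.2 ⟨_, hV.integral_mem_generatorGraph x (le_of_lt hr)⟩

/-- The resolvent of the generator as a Laplace transform. -/
theorem exists_resolvent {m : ℝ} (hm : 0 < m) :
    ∃ R : X →L[ℂ] X, (∀ x, (R x, x) ∈ generatorGraph (TrotterProduct.shift m V)) ∧
      (∀ x y, (x, y) ∈ generatorGraph (TrotterProduct.shift m V) → R y = x) ∧
      ∀ x, R x = ∫ s in Ioi (0 : ℝ), Real.exp (-(m * s)) • V s.toNNReal x := by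
  set W := TrotterProduct.shift m V with hWdef
  have hW : IsContractionSemigroup W := hV.shift hm.le
  have hWn : ∀ (s : ℝ) (x : X), 0 ≤ s → ‖W s.toNNReal x‖ ≤ Real.exp (-m * s) * ‖x‖ := by
    intro s x hs
    rw [hWdef, shift_apply, norm_smul, Real.norm_of_nonneg (Real.exp_nonneg _),
      Real.coe_toNNReal s hs, neg_mul]
    gcongr
    exact hV.norm_apply_le _ _
  have hint : ∀ x, IntegrableOn (fun s : ℝ => W s.toNNReal x) (Ioi 0) := by
    intro x
    refine Integrable.mono' ((integrableOn_exp_mul_Ioi (a := -m) (by linarith) 0).mul_const ‖x‖)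
      (hW.continuous_real x).aestronglyMeasurable ?_
    exact (ae_restrict_iff' measurableSet_Ioi).2 (ae_of_all _ fun s hs => hWn s x (le_of_lt hs))
  let R₀ : X →ₗ[ℂ] X :=
    { toFun := fun x => ∫ s in Ioi (0 : ℝ), W s.toNNReal x
      map_add' := fun x y => by
        simp only [_root_.map_add]; exact integral_add (hint x) (hint y)
      map_smul' := fun c x => by
        simp only [map_smul, RingHom.id_apply]; exact integral_smul c _ }
  have hb : ∀ x, ‖R₀ x‖ ≤ (∫ s in Ioi (0 : ℝ), Real.exp (-m * s)) * ‖x‖ := by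
    intro x
    rw [← integral_mul_const]
    refine norm_integral_le_of_norm_le
      ((integrableOn_exp_mul_Ioi (a := -m) (by linarith) 0).mul_const ‖x‖) ?_
    exact (ae_restrict_iff' measurableSet_Ioi).2 (ae_of_all _ fun s hs => hWn s x (le_of_lt hs))
  refine ⟨R₀.mkContinuous _ hb, fun x => ?_, fun x y hxy => ?_, fun x => ?_⟩
  · change (∫ s in Ioi (0 : ℝ), W s.toNNReal x, x) ∈ generatorGraph W
    rw [mem_generatorGraph_iff]
    have h := tendsto_average (hW.continuous_real x)
    simp only [Real.toNNReal_zero, hW.map_zero, one_apply_eq_self] at h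
    refine h.congr' ?_
    filter_upwards [self_mem_nhdsWithin] with r hr
    have hr0 : 0 ≤ r := le_of_lt hr
    congr 1
    have e1 : W r.toNNReal (∫ s in Ioi (0 : ℝ), W s.toNNReal x) =
        ∫ s in Ioi r, W s.toNNReal x := by
      rw [← ContinuousLinearMap.integral_comp_comm _ (hint x)]
      have := (measurePreserving_add_right volume r).setIntegral_preimage_emb
        (measurableEmbedding_addRight r) (fun s => W s.toNNReal x) (Ioi r)
      rw [preimage_add_const_Ioi, sub_self] at this
      rw [← this]
      refine setIntegral_congr_fun measurableSet_Ioi fun s hs => ?_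
      change W r.toNNReal (W s.toNNReal x) = W (s + r).toNNReal x
      rw [Real.toNNReal_add (le_of_lt hs) hr0, add_comm, hW.add_apply]
    rw [e1, eq_sub_iff_add_eq, intervalIntegral.integral_of_le hr0,
      ← setIntegral_union (Ioc_disjoint_Ioi le_rfl) measurableSet_Ioi
      ((hint x).mono_set Ioc_subset_Ioi_self) ((hint x).mono_set (Ioi_subset_Ioi hr0)),
      Ioc_union_Ioi_eq_Ioi hr0]
  · change ∫ s in Ioi (0 : ℝ), W s.toNNReal y = x
    -- Fundamental theorem of calculus along the orbit of x; the boundary term W(t)x vanishes as t →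
    -- ∞ because of the factor e^{-mt}.
    have h1 : ∀ t : ℝ, 0 ≤ t → ∫ s in (0 : ℝ)..t, W s.toNNReal y = x - W t.toNNReal x := by
      intro t ht
      have := intervalIntegral.integral_eq_sub_of_hasDeriv_right_of_le ht
        (hW.continuous_real x).continuousOn
        (fun r hr => (hW.toIsC0Semigroup.hasDerivWithinAt hxy hr.1.le).Ioi_of_Ici)
        ((hW.continuous_real y).neg.intervalIntegrable _ _)
      rw [intervalIntegral.integral_neg] at this
      simp only [Real.toNNReal_zero, hW.map_zero, one_apply_eq_self] at this
      rw [← neg_sub, ← this, neg_neg]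
    have h2 := intervalIntegral_tendsto_integral_Ioi 0 (hint y) tendsto_id
    have h3 : Tendsto (fun t : ℝ => x - W t.toNNReal x) atTop (𝓝 (x - 0)) := by
      refine tendsto_const_nhds.sub (squeeze_zero_norm' (a := fun t => Real.exp (-m * t) * ‖x‖) ?_ ?_)
      · filter_upwards [eventually_ge_atTop 0] with t ht using hWn t x ht
      · have : Tendsto (fun t : ℝ => Real.exp (-m * t)) atTop (𝓝 0) :=
          Real.tendsto_exp_atBot.comp (tendsto_id.const_mul_atTop_of_neg (by linarith))
        simpa using this.mul_const ‖x‖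
    rw [sub_zero] at h3
    refine tendsto_nhds_unique h2 (h3.congr' ?_)
    filter_upwards [eventually_ge_atTop 0] with t ht
    exact (h1 t ht).symm
  · change ∫ s in Ioi (0 : ℝ), W s.toNNReal x = _
    refine setIntegral_congr_fun measurableSet_Ioi fun s hs => ?_
    simp only [hWdef, shift_apply, Real.coe_toNNReal s (le_of_lt hs)]

end IsContractionSemigroup

/-! ### Uniformly continuous semigroups and the Hille–Yosida theorem -/

theorem norm_exp_smul_le [CompleteSpace X] (N : X →L[ℂ] X) (hN : ‖N‖ ≤ 1) {r : ℝ} (hr : 0 ≤ r) :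
    ‖NormedSpace.exp (r • N)‖ ≤ Real.exp r := by
  rcases subsingleton_or_nontrivial X with h | h
  · rw [ContinuousLinearMap.opNorm_subsingleton]
    exact Real.exp_nonneg r
  · rw [NormedSpace.exp_eq_tsum ℝ, Real.exp_eq_exp_ℝ, NormedSpace.exp_eq_tsum ℝ]
    refine tsum_of_norm_bounded (NormedSpace.expSeries_summable' (𝕂 := ℝ) r).hasSum fun n => ?_
    rw [norm_smul, smul_eq_mul, Real.norm_of_nonneg (by positivity)]
    gcongr
    refine (norm_pow_le _ _).trans ?_
    gcongr
    rw [norm_smul, Real.norm_of_nonneg hr]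
    exact mul_le_of_le_one_right hr hN

/-- The uniformly continuous semigroup with generator `m (1 - N)`. -/
def expSemigroup (m : ℝ) (N : X →L[ℂ] X) (t : ℝ≥0) : X →L[ℂ] X :=
  NormedSpace.exp ((t : ℝ) • (m • (N - 1)))

section expSemigroup
variable [CompleteSpace X] {m : ℝ} {N : X →L[ℂ] X}

theorem hasDerivAt_expSemigroup (m : ℝ) (N : X →L[ℂ] X) (x : X) (t : ℝ) :
    HasDerivAt (fun r : ℝ => NormedSpace.exp (r • (m • (N - 1))) x)
      (NormedSpace.exp (t • (m • (N - 1))) ((m • (N - 1)) x)) t := by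
  have h := hasDerivAt_exp_smul_const (𝕂 := ℝ) (m • (N - 1)) t
  exact ((ContinuousLinearMap.apply ℂ X x).restrictScalars ℝ).hasFDerivAt.comp_hasDerivAt t h

/-- Contractivity: e^{tm(N-1)} = e^{-tm} e^{tmN}, and the exponential series bounds the second
factor by e^{tm}. -/
theorem isContractionSemigroup_expSemigroup (hm : 0 ≤ m) (hN : ‖N‖ ≤ 1) :
    IsContractionSemigroup (expSemigroup m N) := by
  let _ : NormedAlgebra ℚ (X →L[ℂ] X) := NormedAlgebra.restrictScalars ℚ ℝ _
  constructor
  · constructor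
    · simp [expSemigroup, NormedSpace.exp_zero]
    · intro s t
      rw [expSemigroup, expSemigroup, expSemigroup, ← NormedSpace.exp_add_of_commute, ← add_smul,
        NNReal.coe_add]
      exact ((Commute.refl _).smul_left _).smul_right _
    · intro x
      rw [tendsto_nnreal_iff]
      have := (hasDerivAt_expSemigroup m N x 0).continuousAt.tendsto
      simp only [zero_smul, NormedSpace.exp_zero, one_apply_eq_self] at this
      refine (this.mono_left nhdsWithin_le_nhds).congr' ?_
      filter_upwards [self_mem_nhdsWithin] with t ht
      rw [expSemigroup, Real.coe_toNNReal t (le_of_lt ht)]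
  · intro t
    have e : (t : ℝ) • (m • (N - 1)) = (t * m) • N + (-(t * m)) • (1 : X →L[ℂ] X) := by
      rw [smul_smul, smul_sub, neg_smul, sub_eq_add_neg]
    have hc : Commute ((t * m : ℝ) • N) ((-(t * m : ℝ)) • (1 : X →L[ℂ] X)) :=
      ((Commute.one_right N).smul_right _).smul_left _
    have e1 : NormedSpace.exp ((-(t * m : ℝ)) • (1 : X →L[ℂ] X)) =
        Real.exp (-(t * m)) • (1 : X →L[ℂ] X) := by
      have := NormedSpace.algebraMap_exp_comm (𝕂 := ℝ) (𝔸 := X →L[ℂ] X) (-(t * m))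
      rw [Algebra.algebraMap_eq_smul_one, Algebra.algebraMap_eq_smul_one, ← Real.exp_eq_exp_ℝ] at this
      exact this.symm
    rw [expSemigroup, e, NormedSpace.exp_add_of_commute hc, e1, mul_smul_comm, mul_one, norm_smul,
      Real.norm_of_nonneg (Real.exp_nonneg _)]
    calc Real.exp (-(t * m)) * ‖NormedSpace.exp ((t * m : ℝ) • N)‖
        ≤ Real.exp (-(t * m)) * Real.exp (t * m) := by
          gcongr
          exact norm_exp_smul_le N hN (by positivity)
      _ = 1 := by rw [← Real.exp_add]; simp

theorem mem_generatorGraph_expSemigroup (x : X) :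
    (x, m • (x - N x)) ∈ generatorGraph (expSemigroup m N) := by
  rw [mem_generatorGraph_iff]
  have h := (hasDerivAt_expSemigroup m N x 0).tendsto_slope_zero_right.neg
  simp only [zero_smul, NormedSpace.exp_zero, one_apply_eq_self, zero_add] at h
  have e : -(m • (N - 1)) x = m • (x - N x) := by
    simp [smul_sub]
  rw [e] at h
  refine h.congr' ?_
  filter_upwards [self_mem_nhdsWithin] with t ht
  rw [expSemigroup, Real.coe_toNNReal t (le_of_lt ht), ← smul_neg, neg_sub]

omit [CompleteSpace X] in
theorem commute_expSemigroup {m' : ℝ} {N' : X →L[ℂ] X} (h : Commute N N') (t : ℝ≥0) :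
    Commute N (expSemigroup m' N' t) := by
  let _ : NormedAlgebra ℚ (X →L[ℂ] X) := NormedAlgebra.restrictScalars ℚ ℝ _
  exact Commute.exp_right (((h.sub_right (Commute.one_right N)).smul_right _).smul_right _)

/-- Interpolate by r ↦ V(t-r)V'(r)x. Since N and N' commute, the derivative is a product of
contractions applied to the difference of the generators at x. -/
theorem norm_expSemigroup_sub_le {m' : ℝ} {N' : X →L[ℂ] X} (hm : 0 ≤ m) (hN : ‖N‖ ≤ 1)
    (hm' : 0 ≤ m') (hN' : ‖N'‖ ≤ 1) (h : Commute N N') (t : ℝ≥0) (x : X) :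
    ‖expSemigroup m N t x - expSemigroup m' N' t x‖ ≤
      ‖m • (x - N x) - m' • (x - N' x)‖ * t := by
  have hV := isContractionSemigroup_expSemigroup hm hN
  have hV' := isContractionSemigroup_expSemigroup hm' hN'
  have hcomm : ∀ s, m • (expSemigroup m' N' s x - N (expSemigroup m' N' s x)) =
      expSemigroup m' N' s (m • (x - N x)) := by
    intro s
    have : N (expSemigroup m' N' s x) = expSemigroup m' N' s (N x) :=
      DFunLike.congr_fun (commute_expSemigroup (m' := m') h s).eq x
    rw [(expSemigroup m' N' s).map_smul_of_tower, map_sub, this]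
  have := norm_image_sub_le_of_norm_deriv_right_le_segment (a := 0) (b := (t : ℝ))
    (C := ‖m • (x - N x) - m' • (x - N' x)‖)
    (f := fun r : ℝ => expSemigroup m N (t - r).toNNReal
      ((1 : X →L[ℂ] X) (expSemigroup m' N' r.toNNReal x)))
    (f' := fun r : ℝ => expSemigroup m N (t - r).toNNReal
      (m • (expSemigroup m' N' r.toNNReal x - N (expSemigroup m' N' r.toNNReal x)) -
        (1 : X →L[ℂ] X) (expSemigroup m' N' r.toNNReal (m' • (x - N' x)))))
    (fun r _ => (hV.tendsto_apply (l := 𝓝 r)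
      ((continuous_real_toNNReal.comp (continuous_sub_left (t : ℝ))).tendsto r)
      (((1 : X →L[ℂ] X).continuous.comp (hV'.continuous_real x)).tendsto r)).mono_left
        nhdsWithin_le_nhds)
    (fun r hr => hV.hasDerivWithinAt_sub hV'.toIsC0Semigroup 1
      (mem_generatorGraph_expSemigroup x) hr.1 hr.2
      (mem_generatorGraph_expSemigroup _))
    (fun r hr => by
      refine (hV.norm_apply_le _ _).trans ?_
      rw [one_apply_eq_self, hcomm, ← map_sub]
      exact hV'.norm_apply_le _ _)
    t ⟨t.2, le_rfl⟩
  simpa [hV.map_zero, hV'.map_zero, norm_sub_rev] using this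

end expSemigroup

/-- The Hille–Yosida theorem for contraction semigroups, for an operator given by its graph. -/
theorem hilleYosida [CompleteSpace X] {H : Set (X × X)} {m₀ : ℝ} (hm₀ : 0 < m₀)
    {Q : ℝ → X →L[ℂ] X}
    (hQ : ∀ m, m₀ ≤ m → ∀ y, (Q m y, y - m • Q m y) ∈ H)
    (hQ' : ∀ m, m₀ ≤ m → ∀ x y, (x, y) ∈ H → Q m (y + m • x) = x)
    (hQn : ∀ m, m₀ ≤ m → ∀ y, m * ‖Q m y‖ ≤ ‖y‖)
    (hd : Dense {x | ∃ y, (x, y) ∈ H}) :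
    ∃ U : ℝ≥0 → X →L[ℂ] X, IsContractionSemigroup U ∧
      ∀ x y, (x, y) ∈ generatorGraph U ↔ (x, y) ∈ H := by
  have hpos : ∀ m, m₀ ≤ m → 0 < m := fun m hm => hm₀.trans_le hm
  have hNn : ∀ m, m₀ ≤ m → ‖m • Q m‖ ≤ 1 := by
    intro m hm
    refine ContinuousLinearMap.opNorm_le_bound _ zero_le_one fun y => ?_
    rw [_root_.smul_apply, norm_smul, Real.norm_of_nonneg (hpos m hm).le, one_mul]
    exact hQn m hm y
  -- Here Q(m) = (H+m)⁻¹. The resolvent identity, written in both orders, gives commutation.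
  have hcommQ : ∀ m k, m₀ ≤ m → m₀ ≤ k → Commute (Q m) (Q k) := by
    have key : ∀ m k, m₀ ≤ m → m₀ ≤ k → ∀ z, Q k z + (k - m) • Q k (Q m z) = Q m z := by
      intro m k hm hk z
      have := hQ' k hk _ _ (hQ m hm z)
      rw [← (Q k).map_smul_of_tower, ← _root_.map_add]
      rw [← this]
      congr 1
      rw [this, sub_smul]
      abel
    intro m k hm hk
    ext z
    change Q m (Q k z) = Q k (Q m z)
    rcases eq_or_ne m k with rfl | hne
    · rfl
    have h1 := key m k hm hk z
    have h2 := key k m hk hm z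
    have h3 : (k - m) • (Q k (Q m z) - Q m (Q k z)) = 0 := by
      have : (m - k) • Q m (Q k z) = -((k - m) • Q m (Q k z)) := by rw [← neg_smul, neg_sub]
      rw [this] at h2
      rw [smul_sub]
      have h4 : (k - m) • Q k (Q m z) = Q m z - Q k z := eq_sub_of_add_eq' h1
      have h5 : (k - m) • Q m (Q k z) = Q m z - Q k z := by
        rw [← sub_eq_add_neg, sub_eq_iff_eq_add] at h2
        rw [eq_sub_iff_add_eq', ← h2]
      rw [h4, h5, sub_self]
    rcases smul_eq_zero.1 h3 with h | h
    · exact absurd (sub_eq_zero.1 h).symm hne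
    · exact (sub_eq_zero.1 h).symm
  set M : ℕ → ℝ := fun n => m₀ + n with hM
  have hMm : ∀ n, m₀ ≤ M n := fun n => by simp [hM]
  have hMt : Tendsto M atTop atTop := tendsto_atTop_add_const_left _ _ tendsto_natCast_atTop_atTop
  set V : ℕ → ℝ≥0 → X →L[ℂ] X := fun n => expSemigroup (M n) (M n • Q (M n)) with hVdef
  have hV : ∀ n, IsContractionSemigroup (V n) := fun n =>
    isContractionSemigroup_expSemigroup (hpos _ (hMm n)).le (hNn _ (hMm n))
  -- On the domain mQ(m)x - x = -Q(m)w has norm at most ‖w‖/m; density and ‖mQ(m)‖ ≤ 1 give the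
  -- rest.
  have happrox : ∀ y, Tendsto (fun n => M n • Q (M n) y) atTop (𝓝 y) := by
    intro y
    rw [Metric.tendsto_atTop]
    intro ε hε
    obtain ⟨x, ⟨w, hw⟩, hx⟩ := hd.exists_dist_lt y (ε := ε / 4) (by positivity)
    have hev : ∀ᶠ n in atTop, ‖w‖ * 4 / ε < M n := hMt.eventually_gt_atTop _
    obtain ⟨n₀, hn₀⟩ := eventually_atTop.1 hev
    refine ⟨n₀, fun n hn => ?_⟩
    have h1 := hn₀ n hn
    have hp := hpos _ (hMm n)
    have h2 : M n • Q (M n) x - x = -Q (M n) w := by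
      have := hQ' _ (hMm n) x w hw
      rw [_root_.map_add, (Q _).map_smul_of_tower] at this
      rw [sub_eq_iff_eq_add, neg_add_eq_sub, eq_sub_iff_add_eq', this]
    have h3 : ‖Q (M n) w‖ < ε / 4 := by
      have := hQn _ (hMm n) w
      rw [div_lt_iff₀ hε] at h1
      by_contra hcon
      push Not at hcon
      have : M n * (ε / 4) ≤ ‖w‖ := (mul_le_mul_of_nonneg_left hcon hp.le).trans this
      linarith
    have h4 : M n • Q (M n) y - y =
        (M n • Q (M n)) (y - x) + (M n • Q (M n) x - x) + (x - y) := by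
      simp only [map_sub, _root_.smul_apply]; abel
    rw [dist_eq_norm] at hx ⊢
    have h5 : ‖(M n • Q (M n)) (y - x)‖ ≤ 1 * ‖y - x‖ :=
      ContinuousLinearMap.le_of_opNorm_le _ (hNn _ (hMm n)) _
    calc ‖M n • Q (M n) y - y‖
        ≤ ‖(M n • Q (M n)) (y - x)‖ + ‖M n • Q (M n) x - x‖ + ‖x - y‖ := by
          rw [h4]; exact norm_add₃_le
      _ < ε := by rw [h2, norm_neg, norm_sub_rev x y]; linarith
  -- The Yosida approximant applied to x equals mQ(m)y.
  have hY : ∀ x y, (x, y) ∈ H →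
      Tendsto (fun n => M n • (x - (M n • Q (M n)) x)) atTop (𝓝 y) := by
    intro x y hxy
    refine (happrox y).congr fun n => ?_
    have := hQ' _ (hMm n) x y hxy
    rw [_root_.map_add, (Q _).map_smul_of_tower] at this
    congr 1
    rw [_root_.smul_apply, eq_sub_iff_add_eq, this]
  have hcauchy : ∀ (t : ℝ≥0) (x : X), CauchySeq fun n => V n t x := by
    intro t x
    rw [Metric.cauchySeq_iff]
    intro ε hε
    obtain ⟨z, ⟨w, hw⟩, hz⟩ := hd.exists_dist_lt x (ε := ε / 4) (by positivity)
    obtain ⟨n₀, hn₀⟩ := Metric.cauchySeq_iff.1 (hY z w hw).cauchySeq (ε / (2 * (t + 1)))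
      (by positivity)
    refine ⟨n₀, fun n hn k hk => ?_⟩
    have h1 := hn₀ n hn k hk
    rw [dist_eq_norm] at h1 hz ⊢
    have h2 := norm_expSemigroup_sub_le (hpos _ (hMm n)).le (hNn _ (hMm n)) (hpos _ (hMm k)).le
      (hNn _ (hMm k)) (((hcommQ _ _ (hMm n) (hMm k)).smul_left _).smul_right _) t z
    have h3 : V n t x - V k t x = V n t (x - z) + (V n t z - V k t z) - V k t (x - z) := by
      simp only [map_sub]; abel
    rw [h3]
    have h4 := (hV n).norm_apply_le t (x - z)
    have h5 := (hV k).norm_apply_le t (x - z)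
    have h6 : ‖V n t z - V k t z‖ ≤ ε / 2 := by
      refine h2.trans ?_
      calc _ ≤ ε / (2 * (t + 1)) * t := by gcongr
        _ ≤ ε / (2 * (t + 1)) * (t + 1) := by gcongr; linarith
        _ = ε / 2 := by field_simp
    have h7 := norm_sub_le (V n t (x - z) + (V n t z - V k t z)) (V k t (x - z))
    have h8 := norm_add_le (V n t (x - z)) (V n t z - V k t z)
    linarith
  choose u hu using fun t x => cauchySeq_tendsto_of_complete (hcauchy t x)
  have hub : ∀ t x, ‖u t x‖ ≤ ‖x‖ := fun t x =>
    le_of_tendsto' (hu t x).norm fun n => (hV n).norm_apply_le t x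
  let U : ℝ≥0 → X →L[ℂ] X := fun t =>
    LinearMap.mkContinuous
      { toFun := u t
        map_add' := fun x y => tendsto_nhds_unique (hu t (x + y))
          (((hu t x).add (hu t y)).congr fun n => (_root_.map_add _ _ _).symm)
        map_smul' := fun c x => tendsto_nhds_unique (hu t (c • x))
          (((hu t x).const_smul c).congr fun n => (map_smul _ _ _).symm) } 1
      (fun x => by rw [one_mul]; exact hub t x)
  have hU : ∀ t x, Tendsto (fun n => V n t x) atTop (𝓝 (U t x)) := hu
  have hUb : ∀ t x, ‖U t x‖ ≤ ‖x‖ := hub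
  have hUt : ∀ x y, (x, y) ∈ H → ∀ t : ℝ≥0, ‖U t x - x‖ ≤ ‖y‖ * t := by
    intro x y hxy t
    refine le_of_tendsto_of_tendsto' ((hU t x).sub_const x).norm
      ((hY x y hxy).norm.mul_const (t : ℝ)) fun n => ?_
    refine (hV n).norm_map_sub_le (ContinuousLinearMap.id ℂ X) (mem_generatorGraph_expSemigroup x)
      fun r _ => (hV n).norm_apply_le _ _
  have hUc : IsContractionSemigroup U := by
    constructor
    · constructor
      · ext x
        refine tendsto_nhds_unique (hU 0 x) ?_
        simp only [(hV _).map_zero]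
        exact tendsto_const_nhds
      · intro s t
        ext x
        refine tendsto_nhds_unique (hU (s + t) x) ?_
        have h1 : Tendsto (fun n => V n s (V n t x - U t x)) atTop (𝓝 0) := by
          refine squeeze_zero_norm (fun n => (hV n).norm_apply_le _ _) ?_
          simpa using ((hU t x).sub_const (U t x)).norm
        have := h1.add (hU s (U t x))
        rw [zero_add] at this
        refine this.congr fun n => ?_
        rw [(hV n).add_apply, map_sub, sub_add_cancel]
      · intro x
        rw [Metric.tendsto_nhdsWithin_nhds]
        intro ε hε
        obtain ⟨z, ⟨w, hw⟩, hz⟩ := hd.exists_dist_lt x (ε := ε / 4) (by positivity)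
        refine ⟨ε / (2 * (‖w‖ + 1)), by positivity, fun {t} _ ht => ?_⟩
        rw [NNReal.dist_eq, NNReal.coe_zero, sub_zero, abs_of_nonneg t.coe_nonneg,
          lt_div_iff₀ (by positivity)] at ht
        rw [dist_eq_norm] at hz ⊢
        have h1 := hUt z w hw t
        have h2 := hUb t (x - z)
        have h3 : U t x - x = U t (x - z) + (U t z - z) - (x - z) := by
          simp only [map_sub]; abel
        rw [h3]
        have h7 := norm_sub_le (U t (x - z) + (U t z - z)) (x - z)
        have h8 := norm_add_le (U t (x - z)) (U t z - z)
        have := t.coe_nonneg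
        nlinarith
    · exact fun t => ContinuousLinearMap.opNorm_le_bound _ zero_le_one fun x => by
        rw [one_mul]; exact hUb t x
  have hsub : ∀ x y, (x, y) ∈ H → (x, y) ∈ generatorGraph U := by
    intro x y hxy
    -- Taking z in the domain close to y bounds V_n(r)y - y by 2‖y-z‖ plus a multiple of t,
    -- uniformly in n up to a vanishing error. This equicontinuity makes the derivative at 0 survive
    -- the limit in n.
    have key : ∀ z w, (z, w) ∈ H → ∀ t : ℝ≥0,
        ‖U t x - x + (t : ℝ) • y‖ ≤ (2 * ‖y - z‖ + ‖w‖ * t) * t := by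
      intro z w hzw t
      have hb : ∀ n, ‖V n t x - x + (t : ℝ) • y‖ ≤
          (2 * ‖y - z‖ + ‖M n • (z - (M n • Q (M n)) z)‖ * t +
            ‖y - M n • (x - (M n • Q (M n)) x)‖) * t := by
        intro n
        have := norm_image_sub_le_of_norm_deriv_right_le_segment (a := 0) (b := (t : ℝ))
          (C := 2 * ‖y - z‖ + ‖M n • (z - (M n • Q (M n)) z)‖ * t +
            ‖y - M n • (x - (M n • Q (M n)) x)‖)
          (f := fun r : ℝ => V n r.toNNReal x + r • y)
          (f' := fun r => -V n r.toNNReal (M n • (x - (M n • Q (M n)) x)) + (1 : ℝ) • y)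
          (((hV n).continuous_real _).add (by fun_prop)).continuousOn
          (fun r hr => ((hV n).toIsC0Semigroup.hasDerivWithinAt
            (mem_generatorGraph_expSemigroup x) hr.1).add
            ((hasDerivAt_id r).smul_const y).hasDerivWithinAt)
          (fun r hr => by
            have h1 : -V n r.toNNReal (M n • (x - (M n • Q (M n)) x)) + (1 : ℝ) • y =
              (y - z) - V n r.toNNReal (y - z) - (V n r.toNNReal z - z)  +
                V n r.toNNReal (y - M n • (x - (M n • Q (M n)) x)) := by
                simp only [map_sub, one_smul]; abel
            have h2 : ‖V n r.toNNReal z - z‖ ≤ ‖M n • (z - (M n • Q (M n)) z)‖ * t := by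
              have : ‖V n r.toNNReal z - z‖ ≤ ‖M n • (z - (M n • Q (M n)) z)‖ * r.toNNReal :=
                (hV n).norm_map_sub_le (ContinuousLinearMap.id ℂ X)
                  (mem_generatorGraph_expSemigroup z) fun r _ => (hV n).norm_apply_le _ _
              refine this.trans ?_
              gcongr
              exact Real.toNNReal_le_iff_le_coe.2 hr.2.le
            have h3 := (hV n).norm_apply_le r.toNNReal (y - z)
            have h4 := (hV n).norm_apply_le r.toNNReal (y - M n • (x - (M n • Q (M n)) x))
            rw [h1]
            refine (norm_add_le _ _).trans (add_le_add ?_ h4)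
            refine (norm_sub_le _ _).trans (add_le_add ?_ h2)
            refine (norm_sub_le _ _).trans ?_
            linarith)
          t ⟨t.2, le_rfl⟩
        simpa [(hV n).map_zero, add_sub_right_comm] using this
      refine le_of_tendsto_of_tendsto' (((hU t x).sub_const x).add_const ((t : ℝ) • y)).norm ?_ hb
      have h1 := (hY z w hzw).norm
      have h2 : Tendsto (fun n => ‖y - M n • (x - (M n • Q (M n)) x)‖) atTop (𝓝 0) := by
        simpa using ((hY x y hxy).const_sub y).norm
      simpa using (((h1.mul_const (t : ℝ)).const_add (2 * ‖y - z‖)).add h2).mul_const (t : ℝ)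
    rw [mem_generatorGraph_iff, Metric.tendsto_nhdsWithin_nhds]
    intro ε hε
    obtain ⟨z, ⟨w, hw⟩, hz⟩ := hd.exists_dist_lt y (ε := ε / 4) (by positivity)
    refine ⟨ε / (2 * (‖w‖ + 1)), by positivity, fun {h} hh hhd => ?_⟩
    have hh0 : 0 < h := hh
    rw [Real.dist_eq, sub_zero, abs_of_pos hh0, lt_div_iff₀ (by positivity)] at hhd
    have hk := key z w hw h.toNNReal
    rw [Real.coe_toNNReal _ hh0.le] at hk
    rw [dist_eq_norm] at hz ⊢
    have h2 : h⁻¹ • (x - U h.toNNReal x) - y = -(h⁻¹ • (U h.toNNReal x - x + h • y)) := by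
      rw [smul_add, smul_smul, inv_mul_cancel₀ hh0.ne', one_smul, smul_sub, smul_sub]; abel
    rw [h2, norm_neg, norm_smul, norm_inv, Real.norm_of_nonneg hh0.le, inv_mul_lt_iff₀ hh0]
    refine hk.trans_lt ?_
    rw [mul_comm]
    gcongr
    nlinarith [norm_nonneg w]
  refine ⟨U, hUc, fun x y => ⟨fun hxy => ?_, hsub x y⟩⟩
  -- Reverse inclusion: z solves (H+m₀)z = y + m₀x, so x - z is annihilated by the generator of U
  -- plus m₀, and accretivity forces x = z.
  set z := Q m₀ (y + m₀ • x) with hz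
  have hzH := hQ m₀ le_rfl (y + m₀ • x)
  rw [← hz] at hzH
  have hdiff := Submodule.sub_mem _ hxy (hsub _ _ hzH)
  have hacc := hUc.accretive hdiff m₀
  have e : y - (y + m₀ • x - m₀ • z) + (m₀ : ℂ) • (x - z) = 0 := by
    rw [Complex.coe_smul, smul_sub]; abel
  change m₀ * ‖x - z‖ ≤ ‖y - (y + m₀ • x - m₀ • z) + (m₀ : ℂ) • (x - z)‖ at hacc
  rw [e, norm_zero] at hacc
  have hxz : x = z := by
    have : ‖x - z‖ ≤ 0 := by
      by_contra hcon
      push Not at hcon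
      nlinarith [mul_pos hm₀ hcon]
    exact sub_eq_zero.1 (norm_le_zero_iff.1 this)
  rw [← hxz, add_sub_cancel_right] at hzH
  exact hzH

/-! ### Holomorphic semigroups and fractional powers -/

/-- Sectors are invariant under positive dilations, so a ball around 1 settles all s. -/
theorem exists_closedBall_subset_sector {θ : ℝ} (hθ : 0 < θ) :
    ∃ r : ℝ, 0 < r ∧ ∀ s : ℝ, 0 < s → Metric.closedBall (s : ℂ) (r * s) ⊆ sector θ := by
  have h1 : ContinuousAt Complex.arg 1 := Complex.continuousAt_arg (Or.inl (by simp))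
  have h2 : ∀ᶠ z in 𝓝 (1 : ℂ), |z.arg| < θ ∧ z ≠ 0 := by
    refine Filter.Eventually.and ?_ (isOpen_ne.mem_nhds one_ne_zero)
    have : Tendsto (fun z : ℂ => |z.arg|) (𝓝 1) (𝓝 0) := by
      simpa using h1.abs.tendsto
    exact this.eventually_lt_const hθ
  obtain ⟨r, hr, hb⟩ := Metric.nhds_basis_closedBall.eventually_iff.1 h2
  refine ⟨r, hr, fun s hs z hz => ?_⟩
  have hs' : (s : ℂ) ≠ 0 := by exact_mod_cast hs.ne'
  have hw : z / s ∈ Metric.closedBall (1 : ℂ) r := by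
    rw [Metric.mem_closedBall, dist_eq_norm] at hz ⊢
    have : z / s - 1 = (z - s) / s := by field_simp
    rw [this, norm_div, Complex.norm_real, Real.norm_of_nonneg hs.le, div_le_iff₀ hs]
    exact hz
  have e : z = (s : ℂ) * (z / s) := by field_simp
  obtain ⟨h3, h4⟩ := hb hw
  refine ⟨fun h => h4 (by simp [h]), ?_⟩
  rw [e, Complex.arg_real_mul _ hs]
  exact h3

/-- For a holomorphic semigroup, `A T(s)` is bounded by a multiple of `1 / s`. -/
theorem IsHolomorphicContractionSemigroup.exists_generator_mul {θ : ℝ} (hθ : 0 < θ)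
    {T : ℝ≥0 → X →L[ℂ] X} (hT : IsHolomorphicContractionSemigroup θ T) :
    ∃ (C : ℝ) (D : ℝ → X →L[ℂ] X), 0 ≤ C ∧
      (∀ s : ℝ, 0 < s → ∀ x, (T s.toNNReal x, D s x) ∈ generatorGraph T) ∧
      (∀ s : ℝ, 0 < s → ‖D s‖ ≤ C / s) ∧
      ContinuousOn (fun s : ℝ => T s.toNNReal) (Ioi 0) := by
  obtain ⟨W, hW, hWT⟩ := hT.exists_extension
  have hWT' : ∀ s : ℝ, 0 < s → W (s : ℂ) = T s.toNNReal := by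
    intro s hs
    have := hWT s.toNNReal (Real.toNNReal_pos.2 hs)
    rwa [Real.coe_toNNReal s hs.le] at this
  obtain ⟨M, hM⟩ := hW.bounded (θ / 2) (by positivity) (by linarith)
  obtain ⟨r, hr, hball⟩ := exists_closedBall_subset_sector (half_pos hθ)
  have hsub : sector (θ / 2) ⊆ sector θ := fun z hz => ⟨hz.1, hz.2.trans (by linarith)⟩
  have hmem : ∀ s : ℝ, 0 < s → (s : ℂ) ∈ sector (θ / 2) := fun s hs =>
    hball s hs (Metric.mem_closedBall_self (by positivity))
  have hM0 : 0 ≤ M := by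
    have := hM 1 (by rw [show θ - θ / 2 = θ / 2 by ring]; exact_mod_cast hmem 1 one_pos)
    exact (norm_nonneg _).trans this
  -- M bounds W on the half sector, and Cauchy's estimate on the circle of radius r s around s gives
  -- M/(r s).
  refine ⟨M / r, fun s => -deriv W s, by positivity, fun s hs x => ?_, fun s hs => ?_, ?_⟩
  · have hd : HasDerivAt W (deriv W s) (s : ℂ) :=
      (hW.analytic s (hsub (hmem s hs))).differentiableAt.hasDerivAt
    have hd1 : HasDerivAt (fun u : ℂ => W u x) (deriv W s x) (s : ℂ) :=
      (ContinuousLinearMap.apply ℂ X x).hasFDerivAt.comp_hasDerivAt _ hd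
    have hd2 := (hd1.scomp s Complex.ofRealCLM.hasDerivAt).tendsto_slope_zero_right.neg
    rw [Complex.ofRealCLM_apply, Complex.ofReal_one, one_smul] at hd2
    simp only [Function.comp_apply] at hd2
    rw [mem_generatorGraph_iff]
    change Tendsto _ _ (𝓝 (-(deriv W s x)))
    refine hd2.congr' ?_
    filter_upwards [self_mem_nhdsWithin] with h hh
    have hh0 : 0 < h := hh
    rw [hWT' s hs, hWT' (s + h) (by linarith), ← smul_neg, neg_sub, Real.toNNReal_add hs.le hh0.le,
      hT.apply_comm, ← hT.add_apply, add_comm]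
  · rw [norm_neg, div_div]
    refine Complex.norm_deriv_le_of_forall_mem_sphere_norm_le (by positivity) ?_ ?_
    · refine DifferentiableOn.diffContOnCl fun z hz => ?_
      rw [closure_ball _ (by positivity)] at hz
      exact (hW.analytic z (hsub (hball s hs hz))).differentiableAt.differentiableWithinAt
    · intro z hz
      refine hM z ?_
      rw [show θ - θ / 2 = θ / 2 by ring]
      exact hball s hs (Metric.sphere_subset_closedBall hz)
  · intro s hs
    have h1 : ContinuousAt (fun u : ℝ => W (u : ℂ)) s :=
      (hW.analytic s (hsub (hmem s hs))).continuousAt.comp Complex.continuous_ofReal.continuousAt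
    refine (h1.continuousWithinAt).congr (fun u hu => (hWT' u hu).symm) (hWT' s hs).symm

section FracPower

variable {T : ℝ≥0 → X →L[ℂ] X} {α C : ℝ}

/-- `LinearPMap.closure` returns the operator itself when it is not closable, so the inclusion holds
either way and closability need not be shown. -/
theorem fracPower_apply_mem_closure (hα : α ≠ 0) (x : (fracPower T α).domain) :
    ((x : X), fracPower T α x) ∈ closure ((fracPowerOnGenerator T α).graph : Set (X × X)) := by
  have e : fracPower T α = (fracPowerOnGenerator T α).closure := by simp [fracPower, hα]
  have hx : ((x : X), fracPower T α x) ∈ (fracPowerOnGenerator T α).closure.graph := by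
    rw [← e]; exact (fracPower T α).mem_graph x
  by_cases hc : (fracPowerOnGenerator T α).IsClosable
  · rw [← hc.graph_closure_eq_closure_graph] at hx
    exact hx
  · rw [LinearPMap.closure_def' hc] at hx
    exact subset_closure hx

/-- The operators `A ^ α T(s)` and `T(s) A ^ α` are bounded by a multiple of `s ^ (-α)`. -/
theorem exists_fracPower_mul [CompleteSpace X] (hT : IsContractionSemigroup T)
    (hC : ∀ s : ℝ, 0 < s → ∀ l : ℝ, 0 ≤ l → ‖T (l + s).toNNReal - T s.toNNReal‖ ≤ C / s * l)
    (hcont : ContinuousOn (fun s : ℝ => T s.toNNReal) (Ioi 0)) (hC0 : 0 ≤ C)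
    (h0 : 0 < α) (h1 : α < 1) :
    ∃ K : ℝ, 0 ≤ K ∧ ∀ s : ℝ, 0 < s → ∃ E : X →L[ℂ] X, ‖E‖ ≤ K * s ^ (-α) ∧
      ∀ x : (fracPower T α).domain, T s.toNNReal (fracPower T α x) = E x := by
  set c : ℝ := (Real.Gamma (-α))⁻¹ with hc
  have h1α : 0 < 1 - α := by linarith
  refine ⟨|c| * (C / (1 - α) + 2 / α), by positivity, fun s hs => ?_⟩
  -- Moving T(s) under the integral gives an operator-valued integrand. Its increment is at most C
  -- l/s for l ≤ s and at most 2 for l > s, and both pieces integrate to order s^{-α}.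
  set F : ℝ → X →L[ℂ] X := fun l =>
    ((l ^ (-α - 1) : ℝ) : ℂ) • (T (l + s).toNNReal - T s.toNNReal) with hF
  have hFc : ContinuousOn F (Ioi 0) := by
    have c1 : ContinuousOn (fun l : ℝ => ((l ^ (-α - 1) : ℝ) : ℂ)) (Ioi 0) := fun l hl => by
      have : ContinuousAt (fun l : ℝ => ((l ^ (-α - 1) : ℝ) : ℂ)) l :=
        Complex.continuous_ofReal.continuousAt.comp
          (Real.continuousAt_rpow_const _ _ (Or.inl (ne_of_gt hl)))
      exact this.continuousWithinAt
    have c2 : ContinuousOn (fun l : ℝ => T (l + s).toNNReal) (Ioi 0) :=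
      hcont.comp (f := fun l : ℝ => l + s) (by fun_prop) fun l hl => by
        have : 0 < l := hl
        exact mem_Ioi.2 (by linarith)
    exact c1.smul (c2.sub continuousOn_const)
  have hFn : ∀ l : ℝ, 0 < l → ‖F l‖ = l ^ (-α - 1) * ‖T (l + s).toNNReal - T s.toNNReal‖ := by
    intro l hl
    rw [hF]
    simp only
    rw [norm_smul, Complex.norm_real, Real.norm_of_nonneg (Real.rpow_nonneg hl.le _)]
  have hF1 : ∀ l ∈ Ioc 0 s, ‖F l‖ ≤ C / s * l ^ (-α) := by
    intro l hl
    rw [hFn l hl.1]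
    calc _ ≤ l ^ (-α - 1) * (C / s * l) := by
          have := hC s hs l hl.1.le
          have := Real.rpow_nonneg hl.1.le (-α - 1)
          gcongr
      _ = C / s * l ^ (-α) := by
        rw [Real.rpow_sub_one hl.1.ne']
        have := hl.1.ne'
        field_simp
  have hF2 : ∀ l ∈ Ioi s, ‖F l‖ ≤ 2 * l ^ (-α - 1) := by
    intro l hl
    have hl0 : 0 < l := hs.trans hl
    rw [hFn l hl0, mul_comm]
    have := Real.rpow_nonneg hl0.le (-α - 1)
    gcongr
    refine (norm_sub_le _ _).trans ?_
    linarith [hT.norm_le_one (l + s).toNNReal, hT.norm_le_one s.toNNReal]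
  have hg1 : IntegrableOn (fun l : ℝ => C / s * l ^ (-α)) (Ioc 0 s) := by
    have := intervalIntegral.intervalIntegrable_rpow' (a := 0) (b := s) (r := -α) (by linarith)
    exact ((intervalIntegrable_iff_integrableOn_Ioc_of_le hs.le).1 this).const_mul _
  have hg2 : IntegrableOn (fun l : ℝ => 2 * l ^ (-α - 1)) (Ioi s) :=
    (integrableOn_Ioi_rpow_of_lt (by linarith) hs).const_mul _
  have hi1 : IntegrableOn F (Ioc 0 s) :=
    Integrable.mono' hg1 ((hFc.mono fun l hl => hl.1).aestronglyMeasurable measurableSet_Ioc)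
      ((ae_restrict_iff' measurableSet_Ioc).2 (ae_of_all _ hF1))
  have hi2 : IntegrableOn F (Ioi s) :=
    Integrable.mono' hg2 ((hFc.mono fun l hl => hs.trans hl).aestronglyMeasurable measurableSet_Ioi)
      ((ae_restrict_iff' measurableSet_Ioi).2 (ae_of_all _ hF2))
  have hi : IntegrableOn F (Ioi 0) := by
    rw [← Ioc_union_Ioi_eq_Ioi hs.le]
    exact hi1.union hi2
  have hn : ‖∫ l in Ioi (0 : ℝ), F l‖ ≤ (C / (1 - α) + 2 / α) * s ^ (-α) := by
    rw [← Ioc_union_Ioi_eq_Ioi hs.le, setIntegral_union (Ioc_disjoint_Ioi le_rfl) measurableSet_Ioi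
      hi1 hi2]
    refine (norm_add_le _ _).trans ?_
    rw [add_mul]
    refine add_le_add ?_ ?_
    · refine (norm_integral_le_of_norm_le hg1
        ((ae_restrict_iff' measurableSet_Ioc).2 (ae_of_all _ hF1))).trans (le_of_eq ?_)
      rw [← intervalIntegral.integral_of_le hs.le, intervalIntegral.integral_const_mul,
        integral_rpow (Or.inl (by linarith)), Real.zero_rpow (by linarith), sub_zero,
        Real.rpow_add_one hs.ne', neg_add_eq_sub]
      field_simp
    · refine (norm_integral_le_of_norm_le hg2
        ((ae_restrict_iff' measurableSet_Ioi).2 (ae_of_all _ hF2))).trans (le_of_eq ?_)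
      rw [integral_const_mul, integral_Ioi_rpow_of_lt (by linarith) hs, sub_add_cancel]
      field_simp
  refine ⟨(c : ℂ) • ∫ l in Ioi (0 : ℝ), F l, ?_, fun x => ?_⟩
  · rw [norm_smul, Complex.norm_real, Real.norm_eq_abs, mul_assoc]
    gcongr
  · set E : X →L[ℂ] X := (c : ℂ) • ∫ l in Ioi (0 : ℝ), F l with hE
    -- Both sides of the identity are continuous on X × X, so it passes from the integral operator
    -- to its closure.
    have hcl : closure ((fracPowerOnGenerator T α).graph : Set (X × X)) ⊆
        {p | T s.toNNReal p.2 = E p.1} := by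
      refine closure_minimal ?_ (isClosed_eq (by fun_prop) (by fun_prop))
      intro p hp
      obtain ⟨z, hz1, hz2⟩ := LinearPMap.mem_graph_iff _ |>.1 hp
      change T s.toNNReal p.2 = E p.1
      rw [← hz1, ← hz2]
      change T s.toNNReal ((c : ℂ) • ∫ l in Ioi (0 : ℝ), fracIntegrand T α (z : X) l) = E z
      rw [map_smul, ← ContinuousLinearMap.integral_comp_comm _ z.2.2, hE, _root_.smul_apply,
        ContinuousLinearMap.integral_apply hi]
      congr 1
      refine setIntegral_congr_fun measurableSet_Ioi fun l hl => ?_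
      simp only [fracIntegrand, hF, map_smul, map_sub, _root_.smul_apply, _root_.sub_apply]
      rw [Real.toNNReal_add (le_of_lt hl) hs.le, add_comm, hT.add_apply]
    exact hcl (fracPower_apply_mem_closure h0.ne' x)

/-- Since T(s)A^α agrees with a bounded operator E, the functional φ∘T(s) is in the domain of the
adjoint, with image φ∘E. For α = 0 the power is the identity and E = T(s). -/
theorem exists_dualAdjointGraph_fracPower [CompleteSpace X] (hT : IsContractionSemigroup T)
    (hC : ∀ s : ℝ, 0 < s → ∀ l : ℝ, 0 ≤ l → ‖T (l + s).toNNReal - T s.toNNReal‖ ≤ C / s * l)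
    (hcont : ContinuousOn (fun s : ℝ => T s.toNNReal) (Ioi 0)) (hC0 : 0 ≤ C)
    (h0 : 0 ≤ α) (h1 : α < 1) :
    ∃ K : ℝ, 0 ≤ K ∧ ∀ s : ℝ, 0 < s → ∀ φ : StrongDual ℂ X, ∃ ψ : StrongDual ℂ X,
      ‖ψ‖ ≤ K * s ^ (-α) * ‖φ‖ ∧
      (φ.comp (T s.toNNReal), ψ) ∈ dualAdjointGraph (fracPower T α) := by
  rcases h0.eq_or_lt with rfl | h0
  · refine ⟨1, zero_le_one, fun s hs φ => ⟨φ.comp (T s.toNNReal), ?_, fun x => ?_⟩⟩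
    · rw [neg_zero, Real.rpow_zero, mul_one, one_mul]
      refine (ContinuousLinearMap.opNorm_comp_le _ _).trans ?_
      exact mul_le_of_le_one_right (norm_nonneg _) (hT.norm_le_one _)
    · have key : ∀ F : X →ₗ.[ℂ] X, F = (LinearMap.id : X →ₗ[ℂ] X).toPMap ⊤ →
          ∀ x : F.domain, F x = x := by
        rintro _ rfl x; rfl
      rw [key (fracPower T 0) (by simp [fracPower]) x]
  · obtain ⟨K, hK, h⟩ := exists_fracPower_mul hT hC hcont hC0 h0 h1
    refine ⟨K, hK, fun s hs φ => ?_⟩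
    obtain ⟨E, hE, hE2⟩ := h s hs
    refine ⟨φ.comp E, ?_, fun x => ?_⟩
    · refine (ContinuousLinearMap.opNorm_comp_le _ _).trans ?_
      rw [mul_comm]
      gcongr
    · change φ (T s.toNNReal _) = φ (E x)
      rw [hE2]

end FracPower

/-! ### Closed graph arguments and the smoothing estimate -/

/-- A closed subspace G of Y × Y is a Banach space for the graph norm, so the closed graph theorem
applies on it. -/
theorem exists_bound_of_closed_graph {Y : Type*} [NormedAddCommGroup Y] [NormedSpace ℂ Y]
    [CompleteSpace Y] {G : Submodule ℂ (Y × Y)} (hG : IsClosed (G : Set (Y × Y))) (f : G →ₗ[ℂ] Y)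
    (hf : ∀ (u : ℕ → G) (p : G) (ξ : Y), Tendsto u atTop (𝓝 p) →
      Tendsto (fun n => f (u n)) atTop (𝓝 ξ) → ξ = f p) :
    ∃ K : ℝ, 0 ≤ K ∧ ∀ p : G, ‖f p‖ ≤ K * ‖(p : Y × Y)‖ := by
  have : CompleteSpace G := hG.completeSpace_coe
  let g : G →L[ℂ] Y := ⟨f, f.continuous_of_seq_closed_graph hf⟩
  exact ⟨‖g‖, g.opNorm_nonneg, g.le_opNorm⟩

theorem isClosed_dualAdjointGraph (F : X →ₗ.[ℂ] X) :
    IsClosed (dualAdjointGraph F : Set (StrongDual ℂ X × StrongDual ℂ X)) := by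
  have : (dualAdjointGraph F : Set (StrongDual ℂ X × StrongDual ℂ X)) =
      ⋂ x : F.domain, {p | p.1 (F x) = p.2 x} := by
    ext p
    simp [dualAdjointGraph]
  rw [this]
  refine isClosed_iInter fun x => isClosed_eq ?_ ?_
  · exact (ContinuousLinearMap.apply ℂ ℂ (F x)).continuous.comp continuous_fst
  · exact (ContinuousLinearMap.apply ℂ ℂ (x : X)).continuous.comp continuous_snd

theorem dualAdjoint_apply {F : X →ₗ.[ℂ] X} (hF : Dense (F.domain : Set X))
    (φ : (dualAdjoint F).domain) (x : F.domain) : (φ : StrongDual ℂ X) (F x) = dualAdjoint F φ x :=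
  (mem_graph_dualAdjoint F hF _ _).1 ((dualAdjoint F).mem_graph φ) x

/-- If `dom F* ⊆ dom B*`, then `B*` is bounded with respect to the graph norm of `F*`. -/
theorem exists_dualAdjoint_bound {F B : X →ₗ.[ℂ] X} (hB : Dense (B.domain : Set X))
    (h : (dualAdjoint F).domain ≤ (dualAdjoint B).domain) :
    ∃ K : ℝ, 0 ≤ K ∧ ∀ p ∈ dualAdjointGraph F, ∀ x : B.domain,
      ‖p.1 (B x)‖ ≤ K * max ‖p.1‖ ‖p.2‖ * ‖(x : X)‖ := by
  have hdom : ∀ p ∈ dualAdjointGraph F, p.1 ∈ (dualAdjoint B).domain := fun p hp =>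
    h ((mem_dualAdjoint_domain F p.1).2 ⟨p.2, hp⟩)
  -- The map lives on pairs (φ, ψ) rather than on φ, so F need not be densely defined.
  let f : dualAdjointGraph F →ₗ[ℂ] StrongDual ℂ X :=
    { toFun := fun p => dualAdjoint B ⟨p.1.1, hdom p.1 p.2⟩
      map_add' := fun p q => by rw [← LinearPMap.map_add]; rfl
      map_smul' := fun c p => by rw [RingHom.id_apply, ← LinearPMap.map_smul]; rfl }
  have hf : ∀ (p : dualAdjointGraph F) (x : B.domain), p.1.1 (B x) = f p x := fun p x =>
    dualAdjoint_apply hB ⟨p.1.1, hdom p.1 p.2⟩ x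
  obtain ⟨K, hK, hb⟩ := exists_bound_of_closed_graph (isClosed_dualAdjointGraph F) f
    fun u p ξ hu hfu => by
    refine DFunLike.coe_injective (Continuous.ext_on hB ξ.continuous (f p).continuous ?_)
    intro x hx
    have h1 : Tendsto (fun n => f (u n) x) atTop (𝓝 (ξ x)) :=
      ((ContinuousLinearMap.apply ℂ ℂ x).continuous.tendsto ξ).comp hfu
    have h2 : Tendsto (fun n => (u n).1.1 (B ⟨x, hx⟩)) atTop (𝓝 (p.1.1 (B ⟨x, hx⟩))) := by
      have : Continuous fun p : dualAdjointGraph F => p.1.1 (B ⟨x, hx⟩) :=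
        (ContinuousLinearMap.apply ℂ ℂ (B ⟨x, hx⟩)).continuous.comp
          (continuous_fst.comp continuous_subtype_val)
      exact (this.tendsto p).comp hu
    have h3 := hf p ⟨x, hx⟩
    rw [← h3]
    exact tendsto_nhds_unique h1 (h2.congr fun n => hf (u n) ⟨x, hx⟩)
  refine ⟨K, hK, fun p hp x => ?_⟩
  rw [hf ⟨p, hp⟩ x]
  refine ((f ⟨p, hp⟩).le_opNorm x).trans ?_
  gcongr
  exact hb ⟨p, hp⟩

/-- The smoothing estimate `‖T(s) B‖ ≤ K (1 + s ^ (-α))`. -/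
theorem exists_smoothing [CompleteSpace X] {T S : ℝ≥0 → X →L[ℂ] X} {α C : ℝ}
    (hT : IsContractionSemigroup T) (hS : IsContractionSemigroup S)
    (hC : ∀ s : ℝ, 0 < s → ∀ l : ℝ, 0 ≤ l → ‖T (l + s).toNNReal - T s.toNNReal‖ ≤ C / s * l)
    (hcont : ContinuousOn (fun s : ℝ => T s.toNNReal) (Ioi 0)) (hC0 : 0 ≤ C)
    (h0 : 0 ≤ α) (h1 : α < 1)
    (hfrac : (dualAdjoint (fracPower T α)).domain ≤ (dualAdjoint (generator S)).domain) :
    ∃ K : ℝ, 0 ≤ K ∧ ∀ s : ℝ, 0 < s → ∀ x y, (x, y) ∈ generatorGraph S →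
      ‖T s.toNNReal y‖ ≤ K * (1 + s ^ (-α)) * ‖x‖ := by
  obtain ⟨K₁, hK₁, hψ⟩ := exists_dualAdjointGraph_fracPower hT hC hcont hC0 h0 h1
  obtain ⟨K₂, hK₂, hb⟩ := exists_dualAdjoint_bound hS.dense_generator_domain hfrac
  refine ⟨K₂ * (1 + K₁), by positivity, fun s hs x y hxy => ?_⟩
  have hs0 := Real.rpow_nonneg hs.le (-α)
  -- Duality: φ(T(s)Bx) is the functional φ∘T(s) evaluated at Bx, and B* is bounded on that
  -- functional by its graph norm.
  refine NormedSpace.norm_le_dual_bound ℂ _ (by positivity) fun φ => ?_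
  obtain ⟨ψ, hψn, hψm⟩ := hψ s hs φ
  have hx : x ∈ (generator S).domain := mem_generator_domain.2 ⟨y, hxy⟩
  have hy : generator S ⟨x, hx⟩ = y := generator_apply_eq hxy
  have := hb _ hψm ⟨x, hx⟩
  rw [hy] at this
  have hmax : max ‖φ.comp (T s.toNNReal)‖ ‖ψ‖ ≤ (1 + K₁) * (1 + s ^ (-α)) * ‖φ‖ := by
    refine max_le ?_ ?_
    · refine (ContinuousLinearMap.opNorm_comp_le _ _).trans ?_
      refine (mul_le_of_le_one_right (norm_nonneg _) (hT.norm_le_one _)).trans ?_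
      refine le_mul_of_one_le_left (norm_nonneg _) ?_
      nlinarith
    · refine hψn.trans ?_
      gcongr <;> linarith
  calc ‖φ (T s.toNNReal y)‖ ≤ K₂ * max ‖φ.comp (T s.toNNReal)‖ ‖ψ‖ * ‖x‖ := this
    _ ≤ K₂ * ((1 + K₁) * (1 + s ^ (-α)) * ‖φ‖) * ‖x‖ := by gcongr
    _ = K₂ * (1 + K₁) * (1 + s ^ (-α)) * ‖x‖ * ‖φ‖ := by ring

/-- A bounded operator with range in the domain of a closed operator `B` has bounded composition
with `B`. -/
theorem exists_generator_comp [CompleteSpace X] {S : ℝ≥0 → X →L[ℂ] X}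
    (hS : IsContractionSemigroup S) (R : X →L[ℂ] X) (h : ∀ x, R x ∈ (generator S).domain) :
    ∃ L : X →L[ℂ] X, ∀ x, (R x, L x) ∈ generatorGraph S := by
  let f : X →ₗ[ℂ] X :=
    { toFun := fun x => generator S ⟨R x, h x⟩
      map_add' := fun x y => by
        rw [← LinearPMap.map_add]
        congr 2
        exact _root_.map_add R x y
      map_smul' := fun c x => by
        rw [RingHom.id_apply, ← LinearPMap.map_smul]
        congr 2
        exact map_smul R c x }
  refine ⟨⟨f, f.continuous_of_seq_closed_graph fun u x y hu hfu => ?_⟩, fun x =>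
    generator_mem S ⟨R x, h x⟩⟩
  have h1 : Tendsto (fun n => (R (u n), f (u n))) atTop (𝓝 (R x, y)) :=
    ((R.continuous.tendsto x).comp hu).prodMk_nhds hfu
  have h2 : (R x, y) ∈ generatorGraph S :=
    hS.isClosed_generatorGraph.mem_of_tendsto h1
      (Eventually.of_forall fun n => generator_mem S ⟨R (u n), h (u n)⟩)
  exact generatorGraph_unique h2 (generator_mem S ⟨R x, h x⟩)

/-! ### The sum as a generator, and its adjoint -/

/-- The bounded operators describing the sum of the generators of `T` and `S`: `R` is the inverse of
`A + m`, `G` the bounded extension of `R B`, `L = B R`, and `U` is generated by the operator `H`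
with `R (H + m) = 1 + G`. -/
structure IsPerturbation (T S U : ℝ≥0 → X →L[ℂ] X) (m : ℝ) (R G L : X →L[ℂ] X) : Prop where
  left : IsContractionSemigroup T
  right : IsContractionSemigroup S
  sum : IsContractionSemigroup U
  one_le : 1 ≤ m
  resolvent_mem : ∀ x, (R x, x) ∈ generatorGraph (shift m T)
  resolvent_apply : ∀ x y, (x, y) ∈ generatorGraph (shift m T) → R y = x
  ext_apply : ∀ x y, (x, y) ∈ generatorGraph S → G x = R y
  norm_ext_le : ‖G‖ ≤ 1 / 2
  comp_mem : ∀ x, (R x, L x) ∈ generatorGraph S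
  mem_iff : ∀ x y, (x, y) ∈ generatorGraph U ↔ x + G x = R (y + (m : ℂ) • x)

/-- A non-integrable function has integral 0 by convention, whereas the Gamma formula gives a
positive value. -/
theorem integrableOn_rpow_mul_exp {a m : ℝ} (ha : 0 < a) (hm : 0 < m) :
    IntegrableOn (fun t : ℝ => t ^ (a - 1) * Real.exp (-(m * t))) (Ioi 0) := by
  by_contra h
  have h1 := Real.integral_rpow_mul_exp_neg_mul_Ioi ha hm
  rw [integral_undef h] at h1
  have : 0 < (1 / m) ^ a * Real.Gamma a :=
    mul_pos (Real.rpow_pos_of_pos (by positivity) _) (Real.Gamma_pos_of_pos ha)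
  linarith

theorem exists_isUnit_one_add [CompleteSpace X] (G : X →L[ℂ] X) (hG : ‖G‖ ≤ 1 / 2) :
    ∃ J : X →L[ℂ] X, (∀ x, J (x + G x) = x) ∧ ∀ x, J x + G (J x) = x := by
  let u := Units.oneSub (-G) (by rw [norm_neg]; linarith)
  have hu : (u : X →L[ℂ] X) = 1 + G := by simp [u]
  refine ⟨(u⁻¹ : (X →L[ℂ] X)ˣ), fun x => ?_, fun x => ?_⟩
  · have := DFunLike.congr_fun u.inv_mul x
    rw [hu] at this
    exact this
  · have := DFunLike.congr_fun u.mul_inv x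
    rw [hu] at this
    exact this

theorem exists_bounded_extension [CompleteSpace X] {S : ℝ≥0 → X →L[ℂ] X}
    (hS : IsContractionSemigroup S) (R : X →L[ℂ] X) {c : ℝ} (hc : 0 ≤ c)
    (h : ∀ x y, (x, y) ∈ generatorGraph S → ‖R y‖ ≤ c * ‖x‖) :
    ∃ G : X →L[ℂ] X, (∀ x y, (x, y) ∈ generatorGraph S → G x = R y) ∧ ‖G‖ ≤ c := by
  have hden : DenseRange (generator S).domain.subtype := by
    rw [DenseRange]
    simpa using hS.dense_generator_domain
  have hb : ∀ x : (generator S).domain,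
      ‖((R : X →ₗ[ℂ] X) ∘ₗ (generator S).toFun) x‖ ≤ c * ‖(generator S).domain.subtype x‖ :=
    fun x => h _ _ (generator_mem S x)
  refine ⟨((R : X →ₗ[ℂ] X) ∘ₗ (generator S).toFun).extendOfNorm (generator S).domain.subtype,
    fun x y hxy => ?_, ?_⟩
  · have hx : x ∈ (generator S).domain := mem_generator_domain.2 ⟨y, hxy⟩
    have := LinearMap.extendOfNorm_eq hden ⟨c, hb⟩ ⟨x, hx⟩
    refine this.trans ?_
    exact congrArg R (generator_apply_eq (x := ⟨x, hx⟩) hxy)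
  · exact LinearMap.opNorm_extendOfNorm_le hden hc hb

section
variable {T S : ℝ≥0 → X →L[ℂ] X} {R G : X →L[ℂ] X} {m : ℝ}

theorem norm_integral_orbit_le (hS : IsContractionSemigroup S) (x : X) {h : ℝ} (hh : 0 ≤ h) :
    ‖∫ s in (0 : ℝ)..h, S s.toNNReal x‖ ≤ ‖x‖ * h := by
  have := intervalIntegral.norm_integral_le_of_norm_le_const (a := 0) (b := h) (C := ‖x‖)
    (f := fun s => S s.toNNReal x) fun s _ => hS.norm_apply_le _ _
  rwa [sub_zero, abs_of_nonneg hh] at this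

/-- Because B∫₀ʰS(s)x ds = x - S(h)x, increments of S under R are controlled for every x, not only
on the domain of B. -/
theorem map_sub_eq_extension [CompleteSpace X] (hS : IsContractionSemigroup S)
    (hG : ∀ x y, (x, y) ∈ generatorGraph S → G x = R y) (x : X) {h : ℝ} (hh : 0 ≤ h) :
    R (x - S h.toNNReal x) = G (∫ s in (0 : ℝ)..h, S s.toNNReal x) :=
  (hG _ _ (hS.integral_mem_generatorGraph x hh)).symm

/-- Dissipativity of the sum, through the bounded accretive approximations `(1 - S(h)) / h`. -/
theorem norm_le_of_add_eq [CompleteSpace X] (hT : IsContractionSemigroup T)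
    (hS : IsContractionSemigroup S) (hR : ∀ x, (R x, x) ∈ generatorGraph (shift m T))
    (hG : ∀ x y, (x, y) ∈ generatorGraph S → G x = R y) (hGn : ‖G‖ ≤ 1 / 2) {x y : X}
    (hxy : x + G x = R y) : m * ‖x‖ ≤ ‖y‖ := by
  -- Here z solves (A + m + B_h)z = y with B_h = (1-S(h))/h. Both A and B_h are accretive for the
  -- same tangent functional at z, which bounds z. The factor 2 inverts 1 + G_h, as ‖G_h‖ ≤ 1/2.
  have hGh : ∀ h : ℝ, 0 < h → ∃ z : X, m * ‖z‖ ≤ ‖y‖ ∧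
      ‖z - x‖ ≤ 2 * ‖G x - G (h⁻¹ • ∫ s in (0 : ℝ)..h, S s.toNNReal x)‖ := by
    intro h hh
    set Gh : X →L[ℂ] X := R ∘L (h⁻¹ • (1 - S h.toNNReal)) with hGh
    have hGha : ∀ v, Gh v = G (h⁻¹ • ∫ s in (0 : ℝ)..h, S s.toNNReal v) := by
      intro v
      rw [G.map_smul_of_tower, ← map_sub_eq_extension hS hG v hh.le, ← R.map_smul_of_tower]
      rfl
    have hGhn : ‖Gh‖ ≤ 1 / 2 := by
      refine ContinuousLinearMap.opNorm_le_bound _ (by norm_num) fun v => ?_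
      rw [hGha]
      refine G.le_of_opNorm_le_of_le hGn ?_
      rw [norm_smul, norm_inv, Real.norm_of_nonneg hh.le, inv_mul_le_iff₀ hh, mul_comm]
      exact norm_integral_orbit_le hS v hh.le
    obtain ⟨J, -, hJ⟩ := exists_isUnit_one_add Gh hGhn
    set z := J (R y) with hz
    have hz1 : z + Gh z = R y := hJ _
    refine ⟨z, ?_, ?_⟩
    · have hz2 : R (y - h⁻¹ • (z - S h.toNNReal z)) = z := by
        rw [map_sub, ← hz1]
        exact add_sub_cancel_right z (Gh z)
      have h1 := hR (y - h⁻¹ • (z - S h.toNNReal z))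
      rw [hz2, mem_generatorGraph_shift] at h1
      obtain ⟨φ, hφ, hφ'⟩ := exists_dual_vector'' ℂ z
      have hφz : φ z = ((‖z‖ : ℝ) : ℂ) := hφ'
      have h2 := hT.re_generator_nonneg hφ hφz h1
      have h3 := hS.re_sub_nonneg hφ hφz h.toNNReal
      rw [map_sub, map_sub, φ.map_smul_of_tower, map_smul, hφz, smul_eq_mul, ← Complex.ofReal_mul, Complex.sub_re, Complex.sub_re,
        Complex.smul_re, smul_eq_mul, Complex.ofReal_re] at h2
      have h4 : (φ y).re ≤ 1 * ‖y‖ := (Complex.re_le_norm _).trans (φ.le_of_opNorm_le hφ _)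
      have h5 := mul_nonneg (inv_nonneg.2 hh.le) h3
      linarith
    · have h1 : (z - x) + Gh (z - x) = G x - G (h⁻¹ • ∫ s in (0 : ℝ)..h, S s.toNNReal x) := by
        rw [← hGha, map_sub]
        have : z - x + (Gh z - Gh x) = (z + Gh z) - x - Gh x := by abel
        rw [this, hz1, ← hxy]
        abel
      have h2 : ‖Gh (z - x)‖ ≤ 1 / 2 * ‖z - x‖ := Gh.le_of_opNorm_le hGhn _
      have h3 := norm_sub_le ((z - x) + Gh (z - x)) (Gh (z - x))
      rw [add_sub_cancel_right, h1] at h3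
      linarith
  have hlim : Tendsto (fun h : ℝ => 2 * ‖G x - G (h⁻¹ • ∫ s in (0 : ℝ)..h, S s.toNNReal x)‖)
      (𝓝[>] 0) (𝓝 0) := by
    have h1 := (G.continuous.tendsto _).comp (tendsto_average (hS.continuous_real x))
    simp only [Real.toNNReal_zero, hS.map_zero, one_apply_eq_self] at h1
    simpa using ((h1.const_sub (G x)).norm).const_mul 2
  choose! z hz1 hz2 using hGh
  have hz : Tendsto z (𝓝[>] 0) (𝓝 x) := by
    rw [tendsto_iff_norm_sub_tendsto_zero]
    refine squeeze_zero' (Eventually.of_forall fun _ => norm_nonneg _) ?_ hlim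
    filter_upwards [self_mem_nhdsWithin] with h hh using hz2 h hh
  refine le_of_tendsto (hz.norm.const_mul m) ?_
  filter_upwards [self_mem_nhdsWithin] with h hh using hz1 h hh

end

/-- (1+G_m)⁻¹R_m is a candidate resolvent for all large m at once; the resolvent identities of R_m
and G_m show that it always belongs to the same operator, and `norm_le_of_add_eq` supplies the
Hille–Yosida bound. -/
theorem exists_isPerturbation [CompleteSpace X] {T S : ℝ≥0 → X →L[ℂ] X} {α K : ℝ}
    (hT : IsContractionSemigroup T) (hS : IsContractionSemigroup S) (h1 : α < 1)
    (hsm : ∀ s : ℝ, 0 < s → ∀ x y, (x, y) ∈ generatorGraph S →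
      ‖T s.toNNReal y‖ ≤ K * (1 + s ^ (-α)) * ‖x‖)
    (hdom : (generator T).domain ≤ (generator S).domain) :
    ∃ (U : ℝ≥0 → X →L[ℂ] X) (m : ℝ) (R G L : X →L[ℂ] X), IsPerturbation T S U m R G L := by
  have h1α : 0 < 1 - α := by linarith
  -- The Laplace transform at m of the smoothing bound K(1+s^{-α}); it tends to 0, which makes ‖G‖ ≤
  -- 1/2 attainable.
  set c : ℝ → ℝ := fun m => K * ((1 / m) ^ (1 : ℝ) * Real.Gamma 1 +
    (1 / m) ^ (1 - α) * Real.Gamma (1 - α)) with hc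
  have hclim : Tendsto c atTop (𝓝 0) := by
    have h2 : ∀ a : ℝ, 0 < a → Tendsto (fun m : ℝ => (1 / m) ^ a) atTop (𝓝 0) := by
      intro a ha
      have : Tendsto (fun m : ℝ => 1 / m) atTop (𝓝 0) := by
        simpa using tendsto_inv_atTop_zero (𝕜 := ℝ)
      have := this.rpow_const (p := a) (Or.inr ha.le)
      rwa [Real.zero_rpow ha.ne'] at this
    simpa [hc] using (((h2 1 one_pos).mul_const (Real.Gamma 1)).add
      ((h2 _ h1α).mul_const (Real.Gamma (1 - α)))).const_mul K
  obtain ⟨m₁, hm₁⟩ := eventually_atTop.1 (hclim.eventually_le_const (show (0 : ℝ) < 1 / 2 by norm_num))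
  set m₀ := max m₁ 1 with hm₀
  have hm₀1 : 1 ≤ m₀ := le_max_right _ _
  have hpos : ∀ m, m₀ ≤ m → 0 < m := fun m hm => by linarith
  choose! R hR1 hR2 hR3 using fun (m : ℝ) (hm : m₀ ≤ m) => hT.exists_resolvent (hpos m hm)
  have hGe : ∀ m, m₀ ≤ m → ∃ G : X →L[ℂ] X,
      (∀ x y, (x, y) ∈ generatorGraph S → G x = R m y) ∧ ‖G‖ ≤ 1 / 2 := by
    intro m hm
    have hp := hpos m hm
    refine exists_bounded_extension hS (R m) (by norm_num) fun x y hxy => ?_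
    have hi1 := integrableOn_rpow_mul_exp one_pos hp
    have hi2 := integrableOn_rpow_mul_exp h1α hp
    have hi := ((hi1.add hi2).const_mul K).mul_const ‖x‖
    have hle : ‖R m y‖ ≤ c m * ‖x‖ := by
      rw [hR3 m hm]
      refine (norm_integral_le_of_norm_le hi ?_).trans (le_of_eq ?_)
      · refine (ae_restrict_iff' measurableSet_Ioi).2 (ae_of_all _ fun s hs => ?_)
        have hs0 : 0 < s := hs
        rw [norm_smul, Real.norm_of_nonneg (Real.exp_nonneg _)]
        refine (mul_le_mul_of_nonneg_left (hsm s hs x y hxy) (Real.exp_nonneg _)).trans (le_of_eq ?_)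
        simp only [Pi.add_apply]
        rw [sub_self, Real.rpow_zero, show 1 - α - 1 = -α by ring]
        ring
      · rw [integral_mul_const, integral_const_mul, integral_add' hi1 hi2,
          Real.integral_rpow_mul_exp_neg_mul_Ioi one_pos hp,
          Real.integral_rpow_mul_exp_neg_mul_Ioi h1α hp]
    refine hle.trans ?_
    gcongr
    exact hm₁ m ((le_max_left _ _).trans hm)
  choose! G hG1 hG2 using hGe
  choose! J hJ1 hJ2 using fun (m : ℝ) (hm : m₀ ≤ m) => exists_isUnit_one_add (G m) (hG2 m hm)
  have hres : ∀ m k, m₀ ≤ m → m₀ ≤ k → ∀ z, R k z = R m z - (k - m) • R k (R m z) := by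
    intro m k hm hk z
    have h2 := hR1 m hm z
    rw [mem_generatorGraph_shift] at h2
    have h3 := hR2 k hk _ _ (mem_generatorGraph_shift_of_mem (m := k) h2)
    rw [eq_sub_iff_add_eq, ← (R k).map_smul_of_tower, ← _root_.map_add]
    refine Eq.trans ?_ h3
    congr 1
    simp only [Complex.coe_smul, sub_smul]
    abel
  have hresG : ∀ m k, m₀ ≤ m → m₀ ≤ k → ∀ x, G k x = G m x - (k - m) • R k (G m x) := by
    intro m k hm hk
    refine fun x => congrFun (Continuous.ext_on hS.dense_generator_domain (G k).continuous
      (g := fun x => G m x - (k - m) • R k (G m x)) (by fun_prop) ?_) x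
    intro x hx
    obtain ⟨y, hy⟩ := mem_generator_domain.1 hx
    simp only [hG1 k hk x y hy, hG1 m hm x y hy]
    exact hres m k hm hk y
  -- The relation defining H does not depend on m.
  have hrel : ∀ m k, m₀ ≤ m → m₀ ≤ k → ∀ x y, x + G m x = R m (y + m • x) →
      x + G k x = R k (y + k • x) := by
    intro m k hm hk x y h
    have e1 : y + k • x = (y + m • x) + (k - m) • x := by rw [sub_smul]; abel
    have e2 : G m x = R m (y + m • x) - x := by rw [← h]; abel
    rw [e1, _root_.map_add, (R k).map_smul_of_tower, hres m k hm hk (y + m • x),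
      hresG m k hm hk, e2, map_sub, smul_sub]
    abel
  set H : Set (X × X) := {p | p.1 + G m₀ p.1 = R m₀ (p.2 + m₀ • p.1)} with hH
  have hHm : ∀ m, m₀ ≤ m → ∀ x y, (x, y) ∈ H ↔ x + G m x = R m (y + m • x) := fun m hm x y =>
    ⟨hrel _ _ le_rfl hm x y, hrel _ _ hm le_rfl x y⟩
  have hsum : ∀ x y z, (x, y) ∈ generatorGraph T → (x, z) ∈ generatorGraph S →
      (x, y + z) ∈ H := by
    intro x y z hy hz
    rw [hHm m₀ le_rfl]
    have h2 := hR2 m₀ le_rfl _ _ (mem_generatorGraph_shift_of_mem (m := m₀) hy)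
    rw [hG1 m₀ le_rfl x z hz]
    nth_rw 1 [← h2]
    rw [← _root_.map_add]
    congr 1
    simp only [Complex.coe_smul]
    abel
  obtain ⟨U, hU, hUH⟩ := hilleYosida (H := H) (m₀ := m₀) (by linarith)
    (Q := fun m => J m ∘L R m)
    (fun m hm y => by
      rw [hHm m hm, sub_add_cancel]
      exact hJ2 m hm _)
    (fun m hm x y hxy => by
      rw [hHm m hm] at hxy
      rw [ContinuousLinearMap.comp_apply, ← hxy]
      exact hJ1 m hm x)
    (fun m hm y => norm_le_of_add_eq hT hS (hR1 m hm) (hG1 m hm) (hG2 m hm) (hJ2 m hm _))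
    (hT.dense_generator_domain.mono fun x hx => by
      obtain ⟨y, hy⟩ := mem_generator_domain.1 hx
      obtain ⟨z, hz⟩ := mem_generator_domain.1 (hdom hx)
      exact ⟨_, hsum x y z hy hz⟩)
  have hran : ∀ x, R m₀ x ∈ (generator T).domain := fun x =>
    mem_generator_domain.2 ⟨_, mem_generatorGraph_shift.1 (hR1 m₀ le_rfl x)⟩
  obtain ⟨L, hL⟩ := exists_generator_comp hS (R m₀) fun x => hdom (hran x)
  refine ⟨U, m₀, R m₀, G m₀, L, hT, hS, hU, hm₀1, hR1 m₀ le_rfl, hR2 m₀ le_rfl, hG1 m₀ le_rfl,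
    hG2 m₀ le_rfl, hL, fun x y => ?_⟩
  rw [hUH, hHm m₀ le_rfl, Complex.coe_smul]

namespace IsPerturbation

variable {T S U : ℝ≥0 → X →L[ℂ] X} {m : ℝ} {R G L : X →L[ℂ] X}
  (h : IsPerturbation T S U m R G L)
include h

theorem add_mem {x y z : X} (hy : (x, y) ∈ generatorGraph T) (hz : (x, z) ∈ generatorGraph S) :
    (x, y + z) ∈ generatorGraph U := by
  rw [h.mem_iff, h.ext_apply x z hz]
  have h2 := h.resolvent_apply _ _ (mem_generatorGraph_shift_of_mem (m := m) hy)
  nth_rw 1 [← h2]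
  rw [← _root_.map_add]
  congr 1
  abel

theorem generator_add_le : generator T + generator S ≤ generator U := by
  rw [← LinearPMap.le_graph_iff]
  intro p hp
  rw [generator_graph]
  obtain ⟨x, hx1, hx2⟩ := (LinearPMap.mem_graph_iff _).1 hp
  have h1 : ((x : X), generator T ⟨x, x.2.1⟩) ∈ generatorGraph T := generator_mem T ⟨x, x.2.1⟩
  have h2 : ((x : X), generator S ⟨x, x.2.2⟩) ∈ generatorGraph S := generator_mem S ⟨x, x.2.2⟩
  have h3 := h.add_mem h1 h2
  rw [← LinearPMap.add_apply, hx2, hx1] at h3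
  exact h3

theorem resolvent_mem_sum (x : X) : (R x, x + L x) ∈ generatorGraph (shift m U) := by
  have h1 := mem_generatorGraph_shift.1 (h.resolvent_mem x)
  have h2 := mem_generatorGraph_shift_of_mem (m := m) (h.add_mem h1 (h.comp_mem x))
  convert h2 using 2
  abel

/-- If φ is in dom H*, then φ = ωR, so A*φ = ω - mφ; and since RB = G on dom B, φ is in dom B* with
B*φ = ωG. Conversely φ = (A*φ + mφ)R forces B*φ = (A*φ + mφ)G, and R(H+m) = 1+G reassembles H*φ. -/
theorem dualAdjoint_generator [CompleteSpace X] :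
    dualAdjoint (generator U) = dualAdjoint (generator T) + dualAdjoint (generator S) := by
  have hdT := h.left.dense_generator_domain
  have hdS := h.right.dense_generator_domain
  have hdU := h.sum.dense_generator_domain
  obtain ⟨J, hJ1, hJ2⟩ := exists_isUnit_one_add G h.norm_ext_le
  have hmem : ∀ (V : ℝ≥0 → X →L[ℂ] X) (φ ψ : StrongDual ℂ X),
      (φ, ψ) ∈ dualAdjointGraph (generator V) ↔ ∀ x y, (x, y) ∈ generatorGraph V → φ y = ψ x := by
    intro V φ ψ
    constructor
    · intro hh x y hxy
      rw [← generator_apply_eq (x := ⟨x, mem_generator_domain.2 ⟨y, hxy⟩⟩) hxy]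
      exact hh ⟨x, _⟩
    · exact fun hh x => hh _ _ (generator_mem V x)
  apply LinearPMap.eq_of_eq_graph
  ext ⟨φ, χ⟩
  rw [mem_graph_dualAdjoint _ hdU]
  change (φ, χ) ∈ dualAdjointGraph (generator U) ↔ _
  rw [hmem]
  constructor
  · intro hφ
    -- `φ = ω ∘ R` with `ω = (χ + m φ) ∘ J`
    set ω : StrongDual ℂ X := (χ + (m : ℂ) • φ) ∘L J with hω
    have hφω : ∀ y, φ y = ω (R y) := by
      intro y
      have hx : (J (R y), y - (m : ℂ) • J (R y)) ∈ generatorGraph U := by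
        rw [h.mem_iff, sub_add_cancel]; exact hJ2 _
      have := hφ _ _ hx
      rw [map_sub, map_smul, sub_eq_iff_eq_add] at this
      rw [this]
      rfl
    have hωG : ∀ x, χ x + (m : ℂ) • φ x = ω x + ω (G x) := by
      intro x
      rw [← _root_.map_add, hω, ContinuousLinearMap.comp_apply, hJ1]
      rfl
    have hT' : (φ, ω - (m : ℂ) • φ) ∈ dualAdjointGraph (generator T) := by
      rw [hmem]
      intro x y hxy
      have h2 := h.resolvent_apply _ _ (mem_generatorGraph_shift_of_mem (m := m) hxy)
      have h3 := hφω (y + (m : ℂ) • x)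
      rw [h2, _root_.map_add, map_smul] at h3
      exact eq_sub_of_add_eq h3
    have hS' : (φ, ω ∘L G) ∈ dualAdjointGraph (generator S) := by
      rw [hmem]
      intro x y hxy
      rw [hφω, ← h.ext_apply x y hxy]
      rfl
    rw [LinearPMap.mem_graph_iff]
    have m1 : φ ∈ (dualAdjoint (generator T)).domain := (mem_dualAdjoint_domain _ _).2 ⟨_, hT'⟩
    have m2 : φ ∈ (dualAdjoint (generator S)).domain := (mem_dualAdjoint_domain _ _).2 ⟨_, hS'⟩
    refine ⟨⟨φ, m1, m2⟩, rfl, ?_⟩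
    have e1 : dualAdjoint (generator T) ⟨φ, m1⟩ = ω - (m : ℂ) • φ := by
      obtain ⟨z, hz1, hz2⟩ := (LinearPMap.mem_graph_iff _).1
        ((mem_graph_dualAdjoint (generator T) hdT _ _).2 hT')
      refine Eq.trans ?_ hz2
      congr 1
      exact Subtype.ext hz1.symm
    have e2 : dualAdjoint (generator S) ⟨φ, m2⟩ = ω ∘L G := by
      obtain ⟨z, hz1, hz2⟩ := (LinearPMap.mem_graph_iff _).1
        ((mem_graph_dualAdjoint (generator S) hdS _ _).2 hS')
      refine Eq.trans ?_ hz2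
      congr 1
      exact Subtype.ext hz1.symm
    rw [LinearPMap.add_apply]
    change dualAdjoint (generator T) ⟨φ, m1⟩ + dualAdjoint (generator S) ⟨φ, m2⟩ = χ
    rw [e1, e2]
    ext x
    have := hωG x
    change ω x - (m : ℂ) • φ x + ω (G x) = χ x
    rw [sub_add_eq_add_sub, ← this, add_sub_cancel_right]
  · intro hφ x y hxy
    obtain ⟨z, hz1, hz2⟩ := (LinearPMap.mem_graph_iff _).1 hφ
    have hz1' : (z : StrongDual ℂ X) = φ := hz1
    rw [LinearPMap.add_apply] at hz2
    have hz2' : dualAdjoint (generator T) ⟨z, z.2.1⟩ + dualAdjoint (generator S) ⟨z, z.2.2⟩ = χ := hz2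
    have gT : ∀ a b, (a, b) ∈ generatorGraph T → φ b = dualAdjoint (generator T) ⟨z, z.2.1⟩ a := by
      intro a b hab
      rw [← hz1', ← generator_apply_eq (x := ⟨a, mem_generator_domain.2 ⟨b, hab⟩⟩) hab]
      exact dualAdjoint_apply hdT ⟨z, z.2.1⟩ ⟨a, _⟩
    have gS : ∀ a b, (a, b) ∈ generatorGraph S → φ b = dualAdjoint (generator S) ⟨z, z.2.2⟩ a := by
      intro a b hab
      rw [← hz1', ← generator_apply_eq (x := ⟨a, mem_generator_domain.2 ⟨b, hab⟩⟩) hab]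
      exact dualAdjoint_apply hdS ⟨z, z.2.2⟩ ⟨a, _⟩
    set ψ := dualAdjoint (generator T) ⟨z, z.2.1⟩
    set ξ := dualAdjoint (generator S) ⟨z, z.2.2⟩
    have h1 : ∀ v, φ v = ψ (R v) + (m : ℂ) • φ (R v) := by
      intro v
      have := gT _ _ (mem_generatorGraph_shift.1 (h.resolvent_mem v))
      rw [map_sub, map_smul, sub_eq_iff_eq_add] at this
      exact this
    have h2 : ∀ v, ξ v = ψ (G v) + (m : ℂ) • φ (G v) := by
      intro v
      refine congrFun (Continuous.ext_on hdS ξ.continuous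
        (g := fun v => ψ (G v) + (m : ℂ) • φ (G v)) (by fun_prop) ?_) v
      intro v hv
      obtain ⟨w, hw⟩ := mem_generator_domain.1 hv
      simp only
      rw [← gS v w hw, h.ext_apply v w hw]
      exact h1 w
    have h3 := h1 (y + (m : ℂ) • x)
    rw [← (h.mem_iff x y).1 hxy, _root_.map_add, _root_.map_add, _root_.map_add, map_smul, smul_add] at h3
    rw [← hz2', _root_.add_apply, h2 x]
    linear_combination h3

end IsPerturbation

/-! ### Smoothing bounds for the rescaled semigroup -/

theorem norm_le_of_dense {s : Set X} (hs : Dense s) (Z : X →L[ℂ] X) {c : ℝ}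
    (h : ∀ x ∈ s, ‖Z x‖ ≤ c * ‖x‖) (x : X) : ‖Z x‖ ≤ c * ‖x‖ :=
  hs.induction (P := fun x => ‖Z x‖ ≤ c * ‖x‖) h (isClosed_le (by fun_prop) (by fun_prop)) x

/-- A perturbation of a holomorphic semigroup: `D v = (A + m) exp (-v (A + m))` is of order `1 / v`,
and `exp (-v (A + m)) B` is of order `v ^ (-α)`. -/
structure IsSmoothPerturbation (T S U : ℝ≥0 → X →L[ℂ] X) (m : ℝ) (R G L : X →L[ℂ] X)
    (D : ℝ≥0 → X →L[ℂ] X) (α K : ℝ) : Prop extends IsPerturbation T S U m R G L where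
  exponent_nonneg : 0 ≤ α
  exponent_lt_one : α < 1
  const_nonneg : 0 ≤ K
  smooth_mem : ∀ v, 0 < v → ∀ x, (shift m T v x, D v x) ∈ generatorGraph (shift m T)
  norm_smooth_le : ∀ v : ℝ≥0, 0 < v → ‖D v‖ ≤ K / v
  norm_apply_le' : ∀ v : ℝ≥0, 0 < v → ∀ x y, (x, y) ∈ generatorGraph S →
    ‖shift m T v y‖ ≤ K * (v : ℝ) ^ (-α) * ‖x‖

/-- The damping e^{-mv} makes the bounds pure powers for all v > 0: m v e^{-mv} ≤ 1 turns C/v into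
(1+C)/v, and e^{-mv} ≤ v^{-α} turns 1+v^{-α} into 2v^{-α}. -/
theorem exists_isSmoothPerturbation [CompleteSpace X] {T S : ℝ≥0 → X →L[ℂ] X} {θ α : ℝ}
    (hθ : 0 < θ) (hT : IsHolomorphicContractionSemigroup θ T) (hS : IsContractionSemigroup S)
    (h0 : 0 ≤ α) (h1 : α < 1)
    (hfrac : (dualAdjoint (fracPower T α)).domain ≤ (dualAdjoint (generator S)).domain)
    (hdom : (generator T).domain ≤ (generator S).domain) :
    ∃ (U : ℝ≥0 → X →L[ℂ] X) (m : ℝ) (R G L : X →L[ℂ] X) (D : ℝ≥0 → X →L[ℂ] X) (K : ℝ),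
      IsSmoothPerturbation T S U m R G L D α K := by
  obtain ⟨C, D, hC0, hD, hDn, hcont⟩ := hT.exists_generator_mul hθ
  have hC : ∀ s : ℝ, 0 < s → ∀ l : ℝ, 0 ≤ l →
      ‖T (l + s).toNNReal - T s.toNNReal‖ ≤ C / s * l := by
    intro s hs l hl
    refine ContinuousLinearMap.opNorm_le_bound _ (by positivity) fun x => ?_
    have := hT.toIsContractionSemigroup.norm_map_sub_le (ContinuousLinearMap.id ℂ X) (hD s hs x)
      (c := C / s * ‖x‖) (t := l.toNNReal) fun r _ => (hT.norm_apply_le _ _).trans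
        ((D s).le_of_opNorm_le (hDn s hs) x)
    rw [Real.coe_toNNReal l hl, ← hT.add_apply, ← Real.toNNReal_add hl hs.le] at this
    rw [_root_.sub_apply, mul_right_comm]
    exact this
  obtain ⟨K, hK, hsm⟩ := exists_smoothing hT.toIsContractionSemigroup hS hC hcont hC0 h0 h1 hfrac
  obtain ⟨U, m, R, G, L, h⟩ := exists_isPerturbation hT.toIsContractionSemigroup hS h1 hsm hdom
  have hm : 1 ≤ m := h.one_le
  have hm0 : 0 < m := by linarith
  refine ⟨U, m, R, G, L, fun v => (m : ℂ) • shift m T v + ((Real.exp (-(m * v)) : ℝ) : ℂ) • D v,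
    max (1 + C) (2 * K), h, h0, h1, le_max_of_le_left (by positivity), fun v hv x => ?_,
    fun v hv => ?_, fun v hv x y hxy => ?_⟩
  · have h2 := hD v hv x
    rw [Real.toNNReal_coe] at h2
    have h3 := mem_generatorGraph_shift_of_mem (m := m)
      ((generatorGraph T).smul_mem ((Real.exp (-(m * v)) : ℝ) : ℂ) h2)
    rw [add_comm]
    exact h3
  · have hv' : (0 : ℝ) < v := hv
    have e1 : m * v * Real.exp (-(m * v)) ≤ 1 := by
      rw [Real.exp_neg, ← div_eq_mul_inv, div_le_one (Real.exp_pos _)]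
      linarith [Real.add_one_le_exp (m * v)]
    have e2 : Real.exp (-(m * v)) ≤ 1 := by
      rw [Real.exp_le_one_iff]
      have : 0 ≤ m * v := by positivity
      linarith
    refine (norm_add_le _ _).trans ?_
    rw [norm_smul, norm_smul, Complex.norm_real, Complex.norm_real, Real.norm_of_nonneg hm0.le,
      Real.norm_of_nonneg (Real.exp_nonneg _), norm_shift]
    have e3 : m * (Real.exp (-(m * v)) * ‖T v‖) ≤ 1 / v := by
      rw [le_div_iff₀ hv']
      calc _ = m * v * Real.exp (-(m * v)) * ‖T v‖ := by ring
        _ ≤ 1 * 1 := by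
          gcongr
          exact hT.norm_le_one v
        _ = 1 := one_mul 1
    have e4 : Real.exp (-(m * v)) * ‖D v‖ ≤ 1 * (C / v) := by
      gcongr
      exact hDn v hv'
    calc _ ≤ 1 / v + 1 * (C / v) := add_le_add e3 e4
      _ = (1 + C) / v := by ring
      _ ≤ max (1 + C) (2 * K) / v := by gcongr; exact le_max_left _ _
  · have hv' : (0 : ℝ) < v := hv
    have e1 : Real.exp (-(m * v)) ≤ (v : ℝ) ^ (-α) := by
      have e2 : (v : ℝ) ^ α ≤ Real.exp v := by
        rcases le_total (v : ℝ) 1 with hv1 | hv1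
        · exact (Real.rpow_le_one hv'.le hv1 h0).trans (Real.one_le_exp hv'.le)
        · refine (Real.rpow_le_rpow_of_exponent_le hv1 h1.le).trans ?_
          rw [Real.rpow_one]
          linarith [Real.add_one_le_exp (v : ℝ)]
      rw [Real.rpow_neg hv'.le, Real.exp_neg]
      have e3 : Real.exp v ≤ Real.exp (m * v) := by
        gcongr
        nlinarith
      gcongr
      exact e2.trans e3
    have e2 : Real.exp (-(m * v)) ≤ 1 := by
      rw [Real.exp_le_one_iff]
      have : 0 ≤ m * v := by positivity
      linarith
    have e5 := Real.rpow_nonneg hv'.le (-α)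
    have h2 := hsm v hv' x y hxy
    rw [Real.toNNReal_coe] at h2
    rw [shift_apply, norm_smul, Real.norm_of_nonneg (Real.exp_nonneg _)]
    calc _ ≤ Real.exp (-(m * v)) * (K * (1 + (v : ℝ) ^ (-α)) * ‖x‖) := by gcongr
      _ = K * ‖x‖ * (Real.exp (-(m * v)) + Real.exp (-(m * v)) * (v : ℝ) ^ (-α)) := by ring
      _ ≤ K * ‖x‖ * ((v : ℝ) ^ (-α) + 1 * (v : ℝ) ^ (-α)) := by gcongr
      _ = (2 * K) * (v : ℝ) ^ (-α) * ‖x‖ := by ring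
      _ ≤ _ := by gcongr; exact le_max_right _ _

/-! ### One-step estimates of first and second order -/

namespace IsPerturbation

variable {T S U : ℝ≥0 → X →L[ℂ] X} {m : ℝ} {R G L : X →L[ℂ] X}
  (h : IsPerturbation T S U m R G L)
include h

theorem shift_left : IsContractionSemigroup (shift m T) :=
  h.left.shift (zero_le_one.trans h.one_le)

theorem shift_sum : IsContractionSemigroup (shift m U) :=
  h.sum.shift (zero_le_one.trans h.one_le)

theorem mem_shift_iff {x y : X} : (x, y) ∈ generatorGraph (shift m U) ↔ x + G x = R y := by
  rw [mem_generatorGraph_shift, h.mem_iff, sub_add_cancel]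

theorem norm_ext_apply_le (x : X) : ‖G x‖ ≤ 1 / 2 * ‖x‖ := G.le_of_opNorm_le h.norm_ext_le x

theorem resolvent_comm (t : ℝ≥0) (x : X) : R (shift m T t x) = shift m T t (R x) :=
  h.resolvent_apply _ _ (h.shift_left.toIsC0Semigroup.generatorGraph_map (h.resolvent_mem x) t)

variable [CompleteSpace X]

/-- Under R an increment over time t becomes an orbit integral of length t, here with weight 1. For
S and for W the weights are G and 1+G, whence 1/2 and 3/2 in the two lemmas that follow. -/
theorem norm_resolvent_left_le (t : ℝ≥0) (x : X) : ‖R (shift m T t x - x)‖ ≤ t * ‖x‖ := by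
  have h1 := h.resolvent_apply _ _ (h.shift_left.integral_mem_generatorGraph x t.coe_nonneg)
  rw [Real.toNNReal_coe] at h1
  rw [← neg_sub, map_neg, norm_neg, h1, mul_comm]
  exact norm_integral_orbit_le h.shift_left x t.coe_nonneg

theorem norm_resolvent_right_le (t : ℝ≥0) (x : X) : ‖R (S t x - x)‖ ≤ 1 / 2 * (t * ‖x‖) := by
  have h1 := map_sub_eq_extension h.right h.ext_apply x t.coe_nonneg
  rw [Real.toNNReal_coe] at h1
  rw [← neg_sub, map_neg, norm_neg, h1]
  refine (h.norm_ext_apply_le _).trans ?_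
  rw [mul_comm (t : ℝ)]
  gcongr
  exact norm_integral_orbit_le h.right x t.coe_nonneg

theorem norm_resolvent_sum_le (t : ℝ≥0) (x : X) :
    ‖R (shift m U t x - x)‖ ≤ 3 / 2 * (t * ‖x‖) := by
  have h1 := h.mem_shift_iff.1 (h.shift_sum.integral_mem_generatorGraph x t.coe_nonneg)
  rw [Real.toNNReal_coe] at h1
  rw [← neg_sub, map_neg, norm_neg, ← h1]
  have h2 := norm_integral_orbit_le h.shift_sum x t.coe_nonneg
  have h3 := norm_add_le (∫ s in (0 : ℝ)..t, shift m U s.toNNReal x)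
    (G (∫ s in (0 : ℝ)..t, shift m U s.toNNReal x))
  have h4 := h.norm_ext_apply_le (∫ s in (0 : ℝ)..t, shift m U s.toNNReal x)
  linarith

theorem norm_resolvent_step_le (t : ℝ≥0) (x : X) :
    ‖R (S t (shift m T t x) - shift m U t x)‖ ≤ 3 * t * ‖x‖ := by
  have e : R (S t (shift m T t x) - shift m U t x) =
      R (S t (shift m T t x) - shift m T t x) + R (shift m T t x - x) -
        R (shift m U t x - x) := by
    simp only [map_sub]; abel
  have h1 := h.norm_resolvent_right_le t (shift m T t x)
  have h2 := h.norm_resolvent_left_le t x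
  have h3 := h.norm_resolvent_sum_le t x
  have h4 : t * ‖shift m T t x‖ ≤ t * ‖x‖ := by gcongr; exact h.shift_left.norm_apply_le t x
  rw [e]
  refine (norm_sub_le _ _).trans ?_
  have := norm_add_le (R (S t (shift m T t x) - shift m T t x)) (R (shift m T t x - x))
  linarith

/-- On Rx the first-order terms of S, V and W are -Lx, -x and -(x+Lx), so they cancel in S + V - W.
By the three increment bounds the derivative is then O(r) under R. The remainder (S-1)(V-1)Rx is
O(t²) by applying two of those bounds in turn. -/
theorem norm_resolvent_step_resolvent_le (t : ℝ≥0) (x : X) :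
    ‖R (S t (shift m T t (R x)) - shift m U t (R x))‖ ≤ (4 + 2 * ‖L‖) * t ^ 2 * ‖x‖ := by
  have hLx := L.le_opNorm x
  have key : ‖R (S t (R x) - R x) + R (shift m T t (R x) - R x) - R (shift m U t (R x) - R x)‖ ≤
      (3 + 2 * ‖L‖) * t * ‖x‖ * t := by
    have hd := fun r (hr : r ∈ Ico (0 : ℝ) t) =>
      (((R.restrictScalars ℝ).hasFDerivAt.comp_hasDerivWithinAt r
        (h.right.toIsC0Semigroup.hasDerivWithinAt (h.comp_mem x) hr.1)).add
      ((R.restrictScalars ℝ).hasFDerivAt.comp_hasDerivWithinAt r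
        (h.shift_left.toIsC0Semigroup.hasDerivWithinAt (h.resolvent_mem x) hr.1))).sub
      ((R.restrictScalars ℝ).hasFDerivAt.comp_hasDerivWithinAt r
        (h.shift_sum.toIsC0Semigroup.hasDerivWithinAt (h.resolvent_mem_sum x) hr.1))
    have := norm_image_sub_le_of_norm_deriv_right_le_segment
      (C := (3 + 2 * ‖L‖) * t * ‖x‖)
      (((R.continuous.comp (h.right.continuous_real (R x))).add
        (R.continuous.comp (h.shift_left.continuous_real (R x)))).sub
        (R.continuous.comp (h.shift_sum.continuous_real (R x)))).continuousOn hd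
      (fun r hr => by
        have hr0 : ((r.toNNReal : ℝ≥0) : ℝ) ≤ t := Real.toNNReal_le_iff_le_coe.2 hr.2.le
        have e : R (-S r.toNNReal (L x)) + R (-shift m T r.toNNReal x) -
            R (-shift m U r.toNNReal (x + L x)) =
            R (shift m U r.toNNReal (x + L x) - (x + L x)) -
              R (S r.toNNReal (L x) - L x) - R (shift m T r.toNNReal x - x) := by
          simp only [map_neg, map_sub, _root_.map_add]; abel
        have h1 := h.norm_resolvent_sum_le r.toNNReal (x + L x)
        have h2 := h.norm_resolvent_right_le r.toNNReal (L x)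
        have h3 := h.norm_resolvent_left_le r.toNNReal x
        have h4 := norm_add_le x (L x)
        simp only [ContinuousLinearMap.coe_restrictScalars']
        rw [e]
        refine (norm_sub_le _ _).trans ?_
        have h5 := norm_sub_le (R (shift m U r.toNNReal (x + L x) - (x + L x)))
          (R (S r.toNNReal (L x) - L x))
        have h6 : (r.toNNReal : ℝ) * ‖x + L x‖ ≤ t * (‖x‖ + ‖L‖ * ‖x‖) := by
          gcongr
          linarith
        have h7 : (r.toNNReal : ℝ) * ‖L x‖ ≤ t * (‖L‖ * ‖x‖) := by gcongr
        have h8 : (r.toNNReal : ℝ) * ‖x‖ ≤ t * ‖x‖ := by gcongr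
        have h9 : 0 ≤ t * ‖x‖ := by positivity
        linarith)
      t ⟨t.coe_nonneg, le_rfl⟩
    rw [sub_zero] at this
    refine le_trans (le_of_eq ?_) this
    congr 1
    simp [h.right.map_zero, h.shift_left.map_zero, h.shift_sum.map_zero]
    abel
  have e : R (S t (shift m T t (R x)) - shift m U t (R x)) =
      R (S t (R (shift m T t x - x)) - R (shift m T t x - x)) +
      (R (S t (R x) - R x) + R (shift m T t (R x) - R x) - R (shift m U t (R x) - R x)) := by
    have e1 : R (shift m T t x - x) = shift m T t (R x) - R x := by
      rw [map_sub, h.resolvent_comm]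
    rw [e1]
    simp only [map_sub]
    abel
  rw [e]
  refine (norm_add_le _ _).trans ?_
  have h1 := h.norm_resolvent_right_le t (R (shift m T t x - x))
  have h2 : (t : ℝ) * ‖R (shift m T t x - x)‖ ≤ t * (t * ‖x‖) := by
    gcongr
    exact h.norm_resolvent_left_le t x
  have h3 : 0 ≤ t * (t * ‖x‖) := by positivity
  nlinarith

end IsPerturbation

/-! ### Duhamel's formula for the perturbed semigroup -/

namespace IsSmoothPerturbation

variable {T S U : ℝ≥0 → X →L[ℂ] X} {m : ℝ} {R G L : X →L[ℂ] X} {D : ℝ≥0 → X →L[ℂ] X} {α K : ℝ}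
  (h : IsSmoothPerturbation T S U m R G L D α K)
include h

theorem smooth_resolvent {v : ℝ≥0} (hv : 0 < v) (x : X) : D v (R x) = shift m T v x :=
  generatorGraph_unique (h.smooth_mem v hv (R x))
    (h.shift_left.toIsC0Semigroup.generatorGraph_map (h.resolvent_mem x) v)

theorem resolvent_smooth {v : ℝ≥0} (hv : 0 < v) (x : X) : R (D v x) = shift m T v x :=
  h.resolvent_apply _ _ (h.smooth_mem v hv x)

theorem smooth_apply {v : ℝ≥0} (hv : 0 < v) (r : ℝ≥0) (x : X) :
    D v (shift m T r x) = D (v + r) x := by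
  refine generatorGraph_unique (h.smooth_mem v hv _) ?_
  rw [← h.shift_left.add_apply]
  exact h.smooth_mem _ (add_pos_of_pos_of_nonneg hv zero_le) x

theorem apply_smooth {v : ℝ≥0} (hv : 0 < v) (r : ℝ≥0) (x : X) :
    shift m T r (D v x) = D (r + v) x := by
  refine generatorGraph_unique (h.shift_left.toIsC0Semigroup.generatorGraph_map
    (h.smooth_mem v hv x) r) ?_
  rw [← h.shift_left.add_apply]
  exact h.smooth_mem _ (add_pos_of_nonneg_of_pos zero_le hv) x

theorem norm_smooth_ext_le [CompleteSpace X] {v : ℝ≥0} (hv : 0 < v) (x : X) :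
    ‖D v (G x)‖ ≤ K * (v : ℝ) ^ (-α) * ‖x‖ := by
  refine norm_le_of_dense h.right.dense_generator_domain (D v ∘L G) (fun x hx => ?_) x
  obtain ⟨y, hy⟩ := mem_generator_domain.1 hx
  rw [ContinuousLinearMap.comp_apply, h.ext_apply x y hy, h.smooth_resolvent hv]
  exact h.norm_apply_le' v hv x y hy

/-- S(t) - 1 is not small in norm; differentiating in t brings down B, which V(v) absorbs at the
price v^{-α}. -/
theorem norm_apply_right_sub_le [CompleteSpace X] {v : ℝ≥0} (hv : 0 < v) (t : ℝ≥0) (x : X) :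
    ‖shift m T v (S t x - x)‖ ≤ K * (v : ℝ) ^ (-α) * t * ‖x‖ := by
  have hvr := Real.rpow_nonneg v.coe_nonneg (-α)
  have hK := h.const_nonneg
  refine norm_le_of_dense h.right.dense_generator_domain (shift m T v ∘L (S t - 1))
    (fun x hx => ?_) x
  obtain ⟨y, hy⟩ := mem_generator_domain.1 hx
  rw [mul_right_comm]
  refine h.right.norm_map_sub_le (shift m T v) hy fun r _ => ?_
  refine (h.norm_apply_le' v hv _ _ (h.right.toIsC0Semigroup.generatorGraph_map hy r)).trans ?_
  gcongr
  exact h.right.norm_apply_le r x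

/-- The regularized variation of constants formula in differential form. -/
theorem hasDerivWithinAt_duhamel {v t : ℝ≥0} (hv : 0 < v) {x y : X}
    (hxy : (x, y) ∈ generatorGraph (shift m U)) {r : ℝ} (hr : r ∈ Ico (0 : ℝ) t) :
    HasDerivWithinAt (fun r : ℝ => D v (shift m T (t - r).toNNReal (R (shift m U r.toNNReal x))))
      (-D (v + (t - r).toNNReal) (G (shift m U r.toNNReal x))) (Ici r) r := by
  -- The orbit W(r)x need not meet dom A, but RW(r)x does. This is why V(v) is written as D(v)R with
  -- R next to the orbit.
  have h1 := h.shift_left.hasDerivWithinAt_sub h.shift_sum.toIsC0Semigroup R hxy hr.1 hr.2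
    (h.resolvent_mem _)
  have h2 := h.mem_shift_iff.1
    (h.shift_sum.toIsC0Semigroup.generatorGraph_map hxy r.toNNReal)
  have h3 := ((D v).restrictScalars ℝ).hasFDerivAt.comp_hasDerivWithinAt r h1
  refine h3.congr_deriv ?_
  rw [← h2, ContinuousLinearMap.coe_restrictScalars', h.smooth_apply hv, ← map_neg]
  congr 1
  abel

theorem continuous_duhamel (v t : ℝ≥0) (x : X) : Continuous fun r : ℝ =>
    D v (shift m T (t - r).toNNReal (R (shift m U r.toNNReal x))) := by
  refine (D v).continuous.comp (continuous_iff_continuousAt.2 fun r => ?_)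
  exact h.shift_left.tendsto_apply
    ((continuous_real_toNNReal.comp (continuous_sub_left (t : ℝ))).tendsto r)
    ((R.continuous.comp (h.shift_sum.continuous_real x)).tendsto r)

variable [CompleteSpace X]

theorem norm_duhamel_deriv_le {v t : ℝ≥0} (hv : 0 < v) (x : X) {r : ℝ}
    (hr : r ∈ Ico (0 : ℝ) t) :
    ‖-D (v + (t - r).toNNReal) (G (shift m U r.toNNReal x))‖ ≤
      K * (v + (t - r)) ^ (-α) * ‖x‖ := by
  have hK := h.const_nonneg
  rw [norm_neg]
  refine (h.norm_smooth_ext_le (add_pos_of_pos_of_nonneg hv zero_le) _).trans ?_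
  rw [NNReal.coe_add, Real.coe_toNNReal _ (sub_nonneg.2 hr.2.le)]
  have : (0 : ℝ) ≤ v + (t - r) := add_nonneg v.coe_nonneg (sub_nonneg.2 hr.2.le)
  have := Real.rpow_nonneg this (-α)
  gcongr
  exact h.shift_sum.norm_apply_le _ _

theorem norm_apply_sum_sub_le {v : ℝ≥0} (hv : 0 < v) (t : ℝ≥0) (x : X) :
    ‖shift m T v (shift m U t x - shift m T t x)‖ ≤ K * (v : ℝ) ^ (-α) * t * ‖x‖ := by
  have hK := h.const_nonneg
  have hv' : (0 : ℝ) < v := hv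
  refine norm_le_of_dense h.shift_sum.dense_generator_domain
    (shift m T v ∘L (shift m U t - shift m T t)) (fun x hx => ?_) x
  obtain ⟨y, hy⟩ := mem_generator_domain.1 hx
  have := norm_image_sub_le_of_norm_deriv_right_le_segment (a := 0) (b := (t : ℝ))
    (C := K * (v : ℝ) ^ (-α) * ‖x‖)
    (h.continuous_duhamel v t x).continuousOn
    (fun r hr => h.hasDerivWithinAt_duhamel hv hy hr)
    (fun r hr => by
      refine (h.norm_duhamel_deriv_le hv x hr).trans ?_
      have e : ((v : ℝ) + (t - r)) ^ (-α) ≤ (v : ℝ) ^ (-α) :=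
        Real.rpow_le_rpow_of_nonpos hv' (by linarith [hr.2]) (by linarith [h.exponent_nonneg])
      gcongr)
    t ⟨t.coe_nonneg, le_rfl⟩
  simp only [sub_self, sub_zero, Real.toNNReal_zero, Real.toNNReal_coe, h.shift_sum.map_zero,
    h.shift_left.map_zero, one_apply_eq_self, h.smooth_resolvent hv, ← h.resolvent_comm,
    ← map_sub] at this
  rw [mul_right_comm]
  exact this

/-- The derivative bound K(v+t-r)^{-α} is integrated through its primitive for v > 0; as α < 1 the
result stays bounded when v → 0. -/
theorem norm_sum_sub_le (t : ℝ≥0) (x : X) :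
    ‖shift m U t x - shift m T t x‖ ≤ K / (1 - α) * (t : ℝ) ^ (1 - α) * ‖x‖ := by
  have hK := h.const_nonneg
  have hα : 0 < 1 - α := sub_pos.2 h.exponent_lt_one
  refine norm_le_of_dense h.shift_sum.dense_generator_domain (shift m U t - shift m T t)
    (fun x hx => ?_) x
  obtain ⟨y, hy⟩ := mem_generator_domain.1 hx
  have key : ∀ v : ℝ≥0, 0 < v → ‖shift m T v (shift m U t x - shift m T t x)‖ ≤
      K / (1 - α) * ((v : ℝ) + t) ^ (1 - α) * ‖x‖ := by
    intro v hv
    have hv' : (0 : ℝ) < v := hv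
    have hpos : ∀ r ∈ Icc (0 : ℝ) t, 0 < (v : ℝ) + (t - r) := fun r hr =>
      add_pos_of_pos_of_nonneg hv' (sub_nonneg.2 hr.2)
    set B : ℝ → ℝ := fun r =>
      K / (1 - α) * (((v : ℝ) + t) ^ (1 - α) - ((v : ℝ) + (t - r)) ^ (1 - α)) * ‖x‖ with hB
    have hBd : ∀ r ∈ Icc (0 : ℝ) t, HasDerivAt B (K * ((v : ℝ) + (t - r)) ^ (-α) * ‖x‖) r := by
      intro r hr
      have h1 : HasDerivAt (fun r : ℝ => (v : ℝ) + (t - r)) (-1) r :=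
        ((hasDerivAt_id r).const_sub (t : ℝ)).const_add (v : ℝ)
      have h2 := (((h1.rpow_const (p := 1 - α) (Or.inl (hpos r hr).ne')).const_sub
        (((v : ℝ) + t) ^ (1 - α))).const_mul (K / (1 - α))).mul_const ‖x‖
      refine h2.congr_deriv ?_
      rw [show 1 - α - 1 = -α by ring]
      field_simp
    have := image_norm_le_of_norm_deriv_right_le_deriv_boundary' (a := 0) (b := (t : ℝ))
      (f := fun r : ℝ => D v (shift m T (t - r).toNNReal (R (shift m U r.toNNReal x))) -
        D v (shift m T ((t : ℝ) - 0).toNNReal (R (shift m U (0 : ℝ).toNNReal x))))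
      (B := B)
      ((h.continuous_duhamel v t x).sub continuous_const).continuousOn
      (fun r hr => (h.hasDerivWithinAt_duhamel hv hy hr).sub_const _)
      (by simp [hB])
      (fun r hr => (hBd r hr).continuousAt.continuousWithinAt)
      (fun r hr => (hBd r ⟨hr.1, hr.2.le⟩).hasDerivWithinAt)
      (fun r hr => h.norm_duhamel_deriv_le hv x hr)
      ⟨t.coe_nonneg, le_rfl⟩
    simp only [sub_self, Real.toNNReal_zero, Real.toNNReal_coe, h.shift_sum.map_zero, sub_zero,
      h.shift_left.map_zero, one_apply_eq_self, h.smooth_resolvent hv, ← h.resolvent_comm,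
      ← map_sub] at this
    refine this.trans ?_
    rw [hB]
    simp only
    gcongr
    rw [sub_le_self_iff]
    exact Real.rpow_nonneg (by simp) _
  have hl := (h.shift_left.tendsto_zero (shift m U t x - shift m T t x)).norm
  have hr : Tendsto (fun v : ℝ≥0 => K / (1 - α) * ((v : ℝ) + t) ^ (1 - α) * ‖x‖) (𝓝[>] 0)
      (𝓝 (K / (1 - α) * (t : ℝ) ^ (1 - α) * ‖x‖)) := by
    have h1 : Tendsto (fun v : ℝ≥0 => (v : ℝ) + t) (𝓝[>] 0) (𝓝 (t : ℝ)) := by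
      have : Continuous fun v : ℝ≥0 => (v : ℝ) + t := by fun_prop
      simpa using (this.tendsto 0).mono_left nhdsWithin_le_nhds
    exact ((h1.rpow_const (Or.inr hα.le)).const_mul _).mul_const _
  refine le_of_tendsto_of_tendsto hl hr ?_
  filter_upwards [self_mem_nhdsWithin] with v hv using key v hv

end IsSmoothPerturbation

/-! ### Discrete singular kernels -/

theorem sum_le_integral_of_antitoneOn {f : ℝ → ℝ} (hf : AntitoneOn f (Ioi 0))
    (hi : ∀ b, 0 ≤ b → IntervalIntegrable f volume 0 b) {τ : ℝ} (hτ : 0 < τ) (n : ℕ) :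
    ∑ i ∈ Finset.range n, τ * f ((i + 1) * τ) ≤ ∫ s in (0 : ℝ)..(n * τ), f s := by
  induction n with
  | zero => simp
  | succ n ih =>
    have h0 : (0 : ℝ) ≤ n * τ := by positivity
    have h1 : (n : ℝ) * τ ≤ (n + 1) * τ := by nlinarith
    have hi1 := hi (n * τ) h0
    have hi2 := hi ((n + 1) * τ) (h0.trans h1)
    have hi3 : IntervalIntegrable f volume (n * τ) ((n + 1) * τ) := hi1.symm.trans hi2
    rw [Finset.sum_range_succ]
    push_cast
    rw [← intervalIntegral.integral_add_adjacent_intervals hi1 hi3]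
    refine add_le_add ih ?_
    have h2 : ∫ _ in (n * τ)..((n + 1) * τ), f ((n + 1) * τ) ≤
        ∫ s in (n * τ)..((n + 1) * τ), f s := by
      refine intervalIntegral.integral_mono_on_of_le_Ioo h1 intervalIntegrable_const hi3 ?_
      intro x hx
      exact hf (h0.trans_lt hx.1) ((h0.trans_lt hx.1).trans hx.2) hx.2.le
    rw [intervalIntegral.integral_const, smul_eq_mul] at h2
    refine le_trans (le_of_eq ?_) h2
    ring

/-- Right-endpoint sums of a decreasing function avoid its singularity at 0 and stay below its
integral. The bound is uniform in τ and n and vanishes as η → ∞. -/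
theorem sum_rpow_mul_exp_le {α η τ : ℝ} (h0 : 0 ≤ α) (h1 : α < 1) (hη : 0 < η) (hτ : 0 < τ)
    (n : ℕ) :
    ∑ i ∈ Finset.range n, τ * (((i + 1) * τ) ^ (-α) * Real.exp (-(η * ((i + 1) * τ)))) ≤
      (1 / η) ^ (1 - α) * Real.Gamma (1 - α) := by
  have h1α : 0 < 1 - α := by linarith
  have hint := integrableOn_rpow_mul_exp h1α hη
  rw [← Real.integral_rpow_mul_exp_neg_mul_Ioi h1α hη]
  rw [show 1 - α - 1 = -α by ring] at hint ⊢
  have hanti : AntitoneOn (fun s : ℝ => s ^ (-α) * Real.exp (-(η * s))) (Ioi 0) := by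
    intro x hx y hy hxy
    have hx0 : 0 < x := hx
    have hy0 : 0 < y := hy
    have := Real.rpow_nonneg hx0.le (-α)
    refine mul_le_mul (Real.rpow_le_rpow_of_nonpos hx0 hxy (by linarith)) ?_
      (Real.exp_nonneg _) this
    gcongr
  refine (sum_le_integral_of_antitoneOn hanti (fun b hb => ?_) hτ n).trans ?_
  · rw [intervalIntegrable_iff_integrableOn_Ioc_of_le hb]
    exact hint.mono_set Ioc_subset_Ioi_self
  · rw [intervalIntegral.integral_of_le (by positivity)]
    refine setIntegral_mono_set hint ?_ (LE.le.eventuallyLE Ioc_subset_Ioi_self)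
    refine (ae_restrict_iff' measurableSet_Ioi).2 (ae_of_all _ fun s hs => ?_)
    exact mul_nonneg (Real.rpow_nonneg (le_of_lt hs) _) (Real.exp_nonneg _)

theorem sum_rpow_neg_le {α : ℝ} (h0 : 0 ≤ α) (h1 : α < 1) (n : ℕ) :
    ∑ i ∈ Finset.range n, ((i : ℝ) + 1) ^ (-α) ≤ (n : ℝ) ^ (1 - α) / (1 - α) := by
  have hanti : AntitoneOn (fun s : ℝ => s ^ (-α)) (Ioi 0) := by
    intro x hx y hy hxy
    exact Real.rpow_le_rpow_of_nonpos hx hxy (by linarith)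
  have := sum_le_integral_of_antitoneOn hanti
    (fun b _ => intervalIntegral.intervalIntegrable_rpow' (by linarith)) one_pos n
  rw [integral_rpow (Or.inl (by linarith)), Real.zero_rpow (by linarith), sub_zero, mul_one,
    neg_add_eq_sub] at this
  simpa using this

theorem sum_inv_le (n : ℕ) :
    ∑ i ∈ Finset.range n, 1 / ((i : ℝ) + 1) ≤ 1 + Real.log n := by
  have := harmonic_le_one_add_log n
  rw [harmonic] at this
  push_cast at this
  simpa using this

theorem tendsto_const_mul_inv_rpow {p : ℝ} (hp : 0 < p) (c : ℝ) :
    Tendsto (fun η : ℝ => (1 / η) ^ p * c) atTop (𝓝 0) := by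
  have h1 : Tendsto (fun m : ℝ => 1 / m) atTop (𝓝 0) := by
    simpa using tendsto_inv_atTop_zero (𝕜 := ℝ)
  have := (h1.rpow_const (p := p) (Or.inr hp.le)).mul_const c
  rwa [Real.zero_rpow hp.ne', zero_mul] at this

/-- A discrete Gronwall lemma for the singular kernel `s ^ (-α)` and the inhomogeneity `1 / s`. -/
theorem discrete_volterra {α C K : ℝ} (h0 : 0 ≤ α) (h1 : α < 1) (hC : 0 ≤ C) (hK : 0 ≤ K) :
    ∃ M η : ℝ, 0 ≤ M ∧ 0 ≤ η ∧ ∀ (τ : ℝ), 0 < τ → ∀ (n : ℕ) (p : ℕ → ℝ),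
      (∀ j < n, p j ≤ C / ((j + 1) * τ) +
        ∑ i ∈ Finset.range j, K * τ * ((i + 1) * τ) ^ (-α) * p (j - 1 - i)) →
      ∀ j < n, p j ≤ M * Real.exp (η * (n * τ)) *
        (1 / ((j + 1) * τ) + ((j + 1) * τ) ^ (-α) * (1 + Real.log n)) := by
  have h1α : 0 < 1 - α := by linarith
  -- Exponential weighting makes the kernel's total mass at most 1/8, small enough to close the
  -- induction `key`.
  obtain ⟨η, hη1, hη⟩ : ∃ η : ℝ, 1 ≤ η ∧
      K * ((1 / η) ^ (1 - α) * Real.Gamma (1 - α)) ≤ 1 / 8 := by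
    have h2 := (tendsto_const_mul_inv_rpow h1α (Real.Gamma (1 - α))).const_mul K
    rw [mul_zero] at h2
    exact ((eventually_ge_atTop 1).and
      (h2.eventually_le_const (show (0 : ℝ) < 1 / 8 by norm_num))).exists
  have hη0 : 0 < η := by linarith
  set ε := (1 / η) ^ (1 - α) * Real.Gamma (1 - α) with hε
  refine ⟨2 * C + 4 * K * C, η, by positivity, hη0.le, fun τ hτ n p hp => ?_⟩
  set a : ℕ → ℝ := fun j => (j + 1) * τ with ha
  have ha0 : ∀ j, 0 < a j := fun j => by simp only [ha]; positivity
  have haα : ∀ j, 0 ≤ a j ^ (-α) := fun j => Real.rpow_nonneg (ha0 j).le _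
  set w : ℕ → ℝ := fun i => τ * (a i ^ (-α) * Real.exp (-(η * a i))) with hw
  have hw0 : ∀ i, 0 ≤ w i := fun i =>
    mul_nonneg hτ.le (mul_nonneg (haα i) (Real.exp_nonneg _))
  have hwsum : ∀ k, ∑ i ∈ Finset.range k, w i ≤ ε := fun k =>
    sum_rpow_mul_exp_le h0 h1 hη0 hτ k
  have key : ∀ j < n, p j * Real.exp (-(η * a j)) ≤
      2 * C / a j + 4 * K * C * (1 + Real.log n) * a j ^ (-α) := by
    intro j
    induction j using Nat.strong_induction_on with
    | _ j ih =>
    intro hj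
    have hn1 : (1 : ℝ) ≤ n := by exact_mod_cast (Nat.succ_le_of_lt (Nat.zero_lt_of_lt hj))
    have hΛ : 0 ≤ Real.log n := Real.log_nonneg hn1
    set Λ := 1 + Real.log n with hΛdef
    have hΛ0 : 0 ≤ Λ := by linarith
    -- The shift a(i) = (i+1)τ makes the index j-1-i split a(j) exactly.
    have hsplit : ∀ i ∈ Finset.range j, a i + a (j - 1 - i) = a j := by
      intro i hi
      rw [Finset.mem_range] at hi
      simp only [ha]
      rw [Nat.sub_sub, Nat.cast_sub (by omega)]
      push_cast
      ring
    have hterm : ∀ i ∈ Finset.range j,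
        K * τ * a i ^ (-α) * p (j - 1 - i) * Real.exp (-(η * a j)) ≤
        K * (2 * C * (w i / a j + a j ^ (-α) * (1 / (((j - 1 - i : ℕ) : ℝ) + 1))) +
          4 * K * C * Λ * (2 * a j ^ (-α) * (w i + w (j - 1 - i)))) := by
      intro i hi
      have hs := hsplit i hi
      rw [Finset.mem_range] at hi
      have ihl := ih (j - 1 - i) (by omega) (by omega)
      set l := j - 1 - i with hl
      have hai := ha0 i
      have hal := ha0 l
      have haj := ha0 j
      have e1 : K * τ * a i ^ (-α) * p l * Real.exp (-(η * a j)) =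
          K * (w i * (p l * Real.exp (-(η * a l)))) := by
        rw [← hs, mul_add, neg_add, Real.exp_add]
        simp only [hw]
        ring
      -- Partial fractions 1/a_l = 1/a_j + a_i/(a_j a_l), and s^{1-α} is increasing. The last term
      -- sums to a harmonic sum, the source of 1 + log n.
      have e2 : w i / a l ≤ w i / a j + a j ^ (-α) * (1 / ((l : ℝ) + 1)) := by
        have e3 : w i / a l = w i / a j + w i * a i / a j / a l := by
          field_simp
          rw [← hs]; ring
        have e4 : w i * a i / a j / a l ≤ a j ^ (-α) * (1 / ((l : ℝ) + 1)) := by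
          have e5 : w i * a i / a j ≤ τ * a j ^ (-α) := by
            rw [div_le_iff₀ haj]
            have e6 : a i ^ (-α) * a i ≤ a j ^ (-α) * a j := by
              rw [← Real.rpow_add_one hai.ne', ← Real.rpow_add_one haj.ne']
              exact Real.rpow_le_rpow hai.le (by linarith) (by linarith)
            have e7 : Real.exp (-(η * a i)) ≤ 1 := by
              rw [Real.exp_le_one_iff]
              have : 0 ≤ η * a i := by positivity
              linarith
            have e8 : 0 ≤ a i ^ (-α) * a i := mul_nonneg (haα i) hai.le
            calc w i * a i = τ * (a i ^ (-α) * a i) * Real.exp (-(η * a i)) := by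
                  simp only [hw]; ring
              _ ≤ τ * (a i ^ (-α) * a i) * 1 := by gcongr
              _ ≤ τ * (a j ^ (-α) * a j) := by rw [mul_one]; gcongr
              _ = τ * a j ^ (-α) * a j := by ring
          calc w i * a i / a j / a l ≤ τ * a j ^ (-α) / a l := by gcongr
            _ = a j ^ (-α) * (1 / ((l : ℝ) + 1)) := by
              simp only [ha]
              field_simp
        linarith
      have half : ∀ x, a j ≤ 2 * x → 0 < x → x ^ (-α) ≤ 2 * a j ^ (-α) := by
        intro x hx hx0
        have e3 : x ^ (-α) ≤ (a j / 2) ^ (-α) :=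
          Real.rpow_le_rpow_of_nonpos (by positivity) (by linarith) (by linarith)
        have e4 : (a j / 2) ^ (-α) = 2 ^ α * a j ^ (-α) := by
          rw [Real.div_rpow haj.le (by norm_num), Real.rpow_neg (by norm_num : (0 : ℝ) ≤ 2),
            div_inv_eq_mul, mul_comm]
        have e5 : (2 : ℝ) ^ α ≤ 2 ^ (1 : ℝ) :=
          Real.rpow_le_rpow_of_exponent_le (by norm_num) h1.le
        rw [Real.rpow_one] at e5
        rw [e4] at e3
        refine e3.trans ?_
        have := haα j
        gcongr
      -- The larger of a_i and a_l is at least a_j/2, so one of the two singular factors is at most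
      -- 2a_j^{-α}.
      have e3 : w i * a l ^ (-α) ≤ 2 * a j ^ (-α) * (w i + w l) := by
        have hwi := hw0 i
        have hwl := hw0 l
        have hajα := haα j
        rcases le_total (a i) (a l) with hil | hil
        · have := half (a l) (by linarith) hal
          calc w i * a l ^ (-α) ≤ w i * (2 * a j ^ (-α)) := by gcongr
            _ ≤ 2 * a j ^ (-α) * (w i + w l) := by nlinarith [mul_nonneg hajα hwl]
        · have h5 := half (a i) (by linarith) hai
          have h6 : Real.exp (-(η * a i)) ≤ Real.exp (-(η * a l)) := by gcongr
          have h7 := haα l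
          have h8 : w i * a l ^ (-α) ≤ 2 * a j ^ (-α) * w l := by
            calc w i * a l ^ (-α) = a i ^ (-α) * (τ * (a l ^ (-α) * Real.exp (-(η * a i)))) := by
                  simp only [hw]; ring
              _ ≤ 2 * a j ^ (-α) * (τ * (a l ^ (-α) * Real.exp (-(η * a l)))) := by gcongr
              _ = 2 * a j ^ (-α) * w l := by simp only [hw]
          nlinarith [mul_nonneg hajα hwi]
      rw [e1]
      have hwi := hw0 i
      calc K * (w i * (p l * Real.exp (-(η * a l))))
          ≤ K * (w i * (2 * C / a l + 4 * K * C * Λ * a l ^ (-α))) := by gcongr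
        _ = K * (2 * C * (w i / a l) + 4 * K * C * Λ * (w i * a l ^ (-α))) := by ring
        _ ≤ _ := by gcongr
    have hrefl : ∀ g : ℕ → ℝ, ∑ i ∈ Finset.range j, g (j - 1 - i) = ∑ i ∈ Finset.range j, g i :=
      fun g => Finset.sum_range_reflect g j
    have hsumw := hwsum j
    have hH : ∑ i ∈ Finset.range j, 1 / ((i : ℝ) + 1) ≤ Λ := by
      refine le_trans ?_ (sum_inv_le n)
      exact Finset.sum_le_sum_of_subset_of_nonneg (Finset.range_mono hj.le)
        fun i _ _ => by positivity
    have haj := ha0 j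
    have hajα := haα j
    have hjp := hp j hj
    calc p j * Real.exp (-(η * a j))
        ≤ (C / a j + ∑ i ∈ Finset.range j, K * τ * a i ^ (-α) * p (j - 1 - i)) *
          Real.exp (-(η * a j)) := by gcongr
      _ = C / a j * Real.exp (-(η * a j)) +
          ∑ i ∈ Finset.range j, K * τ * a i ^ (-α) * p (j - 1 - i) * Real.exp (-(η * a j)) := by
        rw [add_mul, Finset.sum_mul]
      _ ≤ C / a j * 1 + ∑ i ∈ Finset.range j,
          K * (2 * C * (w i / a j + a j ^ (-α) * (1 / (((j - 1 - i : ℕ) : ℝ) + 1))) +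
          4 * K * C * Λ * (2 * a j ^ (-α) * (w i + w (j - 1 - i)))) := by
        refine add_le_add ?_ (Finset.sum_le_sum hterm)
        gcongr
        rw [Real.exp_le_one_iff]
        have : 0 ≤ η * a j := by positivity
        linarith
      _ = C / a j + K * (2 * C * ((∑ i ∈ Finset.range j, w i) / a j +
            a j ^ (-α) * ∑ i ∈ Finset.range j, 1 / ((i : ℝ) + 1)) +
          4 * K * C * Λ * (2 * a j ^ (-α) * (∑ i ∈ Finset.range j, w i +
            ∑ i ∈ Finset.range j, w i))) := by
        rw [mul_one, ← Finset.mul_sum, Finset.sum_add_distrib, ← Finset.mul_sum, ← Finset.mul_sum,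
          Finset.sum_add_distrib, ← Finset.mul_sum, ← Finset.mul_sum, Finset.sum_add_distrib,
          hrefl w, hrefl (fun i => 1 / ((i : ℝ) + 1)), Finset.sum_div]
      _ ≤ C / a j + K * (2 * C * (ε / a j + a j ^ (-α) * Λ) +
          4 * K * C * Λ * (2 * a j ^ (-α) * (ε + ε))) := by gcongr
      _ = C / a j + 2 * C * (K * ε) / a j + 2 * K * C * Λ * a j ^ (-α) +
          16 * K * C * Λ * a j ^ (-α) * (K * ε) := by ring
      -- With Kε ≤ 1/8 the induction closes: C + C/4 ≤ 2C and 2KC + 2KC = 4KC.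
      _ ≤ C / a j + 2 * C * (1 / 8) / a j + 2 * K * C * Λ * a j ^ (-α) +
          16 * K * C * Λ * a j ^ (-α) * (1 / 8) := by gcongr
      _ ≤ 2 * C / a j + 4 * K * C * Λ * a j ^ (-α) := by
        have : 0 ≤ C / a j := by positivity
        have e : 2 * C * (1 / 8) / a j = 1 / 4 * (C / a j) := by ring
        have e' : 2 * C / a j = 2 * (C / a j) := by ring
        rw [e, e']
        linarith
  intro j hj
  have hn1 : (1 : ℝ) ≤ n := by exact_mod_cast (Nat.succ_le_of_lt (Nat.zero_lt_of_lt hj))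
  have hΛ : 0 ≤ Real.log n := Real.log_nonneg hn1
  have h2 := key j hj
  have haj := ha0 j
  have hajα := haα j
  have hle : a j ≤ n * τ := by
    simp only [ha]
    gcongr
    exact_mod_cast hj
  have h3 : p j = p j * Real.exp (-(η * a j)) * Real.exp (η * a j) := by
    rw [mul_assoc, ← Real.exp_add]; simp
  rw [h3]
  have h4 : 2 * C / a j + 4 * K * C * (1 + Real.log n) * a j ^ (-α) ≤
      (2 * C + 4 * K * C) * (1 / a j + a j ^ (-α) * (1 + Real.log n)) := by
    have e1 : 0 ≤ 4 * K * C * (1 / a j) := by positivity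
    have e2 : 0 ≤ 2 * C * (a j ^ (-α) * (1 + Real.log n)) := by positivity
    have e3 : 2 * C / a j = 2 * C * (1 / a j) := by ring
    rw [e3]
    nlinarith
  calc p j * Real.exp (-(η * a j)) * Real.exp (η * a j)
      ≤ (2 * C + 4 * K * C) * (1 / a j + a j ^ (-α) * (1 + Real.log n)) *
        Real.exp (η * (n * τ)) := by
        refine mul_le_mul (h2.trans h4) ?_ (Real.exp_nonneg _) (by positivity)
        gcongr
    _ = _ := by ring

/-- Convolution of the two discrete singular kernels of the error estimate. -/
theorem sum_convolution_le {α b Λ ℓ : ℝ} (h0 : 0 ≤ α) (h1 : α < 1) (hb : 0 ≤ b) {n : ℕ}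
    (hn : 1 ≤ n) (hΛ : 1 + Real.log n ≤ Λ)
    (hℓ : ∑ i ∈ Finset.range n, ((i : ℝ) + 1) ^ (-1 - α) ≤ ℓ) :
    ∑ j ∈ Finset.range n, (1 / ((j : ℝ) + 1) + b * Λ * ((j : ℝ) + 1) ^ (-α)) *
      (1 / (((n - 1 - j : ℕ) : ℝ) + 1) + b * ℓ) ≤
      Λ * ℓ * (2 / n + 3 * b + b ^ 2 * (n : ℝ) ^ (1 - α) / (1 - α)) := by
  have h1α : 0 < 1 - α := by linarith
  have hn0 : (0 : ℝ) < n := by exact_mod_cast hn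
  have hn1 : (1 : ℝ) ≤ n := by exact_mod_cast hn
  have hΛ1 : 1 ≤ Λ := by linarith [Real.log_nonneg hn1]
  have hℓ1 : 1 ≤ ℓ := by
    refine le_trans ?_ hℓ
    have : ∀ i ∈ Finset.range n, (0 : ℝ) ≤ ((i : ℝ) + 1) ^ (-1 - α) := fun i _ =>
      Real.rpow_nonneg (by positivity) _
    have h2 := Finset.single_le_sum this (Finset.mem_range.2 (Nat.lt_of_lt_of_le Nat.zero_lt_one hn))
    simpa using h2
  -- With x + y = n+1, partial fractions handle 1/(xy), and the mixed product x^{-α}/y is at most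
  -- the power -1-α of the smaller variable, hence at most the sum of both such powers.
  have hterm : ∀ j ∈ Finset.range n,
      (1 / ((j : ℝ) + 1) + b * Λ * ((j : ℝ) + 1) ^ (-α)) *
      (1 / (((n - 1 - j : ℕ) : ℝ) + 1) + b * ℓ) ≤
      1 / n * (1 / ((j : ℝ) + 1) + 1 / (((n - 1 - j : ℕ) : ℝ) + 1)) + b * ℓ * (1 / ((j : ℝ) + 1)) +
      b * Λ * (((j : ℝ) + 1) ^ (-1 - α) + (((n - 1 - j : ℕ) : ℝ) + 1) ^ (-1 - α)) +
      b ^ 2 * Λ * ℓ * ((j : ℝ) + 1) ^ (-α) := by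
    intro j hj
    rw [Finset.mem_range] at hj
    have hs : ((j : ℝ) + 1) + (((n - 1 - j : ℕ) : ℝ) + 1) = n + 1 := by
      rw [Nat.sub_sub, Nat.cast_sub (by omega)]
      push_cast
      ring
    set x := (j : ℝ) + 1 with hx
    set y := (((n - 1 - j : ℕ) : ℝ) + 1) with hy
    have hx0 : 0 < x := by positivity
    have hy0 : 0 < y := by positivity
    have ea : 1 / x * (1 / y) ≤ 1 / n * (1 / x + 1 / y) := by
      have e1 : 1 / x + 1 / y = (n + 1) * (1 / x * (1 / y)) := by
        rw [← hs]; field_simp; ring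
      rw [e1, ← mul_assoc]
      refine le_mul_of_one_le_left (by positivity) ?_
      rw [one_div, inv_mul_eq_div, le_div_iff₀ hn0]
      linarith
    have ec : x ^ (-α) * (1 / y) ≤ x ^ (-1 - α) + y ^ (-1 - α) := by
      have ex : x ^ (-1 - α) = x ^ (-α) * (1 / x) := by
        rw [show -1 - α = -α - 1 by ring, Real.rpow_sub_one hx0.ne']; ring
      have ey : y ^ (-1 - α) = y ^ (-α) * (1 / y) := by
        rw [show -1 - α = -α - 1 by ring, Real.rpow_sub_one hy0.ne']; ring
      have p1 := Real.rpow_nonneg hx0.le (-α)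
      have p2 := Real.rpow_nonneg hy0.le (-α)
      rcases le_total x y with h | h
      · have : 1 / y ≤ 1 / x := one_div_le_one_div_of_le hx0 h
        have q : 0 ≤ y ^ (-1 - α) := Real.rpow_nonneg hy0.le _
        rw [ex]
        nlinarith
      · have : x ^ (-α) ≤ y ^ (-α) := Real.rpow_le_rpow_of_nonpos hy0 h (by linarith)
        have q : 0 ≤ x ^ (-1 - α) := Real.rpow_nonneg hx0.le _
        rw [ey]
        have : x ^ (-α) * (1 / y) ≤ y ^ (-α) * (1 / y) := by gcongr
        linarith
    calc (1 / x + b * Λ * x ^ (-α)) * (1 / y + b * ℓ)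
        = 1 / x * (1 / y) + b * ℓ * (1 / x) + b * Λ * (x ^ (-α) * (1 / y)) +
          b ^ 2 * Λ * ℓ * x ^ (-α) := by ring
      _ ≤ _ := by gcongr
  refine (Finset.sum_le_sum hterm).trans ?_
  have hrefl : ∀ g : ℕ → ℝ, ∑ i ∈ Finset.range n, g (n - 1 - i) = ∑ i ∈ Finset.range n, g i :=
    fun g => Finset.sum_range_reflect g n
  rw [Finset.sum_add_distrib, Finset.sum_add_distrib, Finset.sum_add_distrib, ← Finset.mul_sum,
    ← Finset.mul_sum, ← Finset.mul_sum, ← Finset.mul_sum, Finset.sum_add_distrib,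
    Finset.sum_add_distrib, hrefl (fun i => 1 / ((i : ℝ) + 1)),
    hrefl (fun i => ((i : ℝ) + 1) ^ (-1 - α))]
  have hH := (sum_inv_le n).trans hΛ
  have hA := sum_rpow_neg_le h0 h1 n
  calc _ ≤ 1 / n * (Λ + Λ) + b * ℓ * Λ + b * Λ * (ℓ + ℓ) +
        b ^ 2 * Λ * ℓ * ((n : ℝ) ^ (1 - α) / (1 - α)) := by gcongr
    _ ≤ 1 / n * (Λ + Λ) * ℓ + b * ℓ * Λ + b * Λ * (ℓ + ℓ) +
        b ^ 2 * Λ * ℓ * ((n : ℝ) ^ (1 - α) / (1 - α)) := by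
      have : 1 / n * (Λ + Λ) ≤ 1 / n * (Λ + Λ) * ℓ := le_mul_of_one_le_right (by positivity) hℓ1
      linarith
    _ = _ := by ring

/-! ### Telescoping and the error estimate -/

theorem pow_sub_pow_eq_sum {A : Type*} [Ring A] (a b : A) (n : ℕ) :
    a ^ n - b ^ n = ∑ i ∈ Finset.range n, b ^ i * (a - b) * a ^ (n - 1 - i) := by
  induction n with
  | zero => simp
  | succ n ih =>
    rw [Finset.sum_range_succ', pow_zero, one_mul, Nat.add_sub_cancel, Nat.sub_zero]
    have : ∑ i ∈ Finset.range n, b ^ (i + 1) * (a - b) * a ^ (n - (i + 1)) =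
        b * ∑ i ∈ Finset.range n, b ^ i * (a - b) * a ^ (n - 1 - i) := by
      rw [Finset.mul_sum]
      refine Finset.sum_congr rfl fun i _ => ?_
      rw [pow_succ', Nat.sub_sub, add_comm 1 i]
      simp only [mul_assoc]
    rw [this, ← ih, pow_succ', pow_succ']
    noncomm_ring

theorem norm_pow_le_one {F : X →L[ℂ] X} (hF : ‖F‖ ≤ 1) (n : ℕ) : ‖F ^ n‖ ≤ 1 := by
  induction n with
  | zero => exact ContinuousLinearMap.norm_id_le
  | succ n ih =>
    rw [pow_succ]
    exact (norm_mul_le _ _).trans (mul_le_one₀ ih (norm_nonneg _) hF)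

/-- The error bound is quadratic in t^{1-α}; all of this growth is absorbed into the exponential, as
t^β ≤ e^t. -/
theorem one_add_rpow_add_sq_le {t β : ℝ} (ht : 0 ≤ t) (h0 : 0 ≤ β) (h1 : β ≤ 1) :
    1 + t ^ β + (t ^ β) ^ 2 ≤ 3 * Real.exp (2 * t) := by
  have hx0 : 0 ≤ t ^ β := Real.rpow_nonneg ht _
  have hx : t ^ β ≤ Real.exp t := by
    rcases le_total t 1 with h | h
    · exact (Real.rpow_le_one ht h h0).trans (Real.one_le_exp ht)
    · refine (Real.rpow_le_rpow_of_exponent_le h h1).trans ?_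
      rw [Real.rpow_one]
      linarith [Real.add_one_le_exp t]
  have h2 : Real.exp (2 * t) = Real.exp t ^ 2 := by rw [← Real.exp_nat_mul]; push_cast; rfl
  have h3 : 1 ≤ Real.exp t := Real.one_le_exp ht
  have h4 : (t ^ β) ^ 2 ≤ Real.exp t ^ 2 := pow_le_pow_left₀ hx0 hx 2
  rw [h2]
  nlinarith

theorem one_div_add_le {n b x q : ℝ} (hq : 0 < q) (hbq : b = x / q) (hnq : 1 / n ≤ 1 / q) :
    1 / n + b ≤ (1 + x + x ^ 2) / q := by
  have : (1 + x + x ^ 2) / q = 1 / q + x / q + x ^ 2 / q := by ring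
  have : 0 ≤ x ^ 2 / q := by positivity
  linarith

theorem two_div_add_le {β n b x q : ℝ} (hβ : 0 < β) (hx : 0 ≤ x) (hq : 0 < q) (hbq : b = x / q)
    (hnq : 1 / n ≤ 1 / q) :
    2 / n + 3 * b + b ^ 2 * q / β ≤ (3 + 1 / β) * ((1 + x + x ^ 2) / q) := by
  have hb : 0 ≤ b := hbq ▸ div_nonneg hx hq.le
  have e1 : b ^ 2 * q / β = 1 / β * (x ^ 2 / q) := by
    rw [hbq]; field_simp
  have e2 : (1 + x + x ^ 2) / q = 1 / q + b + x ^ 2 / q := by rw [hbq]; ring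
  have e3 : 2 / n = 2 * (1 / n) := by ring
  have q1 : 0 < 1 / q := by positivity
  have q2 : 0 ≤ x ^ 2 / q := by positivity
  have q4 : 0 ≤ 1 / β * (1 / q + b) := by positivity
  rw [e1, e2, e3]
  linarith

theorem pow_mul_sub_eq_smul_shift (T S : ℝ≥0 → X →L[ℂ] X) {U : ℝ≥0 → X →L[ℂ] X} {m : ℝ}
    (hU : IsC0Semigroup (shift m U)) (τ : ℝ≥0) (n : ℕ) :
    (T τ * S τ) ^ n - U (n * τ) = ((Real.exp (m * (n * τ)) : ℝ) : ℂ) •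
      ((shift m T τ * S τ) ^ n - shift m U τ ^ n) := by
  rw [hU.pow_eq, shift, shift, smul_mul_assoc, smul_pow, smul_sub, smul_smul, smul_smul,
    ← Complex.ofReal_pow, ← Complex.ofReal_mul, ← Complex.ofReal_mul, ← Real.exp_nat_mul,
    ← Real.exp_add, ← Real.exp_add]
  have e1 : m * (n * (τ : ℝ)) + n * -(m * τ) = 0 := by ring
  have e2 : m * (n * (τ : ℝ)) + -(m * ((n * τ : ℝ≥0) : ℝ)) = 0 := by push_cast; ring
  rw [e1, e2]
  simp

namespace IsSmoothPerturbation

variable {T S U : ℝ≥0 → X →L[ℂ] X} {m : ℝ} {R G L : X →L[ℂ] X} {D : ℝ≥0 → X →L[ℂ] X} {α K : ℝ}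
  (h : IsSmoothPerturbation T S U m R G L D α K)
include h

theorem apply_eq_resolvent_mul {v : ℝ≥0} (hv : 0 < v) : shift m T v = R * D v := by
  ext x
  exact (h.resolvent_smooth hv x).symm

variable [CompleteSpace X]

/-- Transfer of a smoothing bound from the powers of `exp (-τ (A + m))` to those of
`exp (-τ (H + m))`. -/
theorem norm_mul_pow_sum_le {Z : X →L[ℂ] X} {a : ℝ} {τ : ℝ≥0} (hτ : 0 < τ) (ha : 0 ≤ a)
    (hZ : ‖Z‖ ≤ a) (hZT : ∀ v : ℝ≥0, 0 < v → ‖Z * shift m T v‖ ≤ a * τ * (K / v)) {k n : ℕ}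
    (hkn : k ≤ n) {ℓ : ℝ} (hℓ1 : 1 ≤ ℓ)
    (hℓ : ∑ i ∈ Finset.range n, ((i : ℝ) + 1) ^ (-1 - α) ≤ ℓ) :
    ‖Z * shift m U τ ^ k‖ ≤ a * (1 + 2 * K + K / (1 - α) + 4 * K ^ 2) *
      (1 / ((k : ℝ) + 1) + (τ : ℝ) ^ (1 - α) * ℓ) := by
  have hK := h.const_nonneg
  have hα : 0 < 1 - α := sub_pos.2 h.exponent_lt_one
  have hτ' : (0 : ℝ) < τ := hτ
  set b := (τ : ℝ) ^ (1 - α) with hb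
  have hb0 : 0 ≤ b := Real.rpow_nonneg hτ'.le _
  have hTp : ∀ i : ℕ, shift m T τ ^ i = shift m T (i * τ) := h.shift_left.pow_eq τ
  have h1 : ‖Z * shift m T τ ^ k‖ ≤ a * (1 + 2 * K) * (1 / ((k : ℝ) + 1)) := by
    rcases Nat.eq_zero_or_pos k with rfl | hk
    · rw [pow_zero, mul_one, Nat.cast_zero, zero_add, div_one, mul_one]
      nlinarith [mul_nonneg ha hK]
    · have hk' : (1 : ℝ) ≤ k := by exact_mod_cast hk
      have hk0 : (0 : ℝ≥0) < k := by exact_mod_cast hk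
      rw [hTp]
      refine (hZT _ (mul_pos hk0 hτ)).trans ?_
      push_cast
      have e : a * τ * (K / (k * τ)) = a * K * (1 / k) := by field_simp
      have e2 : 1 / (k : ℝ) ≤ 2 * (1 / ((k : ℝ) + 1)) := by
        rw [← mul_div_assoc, mul_one, div_le_div_iff₀ (by linarith) (by linarith)]
        linarith
      rw [e]
      calc a * K * (1 / k) ≤ a * K * (2 * (1 / ((k : ℝ) + 1))) := by gcongr
        _ ≤ a * (1 + 2 * K) * (1 / ((k : ℝ) + 1)) := by
          have : 0 ≤ a * (1 / ((k : ℝ) + 1)) := by positivity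
          nlinarith
  -- The first telescoping term has no power of V to smooth it; the unsmoothed bound τ^{1-α} on W -
  -- V is enough.
  have h0 : ‖Z * (shift m U τ - shift m T τ)‖ ≤ a * (K / (1 - α) * b) := by
    refine (norm_mul_le _ _).trans ?_
    gcongr
    exact ContinuousLinearMap.opNorm_le_bound _ (by positivity) fun x => h.norm_sum_sub_le τ x
  have hi : ∀ i : ℕ, ‖Z * (shift m T τ ^ (i + 1) * (shift m U τ - shift m T τ))‖ ≤
      a * (4 * K ^ 2 * b) * ((i : ℝ) + 1) ^ (-1 - α) := by
    intro i
    have hu : (0 : ℝ) < (i : ℝ) + 1 := by positivity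
    -- Half of V^{i+1} smooths Z and costs 1/v; the other half smooths W - V and costs v^{-α}.
    -- Together they give τ^{1-α}(i+1)^{-1-α}.
    set v : ℝ≥0 := ((i + 1 : ℕ) : ℝ≥0) * τ / 2 with hv
    have hv0 : 0 < v := by positivity
    have hvc : (v : ℝ) = ((i : ℝ) + 1) * τ / 2 := by simp [hv]
    have e : shift m T τ ^ (i + 1) = shift m T v * shift m T v := by
      rw [hTp, ← h.shift_left.map_add, hv, add_halves]
    have e1 : ‖shift m T v * (shift m U τ - shift m T τ)‖ ≤ K * (v : ℝ) ^ (-α) * τ :=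
      ContinuousLinearMap.opNorm_le_bound _
        (by have := Real.rpow_nonneg v.coe_nonneg (-α); positivity)
        fun x => h.norm_apply_sum_sub_le hv0 τ x
    rw [e, mul_assoc, ← mul_assoc Z]
    refine (norm_mul_le _ _).trans ?_
    refine (mul_le_mul (hZT v hv0) e1 (norm_nonneg _) (by positivity)).trans ?_
    have e2 : (v : ℝ) ^ (-α) ≤ 2 * (((i : ℝ) + 1) ^ (-α) * (τ : ℝ) ^ (-α)) := by
      rw [hvc, Real.div_rpow (by positivity) (by norm_num), Real.mul_rpow hu.le hτ'.le,
        Real.rpow_neg (by norm_num : (0 : ℝ) ≤ 2), div_inv_eq_mul, mul_comm]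
      have e5 : (2 : ℝ) ^ α ≤ 2 ^ (1 : ℝ) :=
        Real.rpow_le_rpow_of_exponent_le (by norm_num) h.exponent_lt_one.le
      rw [Real.rpow_one] at e5
      have := Real.rpow_nonneg hu.le (-α)
      have := Real.rpow_nonneg hτ'.le (-α)
      gcongr
    have e3 : b = τ * (τ : ℝ) ^ (-α) := by
      rw [hb, show 1 - α = -α + 1 by ring, Real.rpow_add_one hτ'.ne']; ring
    have e4 : ((i : ℝ) + 1) ^ (-1 - α) = ((i : ℝ) + 1) ^ (-α) / ((i : ℝ) + 1) := by
      rw [show -1 - α = -α - 1 by ring, Real.rpow_sub_one hu.ne']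
    calc a * τ * (K / v) * (K * (v : ℝ) ^ (-α) * τ)
        ≤ a * τ * (K / v) * (K * (2 * (((i : ℝ) + 1) ^ (-α) * (τ : ℝ) ^ (-α))) * τ) := by gcongr
      _ = a * (4 * K ^ 2 * b) * ((i : ℝ) + 1) ^ (-1 - α) := by
        rw [hvc, e3, e4]
        field_simp
        ring
  have hsum : ‖Z * ∑ i ∈ Finset.range k,
      shift m T τ ^ i * (shift m U τ - shift m T τ) * shift m U τ ^ (k - 1 - i)‖ ≤
      a * (K / (1 - α) + 4 * K ^ 2) * (b * ℓ) := by
    have hUp : ∀ j, ‖shift m U τ ^ j‖ ≤ 1 := norm_pow_le_one (h.shift_sum.norm_le_one τ)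
    rw [Finset.mul_sum]
    refine (norm_sum_le _ _).trans ?_
    have hb1 : ∀ i ∈ Finset.range k, ‖Z * (shift m T τ ^ i * (shift m U τ - shift m T τ) *
        shift m U τ ^ (k - 1 - i))‖ ≤ ‖Z * (shift m T τ ^ i * (shift m U τ - shift m T τ))‖ := by
      intro i _
      rw [← mul_assoc]
      exact (norm_mul_le _ _).trans (mul_le_of_le_one_right (norm_nonneg _) (hUp _))
    refine (Finset.sum_le_sum hb1).trans ?_
    rcases k with _ | k
    · rw [Finset.sum_range_zero]; positivity
    rw [Finset.sum_range_succ', pow_zero, one_mul]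
    have hk2 : ∑ i ∈ Finset.range k,
        ‖Z * (shift m T τ ^ (i + 1) * (shift m U τ - shift m T τ))‖ ≤ a * (4 * K ^ 2 * b) * ℓ := by
      refine (Finset.sum_le_sum fun i _ => hi i).trans ?_
      rw [← Finset.mul_sum]
      gcongr
      refine le_trans ?_ hℓ
      exact Finset.sum_le_sum_of_subset_of_nonneg (Finset.range_mono (by omega))
        fun i _ _ => Real.rpow_nonneg (by positivity) _
    have e : a * (K / (1 - α) * b) ≤ a * (K / (1 - α) * b) * ℓ :=
      le_mul_of_one_le_right (by positivity) hℓ1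
    linarith
  have e : Z * shift m U τ ^ k = Z * shift m T τ ^ k + Z * ∑ i ∈ Finset.range k,
      shift m T τ ^ i * (shift m U τ - shift m T τ) * shift m U τ ^ (k - 1 - i) := by
    rw [← pow_sub_pow_eq_sum, mul_sub, add_sub_cancel]
  rw [e]
  refine (norm_add_le _ _).trans ((add_le_add h1 hsum).trans ?_)
  have q1 : 0 ≤ a * (1 + 2 * K) * (b * ℓ) := by positivity
  have q2 : 0 ≤ a * (K / (1 - α) + 4 * K ^ 2) * (1 / ((k : ℝ) + 1)) := by positivity
  linarith

theorem norm_resolvent_mul_step_le (τ : ℝ≥0) :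
    ‖R * (S τ * shift m T τ - shift m U τ)‖ ≤ (4 + 2 * ‖L‖) * τ := by
  refine ContinuousLinearMap.opNorm_le_bound _ (by positivity) fun x => ?_
  refine (h.norm_resolvent_step_le τ x).trans ?_
  gcongr
  linarith [norm_nonneg L]

/-- Writing V(v) = R D(v), the second R raises the one-step error to order τ², at the cost K/v of
D(v). -/
theorem norm_resolvent_mul_step_mul_le (τ : ℝ≥0) {v : ℝ≥0} (hv : 0 < v) :
    ‖R * (S τ * shift m T τ - shift m U τ) * shift m T v‖ ≤ (4 + 2 * ‖L‖) * τ * τ * (K / v) := by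
  have e : ‖R * (S τ * shift m T τ - shift m U τ) * R‖ ≤ (4 + 2 * ‖L‖) * τ * τ := by
    refine ContinuousLinearMap.opNorm_le_bound _ (by positivity) fun x => ?_
    rw [mul_assoc (4 + 2 * ‖L‖) (τ : ℝ) (τ : ℝ), ← sq]
    exact h.norm_resolvent_step_resolvent_le τ x
  rw [h.apply_eq_resolvent_mul hv, ← mul_assoc]
  refine (norm_mul_le _ _).trans ?_
  gcongr
  exact h.norm_smooth_le v hv

theorem norm_sub_one_mul_resolvent_le (τ : ℝ≥0) : ‖(shift m T τ - 1) * R‖ ≤ τ := by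
  refine ContinuousLinearMap.opNorm_le_bound _ τ.coe_nonneg fun x => ?_
  have := h.norm_resolvent_left_le τ x
  rw [map_sub, h.resolvent_comm] at this
  exact this

/-- The operators `(exp (-τ (A + m)) exp (-τ B)) ^ j exp (-τ (A + m)) (A + m)` satisfy a discrete
Volterra inequality. -/
theorem norm_pow_mul_smooth_le {τ : ℝ≥0} (hτ : 0 < τ) (j : ℕ) :
    ‖(shift m T τ * S τ) ^ j * D τ‖ ≤ K / ((j + 1) * τ) + ∑ i ∈ Finset.range j,
      K * τ * ((i + 1) * τ) ^ (-α) * ‖(shift m T τ * S τ) ^ (j - 1 - i) * D τ‖ := by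
  have hK := h.const_nonneg
  have hTp : ∀ i : ℕ, shift m T τ ^ i = shift m T (i * τ) := h.shift_left.pow_eq τ
  set F := shift m T τ * S τ with hF
  -- Telescoping against V^j, with F - V = V(S-1): each term contains V^{i+1}(S-1), of order
  -- τ((i+1)τ)^{-α}, the Volterra kernel.
  have e : F ^ j * D τ = shift m T τ ^ j * D τ +
      ∑ i ∈ Finset.range j, (shift m T τ ^ (i + 1) * (S τ - 1)) * (F ^ (j - 1 - i) * D τ) := by
    have h1 := pow_sub_pow_eq_sum F (shift m T τ) j
    rw [sub_eq_iff_eq_add'] at h1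
    rw [h1, add_mul, Finset.sum_mul]
    congr 1
    refine Finset.sum_congr rfl fun i _ => ?_
    have : F - shift m T τ = shift m T τ * (S τ - 1) := by rw [hF, mul_sub, mul_one]
    rw [this, pow_succ]
    simp only [mul_assoc]
  rw [e]
  refine (norm_add_le _ _).trans (add_le_add ?_ ?_)
  · have e1 : shift m T τ ^ j * D τ = D (j * τ + τ) := by
      rw [hTp]
      ext x
      exact h.apply_smooth hτ _ x
    rw [e1]
    refine (h.norm_smooth_le _ (by positivity)).trans (le_of_eq ?_)
    push_cast
    ring
  · refine (norm_sum_le _ _).trans (Finset.sum_le_sum fun i _ => (norm_mul_le _ _).trans ?_)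
    gcongr
    rw [hTp]
    have hv : (0 : ℝ≥0) < ((i + 1 : ℕ) : ℝ≥0) * τ := by positivity
    have hvc : ((((i + 1 : ℕ) : ℝ≥0) * τ : ℝ≥0) : ℝ) = (i + 1) * τ := by push_cast; ring
    have hp := Real.rpow_nonneg (((i + 1 : ℕ) : ℝ≥0) * τ : ℝ≥0).coe_nonneg (-α)
    rw [← hvc]
    refine ContinuousLinearMap.opNorm_le_bound _ (by positivity) fun x => ?_
    refine (h.norm_apply_right_sub_le hv τ x).trans (le_of_eq ?_)
    ring

/-- The splitting F^n - W^n = F^n(1-V) + (V-1)W^n + V((SV)^n - W^n) puts a factor V to the left of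
the telescoped steps. As V(SV)^j = F^jV = F^jDR, that factor becomes an R next to each one-step
error. -/
theorem norm_pow_sub_le {τ : ℝ≥0} (hτ : 0 < τ) {n : ℕ} (hn : 1 ≤ n) :
    ‖(shift m T τ * S τ) ^ n - shift m U τ ^ n‖ ≤
      2 * τ * ‖(shift m T τ * S τ) ^ (n - 1) * D τ‖ +
      ‖(shift m T τ - 1) * shift m U τ ^ n‖ +
      ∑ j ∈ Finset.range n, ‖(shift m T τ * S τ) ^ j * D τ‖ *
        ‖R * (S τ * shift m T τ - shift m U τ) * shift m U τ ^ (n - 1 - j)‖ := by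
  set V := shift m T τ with hV
  set W := shift m U τ with hW
  set F := V * S τ with hF
  have hswap : ∀ j, F ^ j * V = V * (S τ * V) ^ j := by
    intro j
    induction j with
    | zero => simp
    | succ j ih => rw [pow_succ, mul_assoc, hF, mul_assoc, ← hF, ← mul_assoc, ih, pow_succ, mul_assoc]
  have hres : ∀ j, F ^ j * D τ * R = F ^ j * V := by
    intro j
    rw [mul_assoc]
    congr 1
    ext x
    exact h.smooth_resolvent hτ x
  -- F^n = F^{n-1}VS = F^{n-1}DRS with S = 1 + (S-1); each of the two resulting factors has norm at
  -- most τ, whence 2τ.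
  have e1 : F ^ n * (1 - V) = F ^ (n - 1) * D τ * (R * (1 - V) + R * ((S τ - 1) * (1 - V))) := by
    obtain ⟨k, rfl⟩ : ∃ k, n = k + 1 := ⟨n - 1, by omega⟩
    rw [Nat.add_sub_cancel, pow_succ, ← mul_add, ← mul_assoc (F ^ k * D τ), hres]
    have e : F ^ k * F = F ^ k * V * S τ := by rw [mul_assoc]
    rw [e]
    generalize F ^ k = P
    noncomm_ring
  have e2 : V * ((S τ * V) ^ n - W ^ n) = ∑ j ∈ Finset.range n,
      (F ^ j * D τ) * (R * (S τ * V - W) * W ^ (n - 1 - j)) := by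
    have := pow_sub_pow_eq_sum W (S τ * V) n
    rw [← neg_sub, this, ← Finset.sum_neg_distrib, Finset.mul_sum]
    refine Finset.sum_congr rfl fun j _ => ?_
    have e3 : (F ^ j * D τ) * (R * (S τ * V - W) * W ^ (n - 1 - j)) =
        F ^ j * D τ * R * ((S τ * V - W) * W ^ (n - 1 - j)) := by simp only [mul_assoc]
    rw [e3, hres, hswap]
    noncomm_ring
  have e3 : F ^ n - W ^ n = F ^ n * (1 - V) + (V - 1) * W ^ n + V * ((S τ * V) ^ n - W ^ n) := by
    rw [mul_sub, mul_sub, ← hswap]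
    noncomm_ring
  rw [e3, e1, e2]
  refine (norm_add₃_le).trans (add_le_add (add_le_add ?_ le_rfl) ?_)
  · have hR1 : ‖R * (1 - V)‖ ≤ τ := by
      refine ContinuousLinearMap.opNorm_le_bound _ τ.coe_nonneg fun x => ?_
      have := h.norm_resolvent_left_le τ x
      rw [← norm_neg, ← map_neg, neg_sub] at this
      exact this
    have hR2 : ‖R * ((S τ - 1) * (1 - V))‖ ≤ τ := by
      refine ContinuousLinearMap.opNorm_le_bound _ τ.coe_nonneg fun x => ?_
      refine (h.norm_resolvent_right_le τ (x - V x)).trans ?_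
      have h2 : ‖x - V x‖ ≤ 2 * ‖x‖ := by
        refine (norm_sub_le _ _).trans ?_
        linarith [h.shift_left.norm_apply_le τ x]
      have : (τ : ℝ) * ‖x - V x‖ ≤ τ * (2 * ‖x‖) := by gcongr
      linarith
    refine (norm_mul_le _ _).trans ?_
    rw [mul_comm]
    gcongr
    refine (norm_add_le _ _).trans ?_
    linarith
  · exact (norm_sum_le _ _).trans (Finset.sum_le_sum fun j _ => norm_mul_le _ _)

set_option maxHeartbeats 800000 in
/-- The error estimate with explicit dependence on the harmonic-type sum `ℓ`. -/
theorem exists_norm_pow_sub_le : ∃ M η : ℝ, 0 ≤ M ∧ 0 ≤ η ∧ ∀ τ : ℝ≥0, 0 < τ → ∀ n : ℕ, 1 ≤ n →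
    ∀ ℓ : ℝ, ∑ i ∈ Finset.range n, ((i : ℝ) + 1) ^ (-1 - α) ≤ ℓ →
    ‖(T τ * S τ) ^ n - U (n * τ)‖ ≤ M * Real.exp (η * (n * τ)) *
      ((1 + Real.log n) * ℓ / (n : ℝ) ^ (1 - α)) := by
  have hK := h.const_nonneg
  have hα0 := h.exponent_nonneg
  have hα : 0 < 1 - α := sub_pos.2 h.exponent_lt_one
  obtain ⟨M, η, hM, hη, hvol⟩ := discrete_volterra hα0 h.exponent_lt_one hK hK
  set c := 1 + 2 * K + K / (1 - α) + 4 * K ^ 2 with hc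
  have hc0 : 0 ≤ c := by positivity
  set d := 4 + 2 * ‖L‖ with hd
  have hd0 : 0 ≤ d := by positivity
  have hm : 1 ≤ m := h.one_le
  set N := 2 * M + 2 * c + M * (d * c) * (3 + 1 / (1 - α)) with hN
  have hN0 : 0 ≤ N := by positivity
  -- The exponent collects η from the Volterra bound, m from undoing the rescaling, and 2 from
  -- absorbing the powers of t; this last step also gives the 3.
  refine ⟨3 * N, η + m + 2, by positivity, by linarith, fun τ hτ n hn ℓ hℓ => ?_⟩
  have hτ' : (0 : ℝ) < τ := hτ
  have hn0 : (0 : ℝ) < n := by exact_mod_cast hn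
  have hn1 : (1 : ℝ) ≤ n := by exact_mod_cast hn
  set Λ := 1 + Real.log n with hΛ
  have hΛ1 : 1 ≤ Λ := by linarith [Real.log_nonneg hn1]
  have hℓ1 : 1 ≤ ℓ := by
    refine le_trans ?_ hℓ
    have h1 : ∀ i ∈ Finset.range n, (0 : ℝ) ≤ ((i : ℝ) + 1) ^ (-1 - α) := fun i _ =>
      Real.rpow_nonneg (by positivity) _
    have h2 := Finset.single_le_sum h1 (Finset.mem_range.2 (Nat.lt_of_lt_of_le Nat.zero_lt_one hn))
    simpa using h2
  have hΛℓ : 1 ≤ Λ * ℓ := one_le_mul_of_one_le_of_one_le hΛ1 hℓ1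
  set t : ℝ := n * τ with ht
  have ht0 : 0 < t := by positivity
  set b := (τ : ℝ) ^ (1 - α) with hb
  have hb0 : 0 ≤ b := Real.rpow_nonneg hτ'.le _
  set E := Real.exp (η * t) with hE
  have hE1 : 1 ≤ E := Real.one_le_exp (by positivity)
  have hp : ∀ j < n, τ * ‖(shift m T τ * S τ) ^ j * D τ‖ ≤
      M * E * (1 / ((j : ℝ) + 1) + b * Λ * ((j : ℝ) + 1) ^ (-α)) := by
    intro j hj
    have h1 := hvol τ hτ' n (fun j => ‖(shift m T τ * S τ) ^ j * D τ‖)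
      (fun j _ => h.norm_pow_mul_smooth_le hτ j) j hj
    have hu : (0 : ℝ) < (j : ℝ) + 1 := by positivity
    have e3 : b = τ * (τ : ℝ) ^ (-α) := by
      rw [hb, show 1 - α = -α + 1 by ring, Real.rpow_add_one hτ'.ne']; ring
    calc τ * ‖(shift m T τ * S τ) ^ j * D τ‖
        ≤ τ * (M * E * (1 / ((j + 1) * τ) + ((j + 1) * τ) ^ (-α) * Λ)) := by gcongr
      _ = M * E * (1 / ((j : ℝ) + 1) + b * Λ * ((j : ℝ) + 1) ^ (-α)) := by
        rw [Real.mul_rpow hu.le hτ'.le, e3]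
        field_simp
  have hZ0 : ‖(shift m T τ - 1) * shift m U τ ^ n‖ ≤ 2 * c * (1 / ((n : ℝ) + 1) + b * ℓ) := by
    refine h.norm_mul_pow_sum_le hτ (by norm_num) ?_ (fun v hv => ?_) le_rfl hℓ1 hℓ
    · refine (norm_sub_le _ _).trans ?_
      have h1 := h.shift_left.norm_le_one τ
      have h2 : ‖(1 : X →L[ℂ] X)‖ ≤ 1 := ContinuousLinearMap.norm_id_le
      linarith
    · rw [h.apply_eq_resolvent_mul hv, ← mul_assoc]
      refine (norm_mul_le _ _).trans ?_
      refine mul_le_mul ?_ (h.norm_smooth_le v hv) (norm_nonneg _) (by positivity)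
      refine (h.norm_sub_one_mul_resolvent_le τ).trans ?_
      linarith
  have hZ1 : ∀ j < n, ‖R * (S τ * shift m T τ - shift m U τ) * shift m U τ ^ (n - 1 - j)‖ ≤
      d * τ * c * (1 / (((n - 1 - j : ℕ) : ℝ) + 1) + b * ℓ) := fun j hj =>
    h.norm_mul_pow_sum_le hτ (by positivity) (h.norm_resolvent_mul_step_le τ)
      (fun v hv => h.norm_resolvent_mul_step_mul_le τ hv) (by omega) hℓ1 hℓ
  have hsum : ∑ j ∈ Finset.range n, ‖(shift m T τ * S τ) ^ j * D τ‖ *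
      ‖R * (S τ * shift m T τ - shift m U τ) * shift m U τ ^ (n - 1 - j)‖ ≤
      M * E * (d * c) * (Λ * ℓ * (2 / n + 3 * b + b ^ 2 * (n : ℝ) ^ (1 - α) / (1 - α))) := by
    have hterm : ∀ j ∈ Finset.range n, ‖(shift m T τ * S τ) ^ j * D τ‖ *
        ‖R * (S τ * shift m T τ - shift m U τ) * shift m U τ ^ (n - 1 - j)‖ ≤
        M * E * (d * c) * ((1 / ((j : ℝ) + 1) + b * Λ * ((j : ℝ) + 1) ^ (-α)) *
          (1 / (((n - 1 - j : ℕ) : ℝ) + 1) + b * ℓ)) := by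
      intro j hj
      rw [Finset.mem_range] at hj
      have hy : 0 ≤ 1 / (((n - 1 - j : ℕ) : ℝ) + 1) + b * ℓ := by positivity
      calc _ ≤ ‖(shift m T τ * S τ) ^ j * D τ‖ *
            (d * τ * c * (1 / (((n - 1 - j : ℕ) : ℝ) + 1) + b * ℓ)) := by
              gcongr
              exact hZ1 j hj
        _ = (τ * ‖(shift m T τ * S τ) ^ j * D τ‖) * (d * c *
            (1 / (((n - 1 - j : ℕ) : ℝ) + 1) + b * ℓ)) := by ring
        _ ≤ (M * E * (1 / ((j : ℝ) + 1) + b * Λ * ((j : ℝ) + 1) ^ (-α))) * (d * c *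
            (1 / (((n - 1 - j : ℕ) : ℝ) + 1) + b * ℓ)) := by
              exact mul_le_mul_of_nonneg_right (hp j hj) (by positivity)
        _ = _ := by ring
    refine (Finset.sum_le_sum hterm).trans ?_
    rw [← Finset.mul_sum]
    gcongr
    exact sum_convolution_le hα0 h.exponent_lt_one hb0 hn le_rfl hℓ
  have hfirst : 2 * τ * ‖(shift m T τ * S τ) ^ (n - 1) * D τ‖ ≤ 2 * M * E * (Λ * ℓ * (1 / n + b)) := by
    have h1 := hp (n - 1) (by omega)
    have e : (((n - 1 : ℕ) : ℝ) + 1) = n := by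
      rw [Nat.cast_sub hn]; push_cast; ring
    rw [e] at h1
    have e2 : (n : ℝ) ^ (-α) ≤ 1 := Real.rpow_le_one_of_one_le_of_nonpos hn1 (by linarith)
    have e3 : 1 / (n : ℝ) + b * Λ * (n : ℝ) ^ (-α) ≤ Λ * ℓ * (1 / n + b) := by
      have q1 : 1 / (n : ℝ) ≤ Λ * ℓ * (1 / n) := le_mul_of_one_le_left (by positivity) hΛℓ
      have q2 : b * Λ * (n : ℝ) ^ (-α) ≤ b * Λ * ℓ := by
        gcongr
        exact e2.trans hℓ1
      linarith
    calc 2 * τ * ‖(shift m T τ * S τ) ^ (n - 1) * D τ‖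
        = 2 * (τ * ‖(shift m T τ * S τ) ^ (n - 1) * D τ‖) := by ring
      _ ≤ 2 * (M * E * (Λ * ℓ * (1 / n + b))) := by
        exact mul_le_mul_of_nonneg_left
          (h1.trans (mul_le_mul_of_nonneg_left e3 (by positivity))) (by norm_num)
      _ = _ := by ring
  have hsecond : 2 * c * (1 / ((n : ℝ) + 1) + b * ℓ) ≤ 2 * c * E * (Λ * ℓ * (1 / n + b)) := by
    have q1 : 1 / ((n : ℝ) + 1) ≤ Λ * ℓ * (1 / n) :=
      (one_div_le_one_div_of_le hn0 (by linarith)).trans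
        (le_mul_of_one_le_left (by positivity) hΛℓ)
    have q2 : b * ℓ ≤ Λ * ℓ * b := by
      have : 0 ≤ b * ℓ := by positivity
      nlinarith
    calc 2 * c * (1 / ((n : ℝ) + 1) + b * ℓ) ≤ 2 * c * (Λ * ℓ * (1 / n + b)) := by
          gcongr; linarith
      _ ≤ 2 * c * (E * (Λ * ℓ * (1 / n + b))) := by
          exact mul_le_mul_of_nonneg_left
            (le_mul_of_one_le_left (by positivity) hE1) (by positivity)
      _ = _ := by ring
  set x := t ^ (1 - α) with hx
  have hx0 : 0 ≤ x := Real.rpow_nonneg ht0.le _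
  set q := (n : ℝ) ^ (1 - α) with hq
  have hq0 : 0 < q := Real.rpow_pos_of_pos hn0 _
  have hbq : b = x / q := by
    rw [eq_div_iff hq0.ne', hb, hq, ← Real.mul_rpow hτ'.le hn0.le, mul_comm]
  have hnq : 1 / (n : ℝ) ≤ 1 / q := by
    refine one_div_le_one_div_of_le hq0 ?_
    calc q ≤ (n : ℝ) ^ (1 : ℝ) := Real.rpow_le_rpow_of_exponent_le hn1 (by linarith)
      _ = n := Real.rpow_one _
  have hxe : 1 + x + x ^ 2 ≤ 3 * Real.exp (2 * t) := one_add_rpow_add_sq_le ht0.le hα.le (by linarith)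
  have hmain : ‖(shift m T τ * S τ) ^ n - shift m U τ ^ n‖ ≤
      E * N * (Λ * ℓ / q) * (1 + x + x ^ 2) := by
    refine (h.norm_pow_sub_le hτ hn).trans ((add_le_add (add_le_add hfirst
      (hZ0.trans hsecond)) hsum).trans ?_)
    have r1 : 1 / (n : ℝ) + b ≤ (1 + x + x ^ 2) / q := one_div_add_le hq0 hbq hnq
    have r2 : 2 / (n : ℝ) + 3 * b + b ^ 2 * q / (1 - α) ≤
        (3 + 1 / (1 - α)) * ((1 + x + x ^ 2) / q) := two_div_add_le hα hx0 hq0 hbq hnq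
    have s1 : Λ * ℓ * (1 / n + b) ≤ Λ * ℓ * ((1 + x + x ^ 2) / q) := by gcongr
    have s2 : Λ * ℓ * (2 / n + 3 * b + b ^ 2 * q / (1 - α)) ≤
        Λ * ℓ * ((3 + 1 / (1 - α)) * ((1 + x + x ^ 2) / q)) := by gcongr
    calc 2 * M * E * (Λ * ℓ * (1 / n + b)) + 2 * c * E * (Λ * ℓ * (1 / n + b)) +
          M * E * (d * c) * (Λ * ℓ * (2 / n + 3 * b + b ^ 2 * q / (1 - α)))
        ≤ 2 * M * E * (Λ * ℓ * ((1 + x + x ^ 2) / q)) +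
          2 * c * E * (Λ * ℓ * ((1 + x + x ^ 2) / q)) +
          M * E * (d * c) * (Λ * ℓ * ((3 + 1 / (1 - α)) * ((1 + x + x ^ 2) / q))) := by gcongr
      _ = E * N * (Λ * ℓ / q) * (1 + x + x ^ 2) := by rw [hN]; ring
  rw [pow_mul_sub_eq_smul_shift T S h.shift_sum.toIsC0Semigroup, norm_smul, Complex.norm_real, Real.norm_of_nonneg (Real.exp_nonneg _)]
  calc Real.exp (m * t) * ‖(shift m T τ * S τ) ^ n - shift m U τ ^ n‖
      ≤ Real.exp (m * t) * (E * N * (Λ * ℓ / q) * (3 * Real.exp (2 * t))) := by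
        gcongr
        refine hmain.trans ?_
        gcongr
    _ = 3 * N * (Real.exp (η * t) * Real.exp (m * t) * Real.exp (2 * t)) * (Λ * ℓ / q) := by
        rw [hE]; ring
    _ = 3 * N * Real.exp ((η + m + 2) * t) * (Λ * ℓ / q) := by
        rw [← Real.exp_add, ← Real.exp_add]; ring_nf

end IsSmoothPerturbation

/-! ### Uniqueness of the semigroup -/

namespace IsC0Semigroup

variable {V : ℝ≥0 → X →L[ℂ] X} (hV : IsC0Semigroup V)
include hV

theorem tendsto_apply_zero (x : X) : Tendsto (fun t => V t x) (𝓝 0) (𝓝 x) := by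
  have h1 : ContinuousWithinAt (fun t : ℝ≥0 => V t x) (Ioi 0) 0 := by
    simpa [ContinuousWithinAt, hV.map_zero] using hV.tendsto_zero x
  have h2 := continuousWithinAt_insert_self.mpr h1
  have h3 : insert (0 : ℝ≥0) (Ioi 0) = univ := by
    ext t
    simp
  rw [h3, continuousWithinAt_univ] at h2
  simpa [ContinuousAt, hV.map_zero] using h2

variable [CompleteSpace X]

/-- Otherwise ‖V(s_n)‖ is unbounded along some s_n → 0 although V(s_n)x → x for each x, against the
uniform boundedness principle. -/
theorem exists_norm_le_near_zero : ∃ δ : ℝ≥0, 0 < δ ∧ ∃ M : ℝ, ∀ s ≤ δ, ‖V s‖ ≤ M := by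
  by_contra! hcon
  choose s hs hsn using fun n : ℕ => hcon (1 / ((n : ℝ≥0) + 1)) (by positivity) n
  have hs0 : Tendsto s atTop (𝓝 0) :=
    tendsto_of_tendsto_of_tendsto_of_le_of_le tendsto_const_nhds
      (tendsto_one_div_add_atTop_nhds_zero_nat (𝕜 := ℝ≥0)) (fun _ => zero_le) hs
  obtain ⟨C, hC⟩ := banach_steinhaus (g := fun n => V (s n)) fun x => by
    obtain ⟨C, hC⟩ := ((hV.tendsto_apply_zero x).comp hs0).norm.bddAbove_range
    exact ⟨C, fun n => hC ⟨n, rfl⟩⟩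
  obtain ⟨n, hn⟩ := exists_nat_gt C
  linarith [hC n, hsn n]

theorem exists_norm_le (t : ℝ≥0) : ∃ M : ℝ, ∀ s ≤ t, ‖V s‖ ≤ M := by
  obtain ⟨δ, hδ, M, hM⟩ := hV.exists_norm_le_near_zero
  obtain ⟨n, hn⟩ := exists_nat_gt (t / δ)
  have hn0 : 0 < n := by
    have : (0 : ℝ≥0) < n := lt_of_le_of_lt (zero_le) hn
    exact_mod_cast this
  have hn1 : (n : ℝ≥0) ≠ 0 := by positivity
  refine ⟨M ^ n, fun s hs => ?_⟩
  have e : V s = V (s / n) ^ n := by rw [hV.pow_eq, mul_div_cancel₀ _ hn1]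
  rw [e]
  refine (norm_pow_le' _ hn0).trans (pow_le_pow_left₀ (norm_nonneg _) (hM _ ?_) n)
  rw [div_lt_iff₀ hδ] at hn
  rw [div_le_iff₀ (by positivity), mul_comm]
  exact hs.trans hn.le

theorem continuous_apply (x : X) : Continuous fun t => V t x := by
  rw [continuous_iff_continuousAt]
  intro s
  obtain ⟨M, hM⟩ := hV.exists_norm_le (s + 1)
  rw [ContinuousAt, tendsto_iff_norm_sub_tendsto_zero]
  have hd : Tendsto (fun t : ℝ≥0 => (t - s) + (s - t)) (𝓝 s) (𝓝 0) := by
    have hc : Continuous fun t : ℝ≥0 => (t - s) + (s - t) := by fun_prop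
    simpa using hc.tendsto s
  have h0 : Tendsto (fun t : ℝ≥0 => M * ‖V t x - x‖) (𝓝 0) (𝓝 0) := by
    simpa using ((hV.tendsto_apply_zero x).sub_const x).norm.const_mul M
  have hlt : ∀ᶠ t in 𝓝 s, t < s + 1 := eventually_lt_nhds (lt_add_of_pos_right s one_pos)
  refine squeeze_zero' (Eventually.of_forall fun _ => norm_nonneg _) ?_ (h0.comp hd)
  filter_upwards [hlt] with t ht
  have key : ∀ r d : ℝ≥0, r ≤ s + 1 → ‖V (r + d) x - V r x‖ ≤ M * ‖V d x - x‖ := by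
    intro r d hr
    rw [hV.add_apply, ← map_sub]
    exact (V r).le_of_opNorm_le (hM r hr) _
  rcases le_total s t with h | h
  · have := key s (t - s) (le_add_of_nonneg_right zero_le_one)
    rw [add_tsub_cancel_of_le h] at this
    simpa [tsub_eq_zero_of_le h] using this
  · have := key t (s - t) ht.le
    rw [add_tsub_cancel_of_le h, norm_sub_rev] at this
    simpa [tsub_eq_zero_of_le h] using this

/-- A strongly continuous semigroup whose generator is densely defined and is extended by that of a
contraction semigroup equals the latter. -/
theorem eq_of_generator_le {U : ℝ≥0 → X →L[ℂ] X} (hU : IsContractionSemigroup U)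
    (hd : Dense ((generator V).domain : Set X)) (hle : generator V ≤ generator U) : V = U := by
  have hgr : ∀ x y, (x, y) ∈ generatorGraph V → (x, y) ∈ generatorGraph U := by
    intro x y hxy
    rw [← generator_graph] at hxy ⊢
    exact LinearPMap.le_graph_of_le hle hxy
  funext t
  refine DFunLike.coe_injective (Continuous.ext_on hd (V t).continuous (U t).continuous ?_)
  intro x hx
  obtain ⟨y, hxy⟩ := mem_generator_domain.1 hx
  -- The generators agree along the orbit V(r)x, so r ↦ U(t-r)V(r)x has right derivative 0 and its
  -- end values coincide.
  have := norm_image_sub_le_of_norm_deriv_right_le_segment (a := 0) (b := (t : ℝ)) (C := 0)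
    (f := fun r : ℝ => U (t - r).toNNReal ((1 : X →L[ℂ] X) (V r.toNNReal x)))
    (f' := fun r : ℝ => U (t - r).toNNReal
      (V r.toNNReal y - (1 : X →L[ℂ] X) (V r.toNNReal y)))
    (fun r _ => (hU.tendsto_apply (l := 𝓝 r)
      ((continuous_real_toNNReal.comp (continuous_sub_left (t : ℝ))).tendsto r)
      (((1 : X →L[ℂ] X).continuous.comp
        ((hV.continuous_apply x).comp continuous_real_toNNReal)).tendsto r)).mono_left
        nhdsWithin_le_nhds)
    (fun r hr => hU.hasDerivWithinAt_sub hV 1 hxy hr.1 hr.2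
      (hgr _ _ (hV.generatorGraph_map hxy _)))
    (fun r hr => by simp)
    t ⟨t.2, le_rfl⟩
  rw [zero_mul, norm_le_zero_iff, sub_eq_zero] at this
  simpa [hV.map_zero, hU.map_zero] using this

end IsC0Semigroup

/-- This is where n > 2 enters: e < 3, so 1 + log n can be replaced by 2 log n. -/
theorem one_le_log {n : ℕ} (hn : 2 < n) : 1 ≤ Real.log n := by
  rw [Real.le_log_iff_exp_le (by positivity)]
  have : (3 : ℝ) ≤ n := by exact_mod_cast hn
  linarith [Real.exp_one_lt_d9]

theorem sum_rpow_le_tsum {α : ℝ} (hα : 0 < α) (n : ℕ) :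
    ∑ i ∈ Finset.range n, ((i : ℝ) + 1) ^ (-1 - α) ≤ ∑' i : ℕ, ((i : ℝ) + 1) ^ (-1 - α) := by
  have h1 : Summable fun i : ℕ => (i : ℝ) ^ (-1 - α) := Real.summable_nat_rpow.2 (by linarith)
  have h2 := (summable_nat_add_iff 1).2 h1
  simp only [Nat.cast_add, Nat.cast_one] at h2
  exact h2.sum_le_tsum _ fun i _ => Real.rpow_nonneg (by positivity) _

end TrotterProduct

end

/-! ### The theorem -/

theorem theorem8p2p7 {X : Type*} [NormedAddCommGroup X] [NormedSpace ℂ X] [CompleteSpace X]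
    (θ : ℝ) (hθ0 : 0 < θ) (hθ : θ ≤ Real.pi / 2)
    (A B : X →ₗ.[ℂ] X) (T S : ℝ≥0 → X →L[ℂ] X)
    (hT : TrotterProduct.IsHolomorphicContractionSemigroup θ T)
    (hA : TrotterProduct.generator T = A)
    (hS : TrotterProduct.IsContractionSemigroup S)
    (hB : TrotterProduct.generator S = B)
    (α : ℝ) (hα0 : 0 ≤ α) (hα1 : α < 1)
    (hfrac : (TrotterProduct.dualAdjoint (TrotterProduct.fracPower T α)).domain ≤
      (TrotterProduct.dualAdjoint B).domain)
    (hdom : A.domain ≤ B.domain)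
    (hrefl : ¬ TrotterProduct.IsReflexiveSpace X →
      (TrotterProduct.dualAdjoint A).domain ≤ (TrotterProduct.dualAdjoint B).domain) :
    ∃ U : ℝ≥0 → X →L[ℂ] X,
      TrotterProduct.IsContractionSemigroup U ∧
      A + B ≤ TrotterProduct.generator U ∧
      TrotterProduct.dualAdjoint (TrotterProduct.generator U) =
        TrotterProduct.dualAdjoint A + TrotterProduct.dualAdjoint B ∧
      (∀ V : ℝ≥0 → X →L[ℂ] X, TrotterProduct.IsC0Semigroup V →
        TrotterProduct.generator V = A + B → V = U) ∧
      ∃ M₃ M₄ M₄' η : ℝ, 0 < M₃ ∧ 0 < M₄ ∧ 0 < M₄' ∧ 0 < η ∧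
        (0 < α → ∀ (t : ℝ≥0) (n : ℕ), 2 < n →
          ‖(T (t / n) * S (t / n)) ^ n - U t‖ ≤
            Real.exp (η * t) * (M₃ + M₄ * (t : ℝ) ^ (1 - α)) *
              (Real.log n / (n : ℝ) ^ (1 - α))) ∧
        (α = 0 → ∀ (t : ℝ≥0) (n : ℕ), 2 < n →
          ‖(T (t / n) * S (t / n)) ^ n - U t‖ ≤
            Real.exp (η * t) * (M₃ + M₄' * (t : ℝ)) *
              (2 * Real.log n ^ 2 / (n : ℝ))) := by
  subst hA hB
  obtain ⟨U, m, R, G, L, D, K, h⟩ :=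
    TrotterProduct.exists_isSmoothPerturbation hθ0 hT hS hα0 hα1 hfrac hdom
  refine ⟨U, h.sum, h.generator_add_le, h.dualAdjoint_generator, fun V hV hVg => ?_, ?_⟩
  · refine hV.eq_of_generator_le h.sum ?_ (hVg ▸ h.generator_add_le)
    refine h.left.dense_generator_domain.mono fun x hx => ?_
    rw [hVg]
    exact ⟨hx, hdom hx⟩
  obtain ⟨M, η, hM, hη, key⟩ := h.exists_norm_pow_sub_le
  set ζ := ∑' i : ℕ, ((i : ℝ) + 1) ^ (-1 - α) with hζ
  have hζ0 : 0 ≤ ζ := tsum_nonneg fun i => Real.rpow_nonneg (by positivity) _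
  have bound : ∀ (t : ℝ≥0) (n : ℕ), 2 < n → ∀ ℓ : ℝ,
      ∑ i ∈ Finset.range n, ((i : ℝ) + 1) ^ (-1 - α) ≤ ℓ →
      ‖(T (t / n) * S (t / n)) ^ n - U t‖ ≤
        M * Real.exp ((η + 1) * t) * (2 * Real.log n * ℓ / (n : ℝ) ^ (1 - α)) := by
    intro t n hn ℓ hℓ
    have hlog := TrotterProduct.one_le_log hn
    have hℓ0 : 0 ≤ ℓ := (Finset.sum_nonneg fun i _ => Real.rpow_nonneg (by positivity) _).trans hℓ
    -- The estimate `key` needs a positive step; at t = 0 the difference vanishes.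
    rcases eq_or_lt_of_le (show 0 ≤ t from zero_le) with rfl | ht
    · rw [zero_div, h.left.map_zero, h.right.map_zero, h.sum.map_zero, one_mul, one_pow, sub_self,
        norm_zero]
      positivity
    · have hn0 : (0 : ℝ≥0) < n := by positivity
      have h1 := key (t / n) (by positivity) n (by omega) ℓ hℓ
      have e1 : (n : ℝ) * ((t / n : ℝ≥0) : ℝ) = t := by
        push_cast
        field_simp
      rw [mul_div_cancel₀ t hn0.ne', e1] at h1
      refine h1.trans (mul_le_mul (mul_le_mul_of_nonneg_left (Real.exp_le_exp.2 ?_) hM) ?_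
        (by positivity) (by positivity))
      · exact mul_le_mul_of_nonneg_right (by linarith) t.2
      · refine div_le_div_of_nonneg_right (mul_le_mul_of_nonneg_right (by linarith) hℓ0)
          (by positivity)
  -- The growth in t is already in the exponential, so the coefficients of t^{1-α} and t may be 1.
  -- In M₃ the term 2Mζ serves α > 0 and 2M serves α = 0; the added ones ensure positivity.
  refine ⟨2 * M * ζ + 2 * M + 1, 1, 1, η + 1, by positivity, one_pos, one_pos, by positivity,
    fun hα t n hn => ?_, fun hα t n hn => ?_⟩
  · have hlog := TrotterProduct.one_le_log hn
    refine (bound t n hn ζ (TrotterProduct.sum_rpow_le_tsum hα n)).trans ?_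
    have e : M * Real.exp ((η + 1) * t) * (2 * Real.log n * ζ / (n : ℝ) ^ (1 - α)) =
        Real.exp ((η + 1) * t) * (2 * M * ζ) * (Real.log n / (n : ℝ) ^ (1 - α)) := by ring
    rw [e]
    refine mul_le_mul_of_nonneg_right (mul_le_mul_of_nonneg_left ?_ (Real.exp_nonneg _))
      (by positivity)
    have : 0 ≤ (t : ℝ) ^ (1 - α) := Real.rpow_nonneg t.2 _
    linarith
  · have hlog := TrotterProduct.one_le_log hn
    -- At α = 0 the sum is harmonic, and ℓ = 2 log n contributes the second logarithm.
    have hsum : ∑ i ∈ Finset.range n, ((i : ℝ) + 1) ^ (-1 - α) ≤ 2 * Real.log n := by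
      refine (le_of_eq (Finset.sum_congr rfl fun i _ => ?_)).trans
        ((TrotterProduct.sum_inv_le n).trans (by linarith))
      rw [hα, sub_zero, Real.rpow_neg_one, one_div]
    refine (bound t n hn _ hsum).trans ?_
    have e : M * Real.exp ((η + 1) * t) * (2 * Real.log n * (2 * Real.log n) / (n : ℝ) ^ (1 - α)) =
        Real.exp ((η + 1) * t) * (2 * M) * (2 * Real.log n ^ 2 / n) := by
      rw [hα, sub_zero, Real.rpow_one]
      ring
    rw [e]
    refine mul_le_mul_of_nonneg_right (mul_le_mul_of_nonneg_left ?_ (Real.exp_nonneg _))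
      (by positivity)
    have h1 : 0 ≤ 2 * M * ζ := by positivity
    have h2 := t.2
    linarith
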